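/- Let $\Omega\subset\mathbb R^3$ be an open ball of positive radius, let $\varepsilon_m>0$, let $a\in\mathbb R^3$ and let $z\in\mathbb R^3\setminus\overline\Omega$. For $\delta>0$ let $\varepsilon_\Omega=\varepsilon_\Omega(\delta)\in\mathbb C$ be the permittivity for which $$\lambda:=\frac{\varepsilon_\Omega+\varepsilon_m}{2(\varepsilon_\Omega-\varepsilon_m)}=i\delta ,\qquad\text{i.e.}\qquad \varepsilon_\Omega=\varepsilon_m\,\frac{2i\delta+1}{2i\delta-1},$$ so that $\varepsilon_\Omega\to-\varepsilon_m$ and $\lambda\to0$ as $\delta\to0$, where $0$ is the essential spectrum of the Neumann–Poincaré operator of $\partial\Omega$. Put $\varepsilon=\varepsilon_\Omega$ in $\Omega$ and $\varepsilon=\varepsilon_m$ in $\mathbb R^3\setminus\overline\Omega$, and consider the transmission problem $$\nabla\cdot(\varepsilon\nabla u_\delta)=a\cdot\nabla\delta_z\ \text{ in }\mathbb R^3,\qquad u_\delta(x)=O(|x|^{-2})\ \text{ as }|x|\to\infty ,$$ where $\delta_z$ is the Dirac mass at $z$; a solution is a complex-valued function $u_\delta\in L^1_{\rm loc}(\mathbb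 R^3)\cap H^1_{\rm loc}(\mathbb R^3\setminus\{z\})$ which satisfies the equation in the sense of distributions on $\mathbb R^3$. Then this problem has a solution for every $\delta>0$, and there is a constant $C$, independent of $\delta$, such that every solution $u_\delta$ satisfies $$\|\nabla u_\delta\|_{L^2(\Omega)}\le C\qquad\text{for all }\delta>0 .$$ That is, no resonance occurs at the essential spectrum on three-dimensional balls. -/

import Mathlib

open MeasureTheory
open scoped ContDiff NNReal ENNReal

/-- Euclidean three-space. -/
abbrev R3 : Type := EuclideanSpace ℝ (Fin 3)

/-- Vectors in `ℂ³` with the Hermitian norm, the values of gradients of complex-valued functions. -/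
abbrev C3 : Type := EuclideanSpace ℂ (Fin 3)

/-- The parameter `λ = (ε_Ω + ε_m) / (2 (ε_Ω - ε_m))` attached to an inclusion of (complex)
permittivity `ε_Ω` in a matrix of permittivity `ε_m`. -/
noncomputable def contrastParameter (εΩ εm : ℂ) : ℂ :=
  (εΩ + εm) / (2 * (εΩ - εm))

/-- For every `δ > 0` exactly one permittivity of the inclusion gives `λ = i δ`. -/
theorem contrastParameter_eq_iff (εΩ : ℂ) (εm δ : ℝ) (hm : 0 < εm) (hδ : 0 < δ) :
    contrastParameter εΩ εm = Complex.I * δ ↔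
      εΩ = εm * (2 * Complex.I * δ + 1) / (2 * Complex.I * δ - 1) := by
  have h1 : (2 * Complex.I * δ - 1 : ℂ) ≠ 0 := by
    intro h
    have := congrArg Complex.re h
    simp at this
  have h2 : (εm : ℂ) ≠ 0 := by exact_mod_cast hm.ne'
  have h3 : (δ : ℂ) ≠ 0 := by exact_mod_cast hδ.ne'
  unfold contrastParameter
  constructor
  · intro h
    have h4 : (2 * (εΩ - εm) : ℂ) ≠ 0 := by
      intro h0
      rw [h0, div_zero] at h
      exact mul_ne_zero Complex.I_ne_zero h3 h.symm
    rw [div_eq_iff h4] at h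
    rw [eq_div_iff h1]
    linear_combination -h
  · intro h
    have h5 : εΩ * (2 * Complex.I * δ - 1) = εm * (2 * Complex.I * δ + 1) := by
      rw [h, div_mul_cancel₀ _ h1]
    have h4 : (2 * (εΩ - εm) : ℂ) ≠ 0 := by
      intro h0
      have h6 : εΩ = εm := by linear_combination h0 / 2
      rw [h6] at h5
      have : (εm : ℂ) = 0 := by linear_combination -h5 / 2
      exact h2 this
    rw [div_eq_iff h4]
    linear_combination -h5

/-- Real-valued test functions on the open set `U`. -/
def IsTestFunction (U : Set R3) (φ : R3 → ℝ) : Prop :=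
  ContDiff ℝ ∞ φ ∧ HasCompactSupport φ ∧ tsupport φ ⊆ U

/-- The partial derivative `∂φ/∂xᵢ`. -/
noncomputable def partialDeriv (i : Fin 3) (φ : R3 → ℝ) (x : R3) : ℝ :=
  fderiv ℝ φ x (EuclideanSpace.single i 1)

/-- `g` is the weak gradient of `u` on the open set `U`. -/
def HasWeakGradientOn (U : Set R3) (u : R3 → ℂ) (g : R3 → C3) : Prop :=
  LocallyIntegrableOn u U ∧ LocallyIntegrableOn g U ∧
    ∀ φ : R3 → ℝ, IsTestFunction U φ → ∀ i : Fin 3,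
      ∫ x, u x * (partialDeriv i φ x : ℂ) = -∫ x, g x i * (φ x : ℂ)

/-- `u`, with gradient `g`, is a (weak) solution of the transmission problem
`∇ · ε ∇u = a · ∇δ_z` in `ℝ³`, `u(x) = O(|x|⁻²)` as `|x| → ∞`, where `ε = ε_Ω` in `Ω` and
`ε = ε_m` outside the closure of `Ω`, and where `z` is outside the closure of `Ω`.

`u` is a locally integrable function on `ℝ³` which is of class `H¹_loc` away from the source point
`z` (at `z` itself the gradient is too singular to be locally integrable), and the equation holds
in the sense of distributions on the whole of `ℝ³`. There `ε ∇u = ε_m ∇u + (ε_Ω - ε_m) 1_Ω ∇u`, so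
`⟨∇ · ε ∇u, φ⟩ = ε_m ∫ u Δφ - (ε_Ω - ε_m) ∫_Ω ∇u · ∇φ`, and `⟨a · ∇δ_z, φ⟩ = - a · ∇φ(z)`. -/
structure IsTransmissionSolution (Ω : Set R3) (εΩ εm : ℂ) (a z : R3)
    (u : R3 → ℂ) (g : R3 → C3) : Prop where
  locallyIntegrable : LocallyIntegrable u
  weakGradient : HasWeakGradientOn {z}ᶜ u g
  locallySquareIntegrable : ∀ K : Set R3, IsCompact K → K ⊆ {z}ᶜ →
    MemLp g 2 (volume.restrict K)
  equation : ∀ φ : R3 → ℝ, IsTestFunction Set.univ φ →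
    εm * (∫ x, u x * (Laplacian.laplacian φ x : ℂ))
      - (εΩ - εm) * (∫ x in Ω, ∑ i : Fin 3, g x i * (partialDeriv i φ x : ℂ))
      = -((fderiv ℝ φ z a : ℝ) : ℂ)
  decay : ∃ M R : ℝ, ∀ᵐ x : R3, R ≤ ‖x‖ → ‖u x‖ ≤ M / ‖x‖ ^ 2

open Filter Topology

/-! Write `s = ε_m / (ε_Ω + ε_m)`. The condition `λ = iδ` says `s = 1/2 + i/(4δ)`, so `s` runs along
the line `Re s = 1/2` and tends to infinity as `δ → 0`. The claim becomes a bound that is uniform on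
this line.

Existence. Let `u₀` be the field of the dipole in the homogeneous medium, and look for a solution
`u₀ + h` inside and `u₀ + w` outside. On a sphere the choice of `w` is explicit: it is the Kelvin
transform of `h`, which is harmonic outside, equals `h` on the sphere and has radial derivative
`x·∇w = -h - x·∇h` there (center at the origin). Continuity of the flux then reduces to the Euler
equation `x·∇h + s h = (2s - 1) x·∇u₀`, which can be imposed at every point. Its solution is `h =
(2s - 1)(u₀ - s J)` with `J(x) = ∫₀¹ t^(s-1) u₀(tx) dt`, and `h` is harmonic in the ball because
`u₀` is. It vanishes at the center, whence `w = O(|x|⁻²)`.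

Uniformity. On homogeneous harmonic polynomials of degree `n` the map from `u₀` to `h` is
multiplication by `(2s - 1) n / (n + s)`, at most `2n` in modulus when `Re s = 1/2`. So `h` costs
derivatives of `u₀` but nothing in `s`, and `u₀` is smooth up to the sphere because the source is at
positive distance. The proof does this without spherical harmonics: `rayIntegral_ode` lets a factor
`s` be traded for one derivative (`norm_mul_rayIntegral_le`), and `exists_isTransmissionPair` gives
a pointwise gradient bound with one constant for the whole line.

Uniqueness. The difference of two solutions solves the problem without source. It is tested against
the fields just constructed, now with the Newtonian potential of an arbitrary `ψ` supported outside
the closed ball as incident field. `IsHomogeneousSolution.duality` and a cutoff at infinity give `∫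
u ψ = 0`, so `u` vanishes outside; the equation then says `ε_Ω Δu = 0` near the closed ball, and
testing with Newtonian potentials again gives `u = 0` inside. Hence every solution has in the ball
the gradient of the constructed one, and inherits its bound. -/

/-! ### Coordinate calculus for complex-valued functions. -/

/-- The partial derivative of a complex-valued function. -/
noncomputable def pd (i : Fin 3) (F : R3 → ℂ) (x : R3) : ℂ :=
  fderiv ℝ F x (EuclideanSpace.single i 1)

/-- The Laplacian of a complex-valued function, in coordinates. -/
noncomputable def lap (F : R3 → ℂ) (x : R3) : ℂ := ∑ i, pd i (pd i F) x

theorem ContDiff.pd {F : R3 → ℂ} (hF : ContDiff ℝ ∞ F) (i : Fin 3) : ContDiff ℝ ∞ (pd i F) := by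
  have h : ContDiff ℝ ∞ (fderiv ℝ F) := hF.fderiv_right (by simp)
  exact h.clm_apply contDiff_const

theorem ContDiff.lap {F : R3 → ℂ} (hF : ContDiff ℝ ∞ F) : ContDiff ℝ ∞ (lap F) :=
  ContDiff.sum fun i _ => (hF.pd i).pd i

theorem ContDiff.differentiableAt_top {F : R3 → ℂ} (hF : ContDiff ℝ ∞ F) (x : R3) :
    DifferentiableAt ℝ F x :=
  hF.contDiffAt.differentiableAt (by simp)

theorem pd_congr {F G : R3 → ℂ} {x : R3} (i : Fin 3) (h : F =ᶠ[nhds x] G) : pd i F x = pd i G x := by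
  rw [pd, pd, h.fderiv_eq]

theorem pd_eventuallyEq {F G : R3 → ℂ} {x : R3} (i : Fin 3) (h : F =ᶠ[nhds x] G) :
    pd i F =ᶠ[nhds x] pd i G := by
  filter_upwards [h.eventuallyEq_nhds] with y hy using pd_congr i hy

theorem lap_congr {F G : R3 → ℂ} {x : R3} (h : F =ᶠ[nhds x] G) : lap F x = lap G x :=
  Finset.sum_congr rfl fun i _ => pd_congr i (pd_eventuallyEq i h)

theorem pd_add {F G : R3 → ℂ} {x : R3} (i : Fin 3) (hF : DifferentiableAt ℝ F x)
    (hG : DifferentiableAt ℝ G x) : pd i (fun y => F y + G y) x = pd i F x + pd i G x := by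
  simp [pd, fderiv_fun_add hF hG]

theorem pd_sub {F G : R3 → ℂ} {x : R3} (i : Fin 3) (hF : DifferentiableAt ℝ F x)
    (hG : DifferentiableAt ℝ G x) : pd i (fun y => F y - G y) x = pd i F x - pd i G x := by
  simp [pd, fderiv_fun_sub hF hG]

theorem pd_mul {F G : R3 → ℂ} {x : R3} (i : Fin 3) (hF : DifferentiableAt ℝ F x)
    (hG : DifferentiableAt ℝ G x) :
    pd i (fun y => F y * G y) x = F x * pd i G x + pd i F x * G x := by
  simp [pd, fderiv_fun_mul hF hG, mul_comm]

theorem pd_const (i : Fin 3) (a : ℂ) (x : R3) : pd i (fun _ => a) x = 0 := by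
  simp [pd]

theorem pd_const_mul {F : R3 → ℂ} {x : R3} (i : Fin 3) (a : ℂ) (hF : DifferentiableAt ℝ F x) :
    pd i (fun y => a * F y) x = a * pd i F x := by
  simp [pd, fderiv_const_mul hF]

theorem pd_sum {ι : Type*} {F : ι → R3 → ℂ} {x : R3} (s : Finset ι) (i : Fin 3)
    (hF : ∀ j ∈ s, DifferentiableAt ℝ (F j) x) :
    pd i (fun y => ∑ j ∈ s, F j y) x = ∑ j ∈ s, pd i (F j) x := by
  simp [pd, fderiv_fun_sum hF]

theorem pd_comp_sub (F : R3 → ℂ) (i : Fin 3) (c x : R3) :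
    pd i (fun y => F (y - c)) x = pd i F (x - c) := by
  simp [pd, fderiv_comp_sub]

theorem lap_comp_sub (F : R3 → ℂ) (c x : R3) : lap (fun y => F (y - c)) x = lap F (x - c) := by
  have h (i : Fin 3) : pd i (fun y => F (y - c)) = fun y => pd i F (y - c) :=
    funext (pd_comp_sub F i c)
  simp only [lap, h, pd_comp_sub]

theorem pd_ofReal {φ : R3 → ℝ} {x : R3} (i : Fin 3) (hφ : DifferentiableAt ℝ φ x) :
    pd i (fun y => (φ y : ℂ)) x = (partialDeriv i φ x : ℂ) := by
  have := (Complex.ofRealCLM.hasFDerivAt.comp x hφ.hasFDerivAt).fderiv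
  simp only [pd, partialDeriv]
  have h2 : (fun y => (φ y : ℂ)) = Complex.ofRealCLM ∘ φ := rfl
  rw [h2, this]; simp

theorem pd_coord (i j : Fin 3) (x : R3) :
    pd i (fun y => ((y j : ℝ) : ℂ)) x = if i = j then 1 else 0 := by
  have h : HasFDerivAt (fun y : R3 => y j) (EuclideanSpace.proj j : R3 →L[ℝ] ℝ) x :=
    (EuclideanSpace.proj j : R3 →L[ℝ] ℝ).hasFDerivAt
  rw [pd_ofReal i h.differentiableAt, partialDeriv, h.fderiv]
  by_cases hij : i = j
  · subst hij; simp
  · simp [hij, Ne.symm hij]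

theorem contDiff_ofReal_comp {φ : R3 → ℝ} (hφ : ContDiff ℝ ∞ φ) :
    ContDiff ℝ ∞ fun y => (φ y : ℂ) :=
  Complex.ofRealCLM.contDiff.comp hφ

theorem contDiff_coord (j : Fin 3) : ContDiff ℝ ∞ fun y : R3 => ((y j : ℝ) : ℂ) :=
  contDiff_ofReal_comp (EuclideanSpace.proj j : R3 →L[ℝ] ℝ).contDiff

theorem contDiff_coord_sub (c : R3) (j : Fin 3) :
    ContDiff ℝ ∞ fun y : R3 => (((y - c) j : ℝ) : ℂ) :=
  (contDiff_coord j).comp (contDiff_id.sub contDiff_const)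

theorem fderiv_apply_eq_sum {F : R3 → ℂ} (x y : R3) :
    fderiv ℝ F x y = ∑ i, ((y i : ℝ) : ℂ) * pd i F x := by
  have h : y = ∑ i, y i • (EuclideanSpace.single i (1 : ℝ) : R3) := by
    ext j; simp [Finset.sum_apply, Pi.single_apply]
  conv_lhs => rw [h]
  simp [pd]

theorem pd_comm {F : R3 → ℂ} (hF : ContDiff ℝ ∞ F) (i j : Fin 3) (x : R3) :
    pd i (pd j F) x = pd j (pd i F) x := by
  have hd : DifferentiableAt ℝ (fderiv ℝ F) x :=
    (hF.fderiv_right (m := ∞) (by simp)).contDiffAt.differentiableAt (by simp)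
  have h (j : Fin 3) : HasFDerivAt (pd j F) ((fderiv ℝ (fderiv ℝ F) x).flip
      (EuclideanSpace.single j 1)) x := by
    have := hd.hasFDerivAt.clm_apply (hasFDerivAt_const (EuclideanSpace.single j (1 : ℝ)) x)
    rw [ContinuousLinearMap.comp_zero, zero_add] at this
    exact this
  have hs : IsSymmSndFDerivAt ℝ F x :=
    hF.contDiffAt.isSymmSndFDerivAt (by simp; exact WithTop.coe_le_coe.2 (le_top (a := (2 : ℕ∞))))
  rw [pd, (h j).fderiv, pd, (h i).fderiv]
  simpa using hs _ _

theorem lap_add {F G : R3 → ℂ} (hF : ContDiff ℝ ∞ F) (hG : ContDiff ℝ ∞ G) (x : R3) :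
    lap (fun y => F y + G y) x = lap F x + lap G x := by
  have h (i : Fin 3) : pd i (fun y => F y + G y) = fun y => pd i F y + pd i G y :=
    funext fun y => pd_add i (hF.differentiableAt_top y) (hG.differentiableAt_top y)
  simp only [lap, h, ← Finset.sum_add_distrib]
  exact Finset.sum_congr rfl fun i _ =>
    pd_add i ((hF.pd i).differentiableAt_top x) ((hG.pd i).differentiableAt_top x)

theorem lap_const_mul {F : R3 → ℂ} (a : ℂ) (hF : ContDiff ℝ ∞ F) (x : R3) :
    lap (fun y => a * F y) x = a * lap F x := by
  have h (i : Fin 3) : pd i (fun y => a * F y) = fun y => a * pd i F y :=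
    funext fun y => pd_const_mul i a (hF.differentiableAt_top y)
  simp only [lap, h, Finset.mul_sum]
  exact Finset.sum_congr rfl fun i _ => pd_const_mul i a ((hF.pd i).differentiableAt_top x)

theorem lap_sub {F G : R3 → ℂ} (hF : ContDiff ℝ ∞ F) (hG : ContDiff ℝ ∞ G) (x : R3) :
    lap (fun y => F y - G y) x = lap F x - lap G x := by
  have := lap_add hF (contDiff_const.mul hG : ContDiff ℝ ∞ fun y => (-1 : ℂ) * G y) x
  rw [lap_const_mul _ hG] at this
  simpa [sub_eq_add_neg] using this

theorem lap_mul {F G : R3 → ℂ} (hF : ContDiff ℝ ∞ F) (hG : ContDiff ℝ ∞ G) (x : R3) :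
    lap (fun y => F y * G y) x =
      F x * lap G x + 2 * (∑ i, pd i F x * pd i G x) + G x * lap F x := by
  have h (i : Fin 3) : pd i (fun y => F y * G y) = fun y => F y * pd i G y + pd i F y * G y :=
    funext fun y => pd_mul i (hF.differentiableAt_top y) (hG.differentiableAt_top y)
  simp only [lap, h, Finset.mul_sum, ← Finset.sum_add_distrib]
  refine Finset.sum_congr rfl fun i _ => ?_
  rw [pd_add i ((hF.mul (hG.pd i)).differentiableAt_top x)
      (((hF.pd i).mul hG).differentiableAt_top x),
    pd_mul i (hF.differentiableAt_top x) ((hG.pd i).differentiableAt_top x),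
    pd_mul i ((hF.pd i).differentiableAt_top x) (hG.differentiableAt_top x)]
  ring

/-- Links the Laplacian in the definition of a solution with the coordinate one used in all
computations, through the standard orthonormal basis. -/
theorem laplacian_ofReal {φ : R3 → ℝ} (hφ : ContDiff ℝ ∞ φ) (x : R3) :
    ((Laplacian.laplacian φ x : ℝ) : ℂ) = lap (fun y => (φ y : ℂ)) x := by
  rw [InnerProductSpace.laplacian_eq_iteratedFDeriv_orthonormalBasis φ
    (EuclideanSpace.basisFun (Fin 3) ℝ)]
  have hF := contDiff_ofReal_comp hφ
  have h1 (i : Fin 3) : pd i (fun y => (φ y : ℂ)) = fun y => ((partialDeriv i φ y : ℝ) : ℂ) :=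
    funext fun y => pd_ofReal i (hφ.contDiffAt.differentiableAt (by simp))
  have hd : ContDiff ℝ ∞ (fderiv ℝ φ) := hφ.fderiv_right (by simp)
  simp only [lap, h1]
  push_cast
  refine Finset.sum_congr rfl fun i _ => ?_
  have h2 : DifferentiableAt ℝ (partialDeriv i φ) x :=
    (hd.clm_apply contDiff_const).contDiffAt.differentiableAt (n := ∞) (by simp)
  rw [pd_ofReal i h2, iteratedFDeriv_two_apply]
  congr 1
  have := (hd.contDiffAt.differentiableAt (x := x) (by simp)).hasFDerivAt.clm_apply
    (hasFDerivAt_const (EuclideanSpace.single i (1 : ℝ)) x)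
  have h3 : partialDeriv i φ = fun y => fderiv ℝ φ y (EuclideanSpace.single i 1) := rfl
  conv_rhs => rw [h3, partialDeriv, this.fderiv]
  simp

theorem tsupport_pd_subset (i : Fin 3) (F : R3 → ℂ) : tsupport (pd i F) ⊆ tsupport F :=
  tsupport_fderiv_apply_subset ℝ _

theorem HasCompactSupport.pd {F : R3 → ℂ} (hF : HasCompactSupport F) (i : Fin 3) :
    HasCompactSupport (pd i F) :=
  hF.fderiv_apply (𝕜 := ℝ) _

theorem tsupport_lap_subset (F : R3 → ℂ) : tsupport (lap F) ⊆ tsupport F := by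
  refine closure_minimal (fun x hx => ?_) (isClosed_tsupport F)
  by_contra h
  apply hx
  refine Finset.sum_eq_zero fun i _ => ?_
  exact image_eq_zero_of_notMem_tsupport fun h' =>
    h (tsupport_pd_subset i F (tsupport_pd_subset i _ h'))

theorem HasCompactSupport.lap {F : R3 → ℂ} (hF : HasCompactSupport F) :
    HasCompactSupport (lap F) :=
  IsCompact.of_isClosed_subset hF (isClosed_tsupport _) (tsupport_lap_subset F)

/-! ### Integration by parts with compact support. -/

theorem integrable_mul_of_tsupport_subset {U : Set R3} {u φ : R3 → ℂ}
    (hu : LocallyIntegrableOn u U) (hφ : Continuous φ) (hc : HasCompactSupport φ)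
    (hs : tsupport φ ⊆ U) : Integrable fun x => u x * φ x := by
  have h1 : IntegrableOn u (tsupport φ) := hu.integrableOn_compact_subset hs hc
  have h2 : IntegrableOn (fun x => u x * φ x) (tsupport φ) :=
    h1.mul_continuousOn hφ.continuousOn hc
  rwa [integrableOn_iff_integrable_of_support_subset] at h2
  intro x hx
  exact subset_tsupport φ fun h => hx (by simp [h])

theorem integral_pd_eq_zero {F : R3 → ℂ} (hF : ContDiff ℝ ∞ F) (hc : HasCompactSupport F)
    (i : Fin 3) : ∫ x, pd i F x = 0 := by
  have h := integral_mul_fderiv_eq_neg_fderiv_mul_of_integrable (μ := (volume : Measure R3))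
    (f := fun _ => (1 : ℂ)) (g := F) (v := EuclideanSpace.single i 1)
    (by simp) (by simp only [one_mul]
                  exact (hF.pd i).continuous.integrable_of_hasCompactSupport (hc.pd i))
    (by simp only [one_mul]; exact hF.continuous.integrable_of_hasCompactSupport hc)
    (fun _ _ => differentiableAt_const _) (fun x _ => hF.differentiableAt_top x)
  simp only [one_mul, fderiv_fun_const, Pi.zero_apply, zero_mul, integral_zero, neg_zero,
    zero_apply] at h
  exact h

theorem integral_mul_pd {F G : R3 → ℂ} (hF : ContDiff ℝ ∞ F) (hG : ContDiff ℝ ∞ G)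
    (hc : HasCompactSupport G) (i : Fin 3) : ∫ x, F x * pd i G x = -∫ x, pd i F x * G x := by
  have h := integral_pd_eq_zero (hF.mul hG) hc.mul_left i
  simp_rw [pd_mul i (hF.differentiableAt_top _) (hG.differentiableAt_top _)] at h
  rw [integral_add] at h
  · exact eq_neg_of_add_eq_zero_left h
  · exact (hF.mul (hG.pd i)).continuous.integrable_of_hasCompactSupport (hc.pd i).mul_left
  · exact ((hF.pd i).mul hG).continuous.integrable_of_hasCompactSupport hc.mul_left

theorem integral_mul_lap {F G : R3 → ℂ} (hF : ContDiff ℝ ∞ F) (hG : ContDiff ℝ ∞ G)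
    (hc : HasCompactSupport G) : ∫ x, F x * lap G x = ∫ x, lap F x * G x := by
  simp only [lap, Finset.mul_sum, Finset.sum_mul]
  rw [integral_finsetSum, integral_finsetSum]
  · refine Finset.sum_congr rfl fun i _ => ?_
    rw [integral_mul_pd hF (hG.pd i) (hc.pd i), integral_mul_pd (hF.pd i) hG hc, neg_neg]
  · exact fun i _ => (((hF.pd i).pd i).mul hG).continuous.integrable_of_hasCompactSupport
      hc.mul_left
  · exact fun i _ => (hF.mul ((hG.pd i).pd i)).continuous.integrable_of_hasCompactSupport
      ((hc.pd i).pd i).mul_left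

/-! ### Complex-valued test functions. -/

/-- Complex-valued test functions on the open set `U`. -/
def IsComplexTest (U : Set R3) (φ : R3 → ℂ) : Prop :=
  ContDiff ℝ ∞ φ ∧ HasCompactSupport φ ∧ tsupport φ ⊆ U

theorem IsTestFunction.complex {U : Set R3} {φ : R3 → ℝ} (h : IsTestFunction U φ) :
    IsComplexTest U fun x => (φ x : ℂ) := by
  have hs : Function.support (fun x => (φ x : ℂ)) = Function.support φ := by ext; simp
  refine ⟨contDiff_ofReal_comp h.1, ?_, ?_⟩
  · rw [HasCompactSupport, tsupport, hs]; exact h.2.1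
  · rw [tsupport, hs]; exact h.2.2

theorem IsComplexTest.re {U : Set R3} {φ : R3 → ℂ} (h : IsComplexTest U φ) :
    IsTestFunction U fun x => (φ x).re := by
  refine ⟨Complex.reCLM.contDiff.comp h.1, h.2.1.comp_left (g := Complex.re) rfl, ?_⟩
  exact (tsupport_comp_subset (g := Complex.re) rfl φ).trans h.2.2

theorem IsComplexTest.im {U : Set R3} {φ : R3 → ℂ} (h : IsComplexTest U φ) :
    IsTestFunction U fun x => (φ x).im := by
  refine ⟨Complex.imCLM.contDiff.comp h.1, h.2.1.comp_left (g := Complex.im) rfl, ?_⟩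
  exact (tsupport_comp_subset (g := Complex.im) rfl φ).trans h.2.2

theorem pd_re_im {φ : R3 → ℂ} (hφ : ContDiff ℝ ∞ φ) (i : Fin 3) (x : R3) :
    pd i φ x = (partialDeriv i (fun x => (φ x).re) x : ℂ)
      + Complex.I * (partialDeriv i (fun x => (φ x).im) x : ℂ) := by
  have h1 : ContDiff ℝ ∞ fun x => (φ x).re := Complex.reCLM.contDiff.comp hφ
  have h2 : ContDiff ℝ ∞ fun x => (φ x).im := Complex.imCLM.contDiff.comp hφ
  rw [← pd_ofReal i (h1.contDiffAt.differentiableAt (by simp)),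
    ← pd_ofReal i (h2.contDiffAt.differentiableAt (by simp)),
    ← pd_const_mul i _ ((contDiff_ofReal_comp h2).differentiableAt_top x),
    ← pd_add i ((contDiff_ofReal_comp h1).differentiableAt_top x)
      ((contDiff_const.mul (contDiff_ofReal_comp h2)).differentiableAt_top x)]
  congr 1
  ext y
  rw [mul_comm, Complex.re_add_im]

theorem HasWeakGradientOn.integrable_grad_mul {U : Set R3} {u : R3 → ℂ} {g : R3 → C3}
    (h : HasWeakGradientOn U u g) (i : Fin 3) : LocallyIntegrableOn (fun x => g x i) U := by
  intro x hx
  obtain ⟨s, hs, hs'⟩ := h.2.1 x hx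
  refine ⟨s, hs, ?_⟩
  exact (EuclideanSpace.proj i : C3 →L[ℂ] ℂ).integrable_comp hs'

theorem HasWeakGradientOn.complex {U : Set R3} {u : R3 → ℂ} {g : R3 → C3}
    (h : HasWeakGradientOn U u g) {φ : R3 → ℂ} (hφ : IsComplexTest U φ) (i : Fin 3) :
    ∫ x, u x * pd i φ x = -∫ x, g x i * φ x := by
  have hr := hφ.re
  have hm := hφ.im
  have hpr : ∀ x, pd i (fun x => ((φ x).re : ℂ)) x = _ := fun x =>
    pd_ofReal i (hr.1.contDiffAt.differentiableAt (x := x) (by simp))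
  have hpm : ∀ x, pd i (fun x => ((φ x).im : ℂ)) x = _ := fun x =>
    pd_ofReal i (hm.1.contDiffAt.differentiableAt (x := x) (by simp))
  have i1 := integrable_mul_of_tsupport_subset h.1 (hr.complex.1.pd i).continuous
    (hr.complex.2.1.pd i) ((tsupport_pd_subset i _).trans hr.complex.2.2)
  have i2 := integrable_mul_of_tsupport_subset h.1 (hm.complex.1.pd i).continuous
    (hm.complex.2.1.pd i) ((tsupport_pd_subset i _).trans hm.complex.2.2)
  simp_rw [hpr] at i1
  simp_rw [hpm] at i2
  have i3 := integrable_mul_of_tsupport_subset (h.integrable_grad_mul i) hr.complex.1.continuous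
    hr.complex.2.1 hr.complex.2.2
  have i4 := integrable_mul_of_tsupport_subset (h.integrable_grad_mul i) hm.complex.1.continuous
    hm.complex.2.1 hm.complex.2.2
  have e1 : ∀ x, u x * pd i φ x = u x * (partialDeriv i (fun x => (φ x).re) x : ℂ)
      + Complex.I * (u x * (partialDeriv i (fun x => (φ x).im) x : ℂ)) := fun x => by
    rw [pd_re_im hφ.1]; ring
  have e2 : ∀ x, g x i * φ x = g x i * ((φ x).re : ℂ) + Complex.I * (g x i * ((φ x).im : ℂ)) :=
    fun x => by
      conv_lhs => rw [← Complex.re_add_im (φ x)]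
      ring
  simp_rw [e1, e2]
  rw [integral_add i1 (i2.const_mul _), integral_add i3 (i4.const_mul _), integral_const_mul,
    integral_const_mul, h.2.2 _ hr i, h.2.2 _ hm i]
  ring

/-- The bilinear form of the transmission problem. -/
noncomputable def transmissionForm (Ω : Set R3) (εΩ εm : ℂ) (u : R3 → ℂ) (g : R3 → C3)
    (φ : R3 → ℂ) : ℂ :=
  εm * (∫ x, u x * lap φ x) - (εΩ - εm) * (∫ x in Ω, ∑ i : Fin 3, g x i * pd i φ x)

/-- Both sides are complex linear in the test function, so real and imaginary parts can be treated
separately. Complex test functions are needed because the fields used for duality depend on the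
complex parameter `s`. -/
theorem IsTransmissionSolution.complex {Ω : Set R3} {εΩ εm : ℂ} {a z : R3} {u : R3 → ℂ}
    {g : R3 → C3} (h : IsTransmissionSolution Ω εΩ εm a z u g)
    (hg : ∀ i, IntegrableOn (fun x => g x i) Ω) {φ : R3 → ℂ} (hφ : IsComplexTest Set.univ φ) :
    transmissionForm Ω εΩ εm u g φ = -fderiv ℝ φ z a := by
  have hr := hφ.re
  have hm := hφ.im
  have hpr : ∀ i x, pd i (fun x => ((φ x).re : ℂ)) x = _ := fun i x =>
    pd_ofReal i (hr.1.contDiffAt.differentiableAt (x := x) (by simp))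
  have hpm : ∀ i x, pd i (fun x => ((φ x).im : ℂ)) x = _ := fun i x =>
    pd_ofReal i (hm.1.contDiffAt.differentiableAt (x := x) (by simp))
  have key : ∀ ψ : R3 → ℝ, IsTestFunction Set.univ ψ →
      Integrable (fun x => u x * lap (fun x => (ψ x : ℂ)) x) ∧
      IntegrableOn (fun x => ∑ i : Fin 3, g x i * pd i (fun x => (ψ x : ℂ)) x) Ω ∧
      transmissionForm Ω εΩ εm u g (fun x => (ψ x : ℂ)) = -((fderiv ℝ ψ z a : ℝ) : ℂ) := by
    intro ψ hψ
    refine ⟨integrable_mul_of_tsupport_subset (U := Set.univ)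
      (h.locallyIntegrable.locallyIntegrableOn _) hψ.complex.1.lap.continuous
      hψ.complex.2.1.lap (by simp), ?_, ?_⟩
    · refine integrable_finsetSum _ fun i _ => ?_
      obtain ⟨C, hC⟩ := (hψ.complex.2.1.pd i).exists_bound_of_continuous
        (hψ.complex.1.pd i).continuous
      exact (hg i).mul_bdd (c := C) (hψ.complex.1.pd i).continuous.aestronglyMeasurable
        (Filter.Eventually.of_forall hC)
    · rw [← h.equation ψ hψ, transmissionForm]
      simp_rw [laplacian_ofReal hψ.1,
        pd_ofReal _ (hψ.1.contDiffAt.differentiableAt (by simp : (∞ : WithTop ℕ∞) ≠ 0))]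
  obtain ⟨i1, i2, e1⟩ := key _ hr
  obtain ⟨i3, i4, e2⟩ := key _ hm
  have hsum : φ = fun x => ((φ x).re : ℂ) + Complex.I * ((φ x).im : ℂ) := by
    ext x; rw [mul_comm, Complex.re_add_im]
  have hp : ∀ i x, pd i φ x = pd i (fun x => ((φ x).re : ℂ)) x
      + Complex.I * pd i (fun x => ((φ x).im : ℂ)) x := fun i x => by
    rw [pd_re_im hφ.1, hpr, hpm]
  have hl : ∀ x, lap φ x = lap (fun x => ((φ x).re : ℂ)) x
      + Complex.I * lap (fun x => ((φ x).im : ℂ)) x := fun x => by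
    conv_lhs => rw [hsum]
    rw [lap_add hr.complex.1 (contDiff_const.mul hm.complex.1), lap_const_mul _ hm.complex.1]
  have hf : fderiv ℝ φ z a = ((fderiv ℝ (fun x => (φ x).re) z a : ℝ) : ℂ)
      + Complex.I * ((fderiv ℝ (fun x => (φ x).im) z a : ℝ) : ℂ) := by
    have d := (hφ.1.differentiableAt_top z).hasFDerivAt
    have d1 : HasFDerivAt (fun x => (φ x).re) _ z := Complex.reCLM.hasFDerivAt.comp z d
    have d2 : HasFDerivAt (fun x => (φ x).im) _ z := Complex.imCLM.hasFDerivAt.comp z d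
    rw [d1.fderiv, d2.fderiv]
    simp only [ContinuousLinearMap.comp_apply, Complex.reCLM_apply, Complex.imCLM_apply]
    rw [mul_comm, Complex.re_add_im]
  rw [hf, neg_add, ← mul_neg, ← e1, ← e2]
  have j1 : ∀ x, u x * lap φ x = u x * lap (fun x => ((φ x).re : ℂ)) x
      + Complex.I * (u x * lap (fun x => ((φ x).im : ℂ)) x) := fun x => by rw [hl]; ring
  have j2 : ∀ x, ∑ i, g x i * pd i φ x = ∑ i, g x i * pd i (fun x => ((φ x).re : ℂ)) x
      + Complex.I * ∑ i, g x i * pd i (fun x => ((φ x).im : ℂ)) x := fun x => by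
    rw [Finset.mul_sum, ← Finset.sum_add_distrib]
    exact Finset.sum_congr rfl fun i _ => by rw [hp]; ring
  simp_rw [transmissionForm, j1, j2]
  rw [integral_add i1 (i3.const_mul _), integral_add i2 (i4.const_mul _), integral_const_mul,
    integral_const_mul]
  ring

/-! ### Radial cutoffs and Green's formula on a ball. -/

theorem deriv_smoothTransition_eq_zero {t : ℝ} (ht : t ∉ Set.Icc (0 : ℝ) 1) :
    deriv Real.smoothTransition t = 0 := by
  rcases lt_or_ge t 0 with h | h
  · have : Real.smoothTransition =ᶠ[𝓝 t] fun _ => 0 := by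
      filter_upwards [gt_mem_nhds h] with s hs using Real.smoothTransition.zero_of_nonpos hs.le
    rw [this.deriv_eq, deriv_const]
  · have h1 : 1 < t := by
      by_contra h'
      exact ht ⟨h, not_lt.1 h'⟩
    have : Real.smoothTransition =ᶠ[𝓝 t] fun _ => 1 := by
      filter_upwards [lt_mem_nhds h1] with s hs using Real.smoothTransition.one_of_one_le hs.le
    rw [this.deriv_eq, deriv_const]

theorem exists_deriv_smoothTransition_bound :
    ∃ M : ℝ, 0 ≤ M ∧ ∀ t, |deriv Real.smoothTransition t| ≤ M := by
  have h : Continuous (deriv Real.smoothTransition) :=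
    (Real.smoothTransition.contDiff (n := 1)).continuous_deriv (by simp)
  have hc : HasCompactSupport (deriv Real.smoothTransition) :=
    HasCompactSupport.intro isCompact_Icc fun t ht => deriv_smoothTransition_eq_zero ht
  obtain ⟨M, hM⟩ := hc.exists_bound_of_continuous h
  exact ⟨M, (norm_nonneg _).trans (hM 0), hM⟩

/-- Smooth radial cutoffs, supported in the ball and increasing to its indicator function. -/
noncomputable def ballCutoff (c : R3) (r : ℝ) (n : ℕ) (x : R3) : ℂ :=
  (Real.smoothTransition (n * (r ^ 2 - ‖x - c‖ ^ 2) - 1) : ℝ)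

/-- The radial profile of the gradient of `ballCutoff`. -/
noncomputable def ballCutoffDeriv (c : R3) (r : ℝ) (n : ℕ) (x : R3) : ℝ :=
  n * deriv Real.smoothTransition (n * (r ^ 2 - ‖x - c‖ ^ 2) - 1)

theorem ballCutoff_contDiff (c : R3) (r : ℝ) (n : ℕ) : ContDiff ℝ ∞ (ballCutoff c r n) := by
  refine contDiff_ofReal_comp ((Real.smoothTransition.contDiff (n := ⊤)).comp ?_)
  exact (contDiff_const.mul (contDiff_const.sub
    ((contDiff_id.sub contDiff_const).norm_sq ℝ))).sub contDiff_const

theorem pd_ballCutoff (c : R3) (r : ℝ) (n : ℕ) (i : Fin 3) (x : R3) :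
    pd i (ballCutoff c r n) x = -2 * (((x - c) i : ℝ) : ℂ) * (ballCutoffDeriv c r n x : ℂ) := by
  have h1 : HasFDerivAt (fun y : R3 => (n : ℝ) * (r ^ 2 - ‖y - c‖ ^ 2) - 1)
      _ x :=
    ((((hasFDerivAt_id x).sub_const c).norm_sq.const_sub (r ^ 2)).const_mul (n : ℝ)).sub_const 1
  have h2 : HasDerivAt Real.smoothTransition (deriv Real.smoothTransition
      (n * (r ^ 2 - ‖x - c‖ ^ 2) - 1)) (n * (r ^ 2 - ‖x - c‖ ^ 2) - 1) :=
    ((Real.smoothTransition.contDiff (n := 1)).differentiable (by simp) _).hasDerivAt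
  have h3 := h2.comp_hasFDerivAt x h1
  rw [Function.comp_def] at h3
  have h4 := pd_ofReal i h3.differentiableAt
  rw [show ballCutoff c r n = fun y =>
    ((Real.smoothTransition (n * (r ^ 2 - ‖y - c‖ ^ 2) - 1) : ℝ) : ℂ) from rfl, h4, partialDeriv,
    h3.fderiv]
  simp [ballCutoffDeriv, EuclideanSpace.inner_single_right]
  ring

theorem ballCutoff_norm_le (c : R3) (r : ℝ) (n : ℕ) (x : R3) : ‖ballCutoff c r n x‖ ≤ 1 := by
  rw [ballCutoff, Complex.norm_real, Real.norm_of_nonneg (Real.smoothTransition.nonneg _)]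
  exact Real.smoothTransition.le_one _

theorem tsupport_ballCutoff (c : R3) {r : ℝ} (hr : 0 < r) (n : ℕ) :
    tsupport (ballCutoff c r n) ⊆ Metric.ball c r := by
  have hcl : IsClosed {x : R3 | 1 ≤ n * (r ^ 2 - ‖x - c‖ ^ 2)} :=
    isClosed_le continuous_const (by fun_prop)
  refine (closure_minimal (fun x hx => ?_) hcl).trans fun x hx => ?_
  · by_contra h
    apply hx
    rw [ballCutoff, Real.smoothTransition.zero_of_nonpos, Complex.ofReal_zero]
    have : n * (r ^ 2 - ‖x - c‖ ^ 2) < 1 := not_le.1 h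
    linarith
  · rw [Set.mem_ofPred_eq] at hx
    rw [mem_ball_iff_norm]
    by_contra h
    have h1 : r ^ 2 ≤ ‖x - c‖ ^ 2 := by gcongr; exact not_lt.1 h
    have : (n : ℝ) * (r ^ 2 - ‖x - c‖ ^ 2) ≤ 0 :=
      mul_nonpos_of_nonneg_of_nonpos (Nat.cast_nonneg n) (by linarith)
    linarith

theorem IsComplexTest.ballCutoff_mul (c : R3) {r : ℝ} (hr : 0 < r) (n : ℕ) {P : R3 → ℂ}
    (hP : ContDiff ℝ ∞ P) : IsComplexTest (Metric.ball c r) fun x => ballCutoff c r n x * P x := by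
  have h : tsupport (fun x => ballCutoff c r n x * P x) ⊆ Metric.ball c r :=
    tsupport_mul_subset_left.trans (tsupport_ballCutoff c hr n)
  refine ⟨(ballCutoff_contDiff c r n).mul hP, ?_, h⟩
  exact (isCompact_closedBall c r).of_isClosed_subset (isClosed_tsupport _)
    (h.trans Metric.ball_subset_closedBall)

theorem ballCutoff_eventually {c : R3} {r : ℝ} {x : R3} (hx : x ∈ Metric.ball c r) :
    ∀ᶠ n in atTop, ballCutoff c r n x = 1 ∧ ballCutoffDeriv c r n x = 0 := by
  have h : 0 < r ^ 2 - ‖x - c‖ ^ 2 := by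
    rw [mem_ball_iff_norm] at hx
    have : ‖x - c‖ ^ 2 < r ^ 2 := by gcongr
    linarith
  have ht : Tendsto (fun n : ℕ => (n : ℝ) * (r ^ 2 - ‖x - c‖ ^ 2)) atTop atTop :=
    tendsto_natCast_atTop_atTop.atTop_mul_const h
  filter_upwards [ht.eventually_gt_atTop 2] with n hn
  constructor
  · rw [ballCutoff, Real.smoothTransition.one_of_one_le (by linarith), Complex.ofReal_one]
  · rw [ballCutoffDeriv, deriv_smoothTransition_eq_zero, mul_zero]
    exact fun h' => by linarith [h'.2]

/-- Mean value inequality on the segment to the nearest point of the sphere. The bound is phrased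
with `r ^ 2 - ‖x - c‖ ^ 2` to match the argument of the cutoffs. -/
theorem exists_bound_of_eq_zero_on_sphere (c : R3) {r : ℝ} (hr : 0 < r) {W : R3 → ℂ}
    (hW : ContDiff ℝ ∞ W) (h0 : ∀ x ∈ Metric.sphere c r, W x = 0) :
    ∃ L, 0 ≤ L ∧ ∀ x ∈ Metric.ball c r, ‖W x‖ ≤ L * (r ^ 2 - ‖x - c‖ ^ 2) := by
  obtain ⟨L, hL⟩ := (isCompact_closedBall c r).exists_bound_of_continuousOn
    (hW.continuous_fderiv (by simp)).continuousOn
  have hL0 : 0 ≤ L := (norm_nonneg _).trans (hL c (Metric.mem_closedBall_self hr.le))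
  refine ⟨L / r, by positivity, fun x hx => ?_⟩
  have hx' := mem_ball_iff_norm.1 hx
  obtain ⟨y, hy, hxy⟩ : ∃ y ∈ Metric.sphere c r, ‖x - y‖ ≤ r - ‖x - c‖ := by
    rcases eq_or_ne x c with rfl | hne
    · refine ⟨x + EuclideanSpace.single 0 r, ?_, ?_⟩
      · simp [abs_of_pos hr]
      · simp [abs_of_pos hr]
    · have hn : 0 < ‖x - c‖ := norm_pos_iff.2 (sub_ne_zero.2 hne)
      refine ⟨c + (r / ‖x - c‖) • (x - c), ?_, ?_⟩
      · simp [norm_smul, abs_of_pos hr, hn.ne']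
      · have : x - (c + (r / ‖x - c‖) • (x - c)) = (1 - r / ‖x - c‖) • (x - c) := by
          rw [sub_smul, one_smul]; abel
        rw [this, norm_smul, Real.norm_of_nonpos, neg_sub, sub_mul, div_mul_cancel₀ _ hn.ne', one_mul]
        rw [sub_nonpos, one_le_div hn]; exact hx'.le
  have hm := (convex_closedBall c r).norm_image_sub_le_of_norm_fderiv_le
    (fun z _ => hW.differentiableAt_top z) hL (Metric.sphere_subset_closedBall hy)
    (Metric.ball_subset_closedBall hx)
  rw [h0 y hy, sub_zero] at hm
  calc ‖W x‖ ≤ L * (r - ‖x - c‖) := hm.trans (by gcongr)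
    -- With `ρ = ‖x - c‖`, `r² - ρ² = (r - ρ)(r + ρ)` and `r + ρ ≥ r`.
    _ ≤ L / r * (r ^ 2 - ‖x - c‖ ^ 2) := by
      rw [div_mul_eq_mul_div, le_div_iff₀ hr, mul_assoc]
      gcongr
      nlinarith [norm_nonneg (x - c)]

/-- The derivative of the cutoff has size `n`, but lives where `n (r² - |x - c|²) ≤ 2`, and there
`W` is of order `1/n`. The products are thus dominated by a multiple of `‖V‖`, and at each point of
the ball they are eventually zero. -/
theorem tendsto_integral_ballCutoffDeriv (c : R3) {r : ℝ} (hr : 0 < r) {V W : R3 → ℂ}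
    (hV : IntegrableOn V (Metric.ball c r)) (hW : ContDiff ℝ ∞ W)
    (h0 : ∀ x ∈ Metric.sphere c r, W x = 0) :
    Tendsto (fun n : ℕ => ∫ x in Metric.ball c r, V x * W x * (ballCutoffDeriv c r n x : ℂ))
      atTop (𝓝 0) := by
  obtain ⟨M, hM0, hM⟩ := exists_deriv_smoothTransition_bound
  obtain ⟨L, hL0, hL⟩ := exists_bound_of_eq_zero_on_sphere c hr hW h0
  have hcont : ∀ n, Continuous (ballCutoffDeriv c r n) := fun n =>
    continuous_const.mul (((Real.smoothTransition.contDiff (n := 1)).continuous_deriv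
      (by simp)).comp (by fun_prop))
  have key : Tendsto (fun n : ℕ => ∫ x in Metric.ball c r,
      V x * W x * (ballCutoffDeriv c r n x : ℂ)) atTop
      (𝓝 (∫ x in Metric.ball c r, (0 : ℂ))) := by
    refine tendsto_integral_of_dominated_convergence (fun x => ‖V x‖ * (L * (2 * M))) ?_
      (hV.norm.mul_const _) ?_ ?_
    · intro n
      exact (hV.aestronglyMeasurable.mul hW.continuous.aestronglyMeasurable).mul
        (Complex.continuous_ofReal.comp (hcont n)).aestronglyMeasurable
    · intro n
      filter_upwards [ae_restrict_mem measurableSet_ball] with x hx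
      rw [mul_assoc, norm_mul, norm_mul, Complex.norm_real]
      refine mul_le_mul_of_nonneg_left ?_ (norm_nonneg _)
      have hpos : 0 ≤ r ^ 2 - ‖x - c‖ ^ 2 := by
        have := mem_ball_iff_norm.1 hx
        have : ‖x - c‖ ^ 2 ≤ r ^ 2 := by gcongr
        linarith
      have hk : (r ^ 2 - ‖x - c‖ ^ 2) * ‖ballCutoffDeriv c r n x‖ ≤ 2 * M := by
        by_cases ht : n * (r ^ 2 - ‖x - c‖ ^ 2) - 1 ∈ Set.Icc (0 : ℝ) 1
        · rw [ballCutoffDeriv, norm_mul, Real.norm_natCast, ← mul_assoc]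
          refine mul_le_mul ?_ (hM _) (norm_nonneg _) (by norm_num)
          linarith [ht.2]
        · rw [ballCutoffDeriv, deriv_smoothTransition_eq_zero ht]
          simp [hM0]
      calc ‖W x‖ * ‖ballCutoffDeriv c r n x‖
          ≤ L * (r ^ 2 - ‖x - c‖ ^ 2) * ‖ballCutoffDeriv c r n x‖ := by
            gcongr; exact hL x hx
        _ ≤ L * (2 * M) := by rw [mul_assoc]; gcongr
    · filter_upwards [ae_restrict_mem measurableSet_ball] with x hx
      refine tendsto_const_nhds.congr' ?_
      filter_upwards [ballCutoff_eventually hx] with n hn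
      simp [hn.2]
  simpa using key

theorem tendsto_integral_ballCutoff (c : R3) {r : ℝ} {V : R3 → ℂ}
    (hV : IntegrableOn V (Metric.ball c r)) :
    Tendsto (fun n : ℕ => ∫ x in Metric.ball c r, ballCutoff c r n x * V x)
      atTop (𝓝 (∫ x in Metric.ball c r, V x)) := by
  refine tendsto_integral_of_dominated_convergence (fun x => ‖V x‖) ?_ hV.norm ?_ ?_
  · exact fun n => (ballCutoff_contDiff c r n).continuous.aestronglyMeasurable.mul
      hV.aestronglyMeasurable
  · refine fun n => Eventually.of_forall fun x => ?_
    rw [norm_mul]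
    exact mul_le_of_le_one_left (norm_nonneg _) (ballCutoff_norm_le c r n x)
  · filter_upwards [ae_restrict_mem measurableSet_ball] with x hx
    refine tendsto_const_nhds.congr' ?_
    filter_upwards [ballCutoff_eventually hx] with n hn
    simp [hn.1]

theorem integrableOn_mul_continuous {c : R3} {r : ℝ} {V W : R3 → ℂ}
    (hV : IntegrableOn V (Metric.ball c r)) (hW : Continuous W) :
    IntegrableOn (fun x => V x * W x) (Metric.ball c r) := by
  obtain ⟨M, hM⟩ := (isCompact_closedBall c r).exists_bound_of_continuousOn hW.continuousOn
  refine hV.mul_bdd (c := M) hW.aestronglyMeasurable ?_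
  filter_upwards [ae_restrict_mem measurableSet_ball] with x hx
  exact hM x (Metric.ball_subset_closedBall hx)

theorem setIntegral_ball_eq_of_tsupport {c : R3} {r : ℝ} {F : R3 → ℂ}
    (h : tsupport F ⊆ Metric.ball c r) : ∫ x in Metric.ball c r, F x = ∫ x, F x :=
  setIntegral_eq_integral_of_forall_compl_eq_zero fun _ hx =>
    image_eq_zero_of_notMem_tsupport fun h' => hx (h h')

/-- Green's formula on a ball for a weakly differentiable function and a vector field
which is tangential on the boundary sphere. -/
theorem HasWeakGradientOn.integral_tangential {c : R3} {r : ℝ} (hr : 0 < r) {u : R3 → ℂ}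
    {g : R3 → C3} (h : HasWeakGradientOn (Metric.ball c r) u g)
    (hu : IntegrableOn u (Metric.ball c r)) (hg : ∀ i, IntegrableOn (fun x => g x i) (Metric.ball c r))
    {P : Fin 3 → R3 → ℂ} (hP : ∀ i, ContDiff ℝ ∞ (P i))
    (h0 : ∀ x ∈ Metric.sphere c r, ∑ i, (((x - c) i : ℝ) : ℂ) * P i x = 0) :
    (∫ x in Metric.ball c r, ∑ i, g x i * P i x)
      + ∫ x in Metric.ball c r, u x * ∑ i, pd i (P i) x = 0 := by
  have hW : ContDiff ℝ ∞ fun x => ∑ i, (((x - c) i : ℝ) : ℂ) * P i x :=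
    ContDiff.sum fun i _ => (contDiff_coord_sub c i).mul (hP i)
  have iG : IntegrableOn (fun x => ∑ i, g x i * P i x) (Metric.ball c r) :=
    integrable_finsetSum _ fun i _ => integrableOn_mul_continuous (hg i) (hP i).continuous
  have iU : IntegrableOn (fun x => u x * ∑ i, pd i (P i) x) (Metric.ball c r) :=
    integrableOn_mul_continuous hu (continuous_finsetSum _ fun i _ => ((hP i).pd i).continuous)
  have t1 := tendsto_integral_ballCutoff c iG
  have t2 := tendsto_integral_ballCutoff c iU
  have t3 := (tendsto_integral_ballCutoffDeriv c hr hu hW h0).const_mul (-2)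
  have t4 := (t1.add t2).add t3
  rw [mul_zero, add_zero] at t4
  -- Before the limit the sum is exactly zero: cutoff times `P i` is an admissible test function,
  -- and the product rule splits its weak identity into these three terms.
  refine tendsto_nhds_unique t4 (tendsto_const_nhds.congr fun n => ?_)
  have e (i : Fin 3) := h.complex (IsComplexTest.ballCutoff_mul c hr n (hP i)) i
  have iA (i : Fin 3) : IntegrableOn (fun x => g x i * (ballCutoff c r n x * P i x))
      (Metric.ball c r) :=
    integrableOn_mul_continuous (hg i) ((ballCutoff_contDiff c r n).mul (hP i)).continuous
  have iB (i : Fin 3) : IntegrableOn (fun x => u x * pd i (fun x => ballCutoff c r n x * P i x) x)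
      (Metric.ball c r) :=
    integrableOn_mul_continuous hu (((ballCutoff_contDiff c r n).mul (hP i)).pd i).continuous
  have e' (i : Fin 3) : ∫ x in Metric.ball c r, (g x i * (ballCutoff c r n x * P i x)
      + u x * pd i (fun x => ballCutoff c r n x * P i x) x) = 0 := by
    rw [integral_add (iA i) (iB i)]
    have hs := (IsComplexTest.ballCutoff_mul c hr n (hP i)).2.2
    rw [setIntegral_ball_eq_of_tsupport (tsupport_mul_subset_right.trans hs),
      setIntegral_ball_eq_of_tsupport
        (tsupport_mul_subset_right.trans ((tsupport_pd_subset i _).trans hs)), e i, add_neg_cancel]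
  have e'' := Finset.sum_eq_zero (s := Finset.univ) fun i _ => e' i
  have iAB := fun (i : Fin 3) (_ : i ∈ Finset.univ) => (iA i).add (iB i)
  simp only [Pi.add_def] at iAB
  rw [← integral_finsetSum _ iAB] at e''
  rw [← integral_const_mul, ← integral_add, ← integral_add, ← e'']
  · refine integral_congr_ae (Eventually.of_forall fun x => ?_)
    simp only [Finset.mul_sum, Finset.sum_mul, ← Finset.sum_add_distrib]
    refine Finset.sum_congr rfl fun i _ => ?_
    rw [pd_mul i ((ballCutoff_contDiff c r n).differentiableAt_top x) ((hP i).differentiableAt_top x),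
      pd_ballCutoff]
    ring
  · exact ((integrableOn_mul_continuous iG (ballCutoff_contDiff c r n).continuous).congr
      (Eventually.of_forall fun x => mul_comm _ _)).add
      ((integrableOn_mul_continuous iU (ballCutoff_contDiff c r n).continuous).congr
      (Eventually.of_forall fun x => mul_comm _ _))
  · refine Integrable.const_mul ?_ _
    refine integrableOn_mul_continuous (integrableOn_mul_continuous hu hW.continuous) ?_
    exact Complex.continuous_ofReal.comp (continuous_const.mul
      (((Real.smoothTransition.contDiff (n := 1)).continuous_deriv (by simp)).comp (by fun_prop)))
  · exact (integrableOn_mul_continuous iG (ballCutoff_contDiff c r n).continuous).congr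
      (Eventually.of_forall fun x => mul_comm _ _)
  · exact (integrableOn_mul_continuous iU (ballCutoff_contDiff c r n).continuous).congr
      (Eventually.of_forall fun x => mul_comm _ _)

/-- The divergence theorem on a ball, for vector fields tangential on the boundary sphere. -/
theorem integral_div_eq_zero_of_tangential (c : R3) {r : ℝ} (hr : 0 < r)
    {P : Fin 3 → R3 → ℂ} (hP : ∀ i, ContDiff ℝ ∞ (P i))
    (h0 : ∀ x ∈ Metric.sphere c r, ∑ i, (((x - c) i : ℝ) : ℂ) * P i x = 0) :
    ∫ x in Metric.ball c r, ∑ i, pd i (P i) x = 0 := by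
  -- Green's formula is applied to the constant function `1`.
  have hw : HasWeakGradientOn (Metric.ball c r) (fun _ => 1) (fun _ => 0) := by
    refine ⟨continuous_const.locallyIntegrable.locallyIntegrableOn _,
      continuous_const.locallyIntegrable.locallyIntegrableOn _, fun φ hφ i => ?_⟩
    have := integral_pd_eq_zero hφ.complex.1 hφ.complex.2.1 i
    simp_rw [pd_ofReal i (hφ.1.contDiffAt.differentiableAt (by simp : (∞ : WithTop ℕ∞) ≠ 0))] at this
    simp [this]
  have := hw.integral_tangential hr (integrableOn_const measure_ball_lt_top.ne) (by simp) hP h0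
  simpa using this

/-- A weak gradient may be tested on a ball with the gradient of a function that
vanishes on the boundary sphere, as a limit of compactly supported functions. -/
theorem tendsto_integral_grad_ballCutoff_mul {c : R3} {r : ℝ} (hr : 0 < r) {g : R3 → C3}
    (hg : ∀ i, IntegrableOn (fun x => g x i) (Metric.ball c r)) {w : R3 → ℂ}
    (hw : ContDiff ℝ ∞ w) (h0 : ∀ x ∈ Metric.sphere c r, w x = 0) :
    Tendsto (fun n : ℕ => ∫ x in Metric.ball c r,
      ∑ i, g x i * pd i (fun x => ballCutoff c r n x * w x) x) atTop
      (𝓝 (∫ x in Metric.ball c r, ∑ i, g x i * pd i w x)) := by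
  have iG : IntegrableOn (fun x => ∑ i, g x i * pd i w x) (Metric.ball c r) :=
    integrable_finsetSum _ fun i _ => integrableOn_mul_continuous (hg i) (hw.pd i).continuous
  have iV : IntegrableOn (fun x => ∑ i, g x i * (((x - c) i : ℝ) : ℂ)) (Metric.ball c r) :=
    integrable_finsetSum _ fun i _ =>
      integrableOn_mul_continuous (hg i) (contDiff_coord_sub c i).continuous
  have t := (tendsto_integral_ballCutoff c iG).add
    ((tendsto_integral_ballCutoffDeriv c hr iV hw h0).const_mul (-2))
  rw [mul_zero, add_zero] at t
  refine t.congr fun n => ?_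
  rw [← integral_const_mul, ← integral_add]
  · refine integral_congr_ae (Eventually.of_forall fun x => ?_)
    simp only [Finset.mul_sum, Finset.sum_mul, ← Finset.sum_add_distrib]
    refine Finset.sum_congr rfl fun i _ => ?_
    rw [pd_mul i ((ballCutoff_contDiff c r n).differentiableAt_top x) (hw.differentiableAt_top x),
      pd_ballCutoff]
    ring
  · exact (integrableOn_mul_continuous iG (ballCutoff_contDiff c r n).continuous).congr
      (Eventually.of_forall fun x => mul_comm _ _)
  · refine Integrable.const_mul ?_ _
    refine integrableOn_mul_continuous (integrableOn_mul_continuous iV hw.continuous) ?_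
    exact Complex.continuous_ofReal.comp (continuous_const.mul
      (((Real.smoothTransition.contDiff (n := 1)).continuous_deriv (by simp)).comp (by fun_prop)))

/-! ### Ray integrals and the Euler equation. -/

theorem contDiff_succ_of_pd {n : ℕ} {F : R3 → ℂ} (hF : Differentiable ℝ F)
    (h : ∀ i, ContDiff ℝ n (pd i F)) : ContDiff ℝ (n + 1 : ℕ) F := by
  have e : fderiv ℝ F = fun x => ∑ i, pd i F x •
      (Complex.ofRealCLM.comp (EuclideanSpace.proj i : R3 →L[ℝ] ℝ)) := by
    ext x y
    rw [fderiv_apply_eq_sum]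
    simp [mul_comm]
  push_cast
  refine contDiff_succ_iff_fderiv.2 ⟨hF, by simp, ?_⟩
  rw [e]
  exact ContDiff.sum fun i _ => (h i).smul contDiff_const

/-- The weighted average of a function along the segment from the origin. -/
noncomputable def rayIntegral (s : ℂ) (F : R3 → ℂ) (x : R3) : ℂ :=
  ∫ t in (0 : ℝ)..1, (t : ℂ) ^ (s - 1) * F (t • x)

theorem intervalIntegrable_cpow_sub_one {s : ℂ} (hs : 0 < s.re) :
    IntervalIntegrable (fun t : ℝ => (t : ℂ) ^ (s - 1)) volume 0 1 :=
  intervalIntegral.intervalIntegrable_cpow' (by simp [hs])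

theorem rayIntegral_integrand {s : ℂ} (hs : 0 < s.re) {F : R3 → ℂ} (hF : Continuous F) (x : R3) :
    IntervalIntegrable (fun t : ℝ => (t : ℂ) ^ (s - 1) * F (t • x)) volume 0 1 :=
  (intervalIntegrable_cpow_sub_one hs).mul_continuousOn (by fun_prop)

/-- Differentiation under the integral. For `y` within distance `1` of `x` the points `t • y` stay
in the ball of radius `‖x‖ + 1`, so `|t^(s-1)|` times a constant dominates; it is integrable since
`Re s > 0`. -/
theorem rayIntegral_hasFDerivAt {s : ℂ} (hs : 0 < s.re) {F : R3 → ℂ} (hF : ContDiff ℝ ∞ F) (x : R3) :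
    IntervalIntegrable (fun t : ℝ => ((t : ℂ) ^ (s - 1)) • (t • fderiv ℝ F (t • x))) volume 0 1 ∧
    HasFDerivAt (rayIntegral s F)
      (∫ t in (0 : ℝ)..1, ((t : ℂ) ^ (s - 1)) • (t • fderiv ℝ F (t • x))) x := by
  have hF' : Continuous (fderiv ℝ F) := hF.continuous_fderiv (by simp)
  obtain ⟨M, hM⟩ := (isCompact_closedBall (0 : R3) (‖x‖ + 1)).exists_bound_of_continuousOn
    hF'.continuousOn
  have hm := intervalIntegrable_cpow_sub_one hs
  have h := intervalIntegral.hasFDerivAt_integral_of_dominated_of_fderiv_le (𝕜 := ℝ)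
    (F := fun x t => (t : ℂ) ^ (s - 1) * F (t • x)) (μ := volume) (a := (0 : ℝ)) (b := 1)
    (F' := fun x t => ((t : ℂ) ^ (s - 1)) • (t • fderiv ℝ F (t • x)))
    (bound := fun t => ‖(t : ℂ) ^ (s - 1)‖ * M) (x₀ := x) (Metric.ball_mem_nhds x one_pos)
    (Eventually.of_forall fun y =>
      (rayIntegral_integrand hs hF.continuous y).def'.aestronglyMeasurable)
    (rayIntegral_integrand hs hF.continuous x)
    (hm.def'.aestronglyMeasurable.smul (by fun_prop : Continuous fun t : ℝ =>
      t • fderiv ℝ F (t • x)).aestronglyMeasurable)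
    (Eventually.of_forall fun t ht y hy => ?_) (hm.norm.mul_const M)
    (Eventually.of_forall fun t ht y hy => ?_)
  · refine ⟨?_, h⟩
    exact hm.smul_continuousOn (by fun_prop : Continuous fun t : ℝ =>
      t • fderiv ℝ F (t • x)).continuousOn
  · rw [Set.uIoc_of_le zero_le_one] at ht
    rw [norm_smul, norm_smul, Real.norm_of_nonneg ht.1.le]
    refine mul_le_mul_of_nonneg_left ?_ (norm_nonneg _)
    have hy' : ‖y‖ ≤ ‖x‖ + 1 := by
      have := norm_sub_norm_le y x
      have := mem_ball_iff_norm.1 hy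
      linarith
    have : t • y ∈ Metric.closedBall (0 : R3) (‖x‖ + 1) := by
      rw [mem_closedBall_zero_iff, norm_smul, Real.norm_of_nonneg ht.1.le]
      exact (mul_le_of_le_one_left (norm_nonneg _) ht.2).trans hy'
    exact (mul_le_of_le_one_left (norm_nonneg _) ht.2).trans (hM _ this)
  · have h1 : HasFDerivAt (fun y : R3 => t • y) (t • ContinuousLinearMap.id ℝ R3) y :=
      (hasFDerivAt_id y).const_smul t
    have h2 := ((hF.differentiableAt_top (t • y)).hasFDerivAt.comp y h1).const_mul
      ((t : ℂ) ^ (s - 1))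
    refine h2.congr_fderiv ?_
    ext v
    simp

/-- The chain rule produces one factor `t`, which raises the exponent by one. -/
theorem pd_rayIntegral {s : ℂ} (hs : 0 < s.re) {F : R3 → ℂ} (hF : ContDiff ℝ ∞ F) (i : Fin 3)
    (x : R3) : pd i (rayIntegral s F) x = rayIntegral (s + 1) (pd i F) x := by
  obtain ⟨h1, h2⟩ := rayIntegral_hasFDerivAt hs hF x
  rw [pd, h2.fderiv, ContinuousLinearMap.intervalIntegral_apply h1, rayIntegral]
  refine intervalIntegral.integral_congr_ae (Eventually.of_forall fun t ht => ?_)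
  rw [Set.uIoc_of_le zero_le_one] at ht
  have : (t : ℂ) ≠ 0 := by exact_mod_cast ht.1.ne'
  rw [show s + 1 - 1 = s - 1 + 1 by ring, Complex.cpow_add _ _ this, Complex.cpow_one]
  simp [pd, mul_assoc]

theorem ContDiff.rayIntegral {s : ℂ} (hs : 0 < s.re) {F : R3 → ℂ} (hF : ContDiff ℝ ∞ F) :
    ContDiff ℝ ∞ (rayIntegral s F) := by
  -- The induction has to vary `s` and `F`, since a derivative is a ray integral with parameter `s +
  -- 1` of another function.
  have key : ∀ n : ℕ, ∀ s : ℂ, 0 < s.re → ∀ F : R3 → ℂ, ContDiff ℝ ∞ F →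
      ContDiff ℝ n (_root_.rayIntegral s F) := by
    intro n
    induction n with
    | zero =>
      intro s hs F hF
      exact contDiff_zero.2 (continuous_iff_continuousAt.2 fun x =>
        (rayIntegral_hasFDerivAt hs hF x).2.continuousAt)
    | succ n ih =>
      intro s hs F hF
      refine contDiff_succ_of_pd (fun x => (rayIntegral_hasFDerivAt hs hF x).2.differentiableAt)
        fun i => ?_
      rw [show _root_.pd i (_root_.rayIntegral s F) =
        _root_.rayIntegral (s + 1) (_root_.pd i F) from
        funext (pd_rayIntegral hs hF i)]
      exact ih _ (by simp; linarith) _ (hF.pd i)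
  exact contDiff_infty.2 fun n => key n s hs F hF

theorem lap_rayIntegral {s : ℂ} (hs : 0 < s.re) {F : R3 → ℂ} (hF : ContDiff ℝ ∞ F) (x : R3) :
    lap (rayIntegral s F) x = rayIntegral (s + 2) (lap F) x := by
  have h1 (i : Fin 3) : pd i (rayIntegral s F) = rayIntegral (s + 1) (pd i F) :=
    funext (pd_rayIntegral hs hF i)
  have hs1 : 0 < (s + 1).re := by simp; linarith
  have hs2 : 0 < (s + 2).re := by simp; linarith
  simp only [lap, h1, pd_rayIntegral hs1 (hF.pd _)]
  rw [show s + 1 + 1 = s + 2 by ring]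
  simp only [rayIntegral, lap, Finset.mul_sum]
  rw [intervalIntegral.integral_finsetSum]
  · exact fun i _ => rayIntegral_integrand hs2 ((hF.pd i).pd i).continuous x

theorem lap_rayIntegral_eq_zero {s : ℂ} (hs : 0 < s.re) {F : R3 → ℂ} (hF : ContDiff ℝ ∞ F) {r : ℝ}
    (h : ∀ x ∈ Metric.ball (0 : R3) r, lap F x = 0) {x : R3} (hx : x ∈ Metric.ball (0 : R3) r) :
    lap (rayIntegral s F) x = 0 := by
  rw [lap_rayIntegral hs hF, rayIntegral, intervalIntegral.integral_congr (g := fun _ => 0)]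
  · simp
  · intro t ht
    rw [Set.uIcc_of_le zero_le_one] at ht
    have : t • x ∈ Metric.ball (0 : R3) r := by
      rw [mem_ball_zero_iff] at hx ⊢
      rw [norm_smul, Real.norm_of_nonneg ht.1]
      exact (mul_le_of_le_one_left (norm_nonneg _) ht.2).trans_lt hx
    simp only
    rw [h _ this, mul_zero]

/-- The left side integrates the derivative of `t ↦ t^s F(tx)` over `[0, 1]`, and the endpoint `0`
contributes nothing because `Re s > 0`. On homogeneous functions of degree `n` the ray integral is
division by `n + s`. -/
theorem rayIntegral_ode {s : ℂ} (hs : 0 < s.re) {F : R3 → ℂ} (hF : ContDiff ℝ ∞ F) (x : R3) :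
    (∑ i, ((x i : ℝ) : ℂ) * pd i (rayIntegral s F) x) + s * rayIntegral s F x = F x := by
  have hs1 : 0 < (s + 1).re := by simp; linarith
  have hs0 : s ≠ 0 := fun h => by simp [h] at hs
  have hi1 := fun i => (rayIntegral_integrand hs1 (hF.pd i).continuous x).const_mul ((x i : ℝ) : ℂ)
  have hi2 := (rayIntegral_integrand hs hF.continuous x).const_mul s
  have e : (∑ i, ((x i : ℝ) : ℂ) * pd i (rayIntegral s F) x) + s * rayIntegral s F x =
      ∫ t in (0 : ℝ)..1, ((∑ i, ((x i : ℝ) : ℂ) * ((t : ℂ) ^ (s + 1 - 1) * pd i F (t • x)))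
        + s * ((t : ℂ) ^ (s - 1) * F (t • x))) := by
    rw [intervalIntegral.integral_add _ hi2, intervalIntegral.integral_finsetSum,
      intervalIntegral.integral_const_mul]
    · simp only [pd_rayIntegral hs hF, intervalIntegral.integral_const_mul]
      rfl
    · exact fun i _ => hi1 i
    · simpa [Finset.sum_fn] using IntervalIntegrable.sum Finset.univ fun i _ => hi1 i
  rw [e]
  have := intervalIntegral.integral_eq_sub_of_hasDerivAt_of_le (a := 0) (b := 1)
    (f := fun t : ℝ => (t : ℂ) ^ s * F (t • x))
    (f' := fun t : ℝ => (∑ i, ((x i : ℝ) : ℂ) * ((t : ℂ) ^ (s + 1 - 1) * pd i F (t • x)))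
        + s * ((t : ℂ) ^ (s - 1) * F (t • x))) zero_le_one ?_ ?_ ?_
  · rw [this]; simp [hs0]
  · exact ((Complex.continuous_ofReal_cpow_const hs).mul
      (hF.continuous.comp (continuous_id.smul continuous_const))).continuousOn
  · intro t ht
    have ht0 : (t : ℂ) ∈ Complex.slitPlane := Or.inl (by simpa using ht.1)
    have d1 : HasDerivAt (fun t : ℝ => (t : ℂ) ^ s) (s * (t : ℂ) ^ (s - 1)) t := by
      have := (hasDerivAt_id (t : ℂ)).cpow_const (c := s) ht0
      simpa using this.comp_ofReal
    have d2 : HasDerivAt (fun t : ℝ => F (t • x)) (fderiv ℝ F (t • x) x) t := by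
      have h1 : HasDerivAt (fun t : ℝ => t • x) x t := by
        simpa using (hasDerivAt_id t).smul_const x
      exact (hF.differentiableAt_top (t • x)).hasFDerivAt.comp_hasDerivAt t h1
    refine (d1.mul d2).congr_deriv ?_
    rw [fderiv_apply_eq_sum, Finset.mul_sum, add_comm, add_sub_cancel_right, mul_assoc]
    congr 1
    exact Finset.sum_congr rfl fun i _ => by ring
  · refine IntervalIntegrable.add ?_ hi2
    simpa [Finset.sum_fn] using IntervalIntegrable.sum Finset.univ fun i _ => hi1 i

/-- `|t^(s-1)| = t^(Re s - 1) ≤ 1`, so the imaginary part of `s`, which blows up as `δ → 0`, plays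
no role. -/
theorem norm_rayIntegral_le {s : ℂ} (hs : 1 ≤ s.re) {F : R3 → ℂ} {r B : ℝ}
    (h : ∀ x ∈ Metric.ball (0 : R3) r, ‖F x‖ ≤ B) {x : R3} (hx : x ∈ Metric.ball (0 : R3) r) :
    ‖rayIntegral s F x‖ ≤ B := by
  have := intervalIntegral.norm_integral_le_of_norm_le_const (a := 0) (b := 1) (C := B)
    (f := fun t : ℝ => (t : ℂ) ^ (s - 1) * F (t • x)) ?_
  · rw [rayIntegral]; simpa using this
  · intro t ht
    rw [Set.uIoc_of_le zero_le_one] at ht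
    have hm : t • x ∈ Metric.ball (0 : R3) r := by
      rw [mem_ball_zero_iff] at hx ⊢
      rw [norm_smul, Real.norm_of_nonneg ht.1.le]
      exact (mul_le_of_le_one_left (norm_nonneg _) ht.2).trans_lt hx
    rw [norm_mul, Complex.norm_cpow_eq_rpow_re_of_pos ht.1]
    refine (mul_le_of_le_one_left (norm_nonneg _) ?_).trans (h _ hm)
    exact Real.rpow_le_one ht.1.le ht.2 (by simp; linarith)

/-! ### Inversion and the Kelvin transform. -/

/-- `F` is differentiable at `x`, with `i`-th partial derivative `F'`. -/
def HasPd (i : Fin 3) (F : R3 → ℂ) (F' : ℂ) (x : R3) : Prop :=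
  DifferentiableAt ℝ F x ∧ pd i F x = F'

namespace HasPd

variable {i : Fin 3} {F G : R3 → ℂ} {F' G' : ℂ} {x : R3}

theorem mul (hF : HasPd i F F' x) (hG : HasPd i G G' x) :
    HasPd i (fun y => F y * G y) (F x * G' + F' * G x) x :=
  ⟨hF.1.mul hG.1, by rw [pd_mul i hF.1 hG.1, hF.2, hG.2]⟩

theorem add (hF : HasPd i F F' x) (hG : HasPd i G G' x) :
    HasPd i (fun y => F y + G y) (F' + G') x :=
  ⟨hF.1.add hG.1, by rw [pd_add i hF.1 hG.1, hF.2, hG.2]⟩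

theorem sub (hF : HasPd i F F' x) (hG : HasPd i G G' x) :
    HasPd i (fun y => F y - G y) (F' - G') x :=
  ⟨hF.1.sub hG.1, by rw [pd_sub i hF.1 hG.1, hF.2, hG.2]⟩

theorem const_mul (a : ℂ) (hF : HasPd i F F' x) : HasPd i (fun y => a * F y) (a * F') x :=
  ⟨hF.1.const_mul a, by rw [pd_const_mul i a hF.1, hF.2]⟩

theorem pow (hF : HasPd i F F' x) (n : ℕ) :
    HasPd i (fun y => F y ^ n) (n * F x ^ (n - 1) * F') x := by
  have h := (hF.1.hasFDerivAt.pow n)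
  refine ⟨h.differentiableAt, ?_⟩
  rw [pd, h.fderiv, ← hF.2, pd]
  simp

theorem sum {F : Fin 3 → R3 → ℂ} {F' : Fin 3 → ℂ} (h : ∀ j, HasPd i (F j) (F' j) x) :
    HasPd i (fun y => ∑ j, F j y) (∑ j, F' j) x :=
  ⟨DifferentiableAt.fun_sum fun j _ => (h j).1, by
    rw [pd_sum _ i fun j _ => (h j).1]; exact Finset.sum_congr rfl fun j _ => (h j).2⟩

theorem congr (hF : HasPd i F F' x) (h : G =ᶠ[𝓝 x] F) (h' : F' = G') : HasPd i G G' x :=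
  ⟨hF.1.congr_of_eventuallyEq h, by rw [pd_congr i h, hF.2, h']⟩

end HasPd

theorem hasPd_coord (i j : Fin 3) (x : R3) :
    HasPd i (fun y => ((y j : ℝ) : ℂ)) (if i = j then 1 else 0) x :=
  ⟨(contDiff_coord j).differentiableAt_top x, pd_coord i j x⟩

theorem hasPd_comp {F : R3 → ℂ} {φ : R3 → R3} {φ' : Fin 3 → ℂ} {i : Fin 3} {x : R3}
    (hF : DifferentiableAt ℝ F (φ x)) (hφ : DifferentiableAt ℝ φ x)
    (h : ∀ j, pd i (fun y => ((φ y j : ℝ) : ℂ)) x = φ' j) :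
    HasPd i (fun y => F (φ y)) (∑ j, φ' j * pd j F (φ x)) x := by
  have hc := hF.hasFDerivAt.comp x hφ.hasFDerivAt
  rw [Function.comp_def] at hc
  refine ⟨hc.differentiableAt, ?_⟩
  rw [pd, hc.fderiv, ContinuousLinearMap.comp_apply, fderiv_apply_eq_sum]
  refine Finset.sum_congr rfl fun j _ => ?_
  have hj : HasFDerivAt (fun y => φ y j)
      ((EuclideanSpace.proj j : R3 →L[ℝ] ℝ).comp (fderiv ℝ φ x)) x :=
    (EuclideanSpace.proj j : R3 →L[ℝ] ℝ).hasFDerivAt.comp x hφ.hasFDerivAt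
  rw [← h j, pd_ofReal i hj.differentiableAt, partialDeriv, hj.fderiv]
  rfl

/-- The complex number `1 / |x|`. -/
noncomputable def invNorm (x : R3) : ℂ := ((‖x‖⁻¹ : ℝ) : ℂ)

theorem invNorm_sq_mul {x : R3} (hx : x ≠ 0) :
    invNorm x ^ 2 * (((x 0 : ℝ) : ℂ) ^ 2 + ((x 1 : ℝ) : ℂ) ^ 2 + ((x 2 : ℝ) : ℂ) ^ 2) = 1 := by
  have h : ‖x‖ ^ 2 = x 0 ^ 2 + x 1 ^ 2 + x 2 ^ 2 := by
    rw [EuclideanSpace.real_norm_sq_eq, Fin.sum_univ_three]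
  have h0 : ‖x‖ ≠ 0 := norm_ne_zero_iff.2 hx
  have : ‖x‖⁻¹ ^ 2 * (x 0 ^ 2 + x 1 ^ 2 + x 2 ^ 2) = 1 := by
    rw [← h]; field_simp
  rw [invNorm]
  exact_mod_cast this

theorem invNorm_contDiffAt {x : R3} (hx : x ≠ 0) : ContDiffAt ℝ ∞ invNorm x :=
  Complex.ofRealCLM.contDiff.contDiffAt.comp x
    ((contDiffAt_norm ℝ hx).inv (norm_ne_zero_iff.2 hx))

/-- Implicit differentiation of `ν² (|x|² + e) = 1`. It serves both `1/|x|`, with `e = 0`, and its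
smooth regularization. -/
theorem hasPd_of_sq_mul {ν : R3 → ℂ} (i : Fin 3) {x : R3} (hd : DifferentiableAt ℝ ν x) (e : ℂ)
    (h : ∀ᶠ y : R3 in 𝓝 x, ν y ^ 2 * (((y 0 : ℝ) : ℂ) ^ 2 + ((y 1 : ℝ) : ℂ) ^ 2
      + ((y 2 : ℝ) : ℂ) ^ 2 + e) = 1) : HasPd i ν (-((x i : ℝ) : ℂ) * ν x ^ 3) x := by
  refine ⟨hd, ?_⟩
  have hI : HasPd i ν (pd i ν x) x := ⟨hd, rfl⟩
  have h1 := (hI.pow 2).mul (((((hasPd_coord i 0 x).pow 2).add ((hasPd_coord i 1 x).pow 2)).add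
    ((hasPd_coord i 2 x).pow 2)).add (⟨differentiableAt_const e, pd_const i e x⟩ :
      HasPd i (fun _ => e) 0 x))
  have h2 := pd_congr (F := fun y => ν y ^ 2 *
    (((y 0 : ℝ) : ℂ) ^ 2 + ((y 1 : ℝ) : ℂ) ^ 2 + ((y 2 : ℝ) : ℂ) ^ 2 + e)) (G := fun _ => 1)
    (x := x) i h
  rw [h1.2, pd_const] at h2
  have h3 := h.self_of_nhds
  have h4 : ν x ≠ 0 := fun h => by simp [h] at h3
  have h5 : ∑ j : Fin 3, ((x j : ℝ) : ℂ) * (if i = j then 1 else 0) = ((x i : ℝ) : ℂ) := by simp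
  rw [Fin.sum_univ_three] at h5
  have h6 : 2 * ν x * (pd i ν x * (((x 0 : ℝ) : ℂ) ^ 2 + ((x 1 : ℝ) : ℂ) ^ 2
      + ((x 2 : ℝ) : ℂ) ^ 2 + e) + ν x * ((x i : ℝ) : ℂ)) = 0 := by
    rw [← h5]
    simp only [Nat.cast_ofNat, show (2 : ℕ) - 1 = 1 from rfl, pow_one] at h2
    linear_combination h2
  have h7 := (mul_eq_zero.1 h6).resolve_left (mul_ne_zero two_ne_zero h4)
  linear_combination ν x ^ 2 * h7 - pd i ν x * h3

theorem hasPd_invNorm (i : Fin 3) {x : R3} (hx : x ≠ 0) :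
    HasPd i invNorm (-((x i : ℝ) : ℂ) * invNorm x ^ 3) x := by
  refine hasPd_of_sq_mul i ((invNorm_contDiffAt hx).differentiableAt (by simp)) 0 ?_
  filter_upwards [isOpen_ne.mem_nhds hx] with y hy
  rw [add_zero, invNorm_sq_mul hy]

/-- The inversion in the sphere of radius `r` about the origin. -/
noncomputable def sphereInv (r : ℝ) (x : R3) : R3 := (r ^ 2 * (‖x‖⁻¹) ^ 2) • x

/-- The Kelvin transform with respect to the sphere of radius `r` about the origin. -/
noncomputable def kelvin (r : ℝ) (h : R3 → ℂ) (x : R3) : ℂ :=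
  (r : ℂ) * invNorm x * h (sphereInv r x)

theorem sphereInv_contDiffAt (r : ℝ) {x : R3} (hx : x ≠ 0) : ContDiffAt ℝ ∞ (sphereInv r) x :=
  (contDiffAt_const.mul (((contDiffAt_norm ℝ hx).inv (norm_ne_zero_iff.2 hx)).pow 2)).smul
    contDiffAt_id

theorem kelvin_contDiffAt (r : ℝ) {h : R3 → ℂ} (hh : ContDiff ℝ ∞ h) {x : R3} (hx : x ≠ 0) :
    ContDiffAt ℝ ∞ (kelvin r h) x :=
  (contDiffAt_const.mul (invNorm_contDiffAt hx)).mul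
    (hh.contDiffAt.comp x (sphereInv_contDiffAt r hx))

/-- The Jacobian matrix of the inversion. -/
noncomputable def sphereInvJac (r : ℝ) (i j : Fin 3) (x : R3) : ℂ :=
  (r : ℂ) ^ 2 * (invNorm x ^ 2 * (if i = j then 1 else 0)
    - 2 * (invNorm x ^ 4 * (((x i : ℝ) : ℂ) * ((x j : ℝ) : ℂ))))

theorem hasPd_sphereInv_comp (r : ℝ) {h : R3 → ℂ} (hh : ContDiff ℝ ∞ h) (i : Fin 3) {x : R3}
    (hx : x ≠ 0) : HasPd i (fun y => h (sphereInv r y))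
      (∑ j, sphereInvJac r i j x * pd j h (sphereInv r x)) x := by
  refine hasPd_comp (hh.differentiableAt_top _)
    ((sphereInv_contDiffAt r hx).differentiableAt (by simp)) fun j => ?_
  have h1 := (((hasPd_invNorm i hx).pow 2).mul (hasPd_coord i j x)).const_mul ((r : ℂ) ^ 2)
  have h2 : (fun y => ((sphereInv r y j : ℝ) : ℂ)) =
      fun y => (r : ℂ) ^ 2 * (invNorm y ^ 2 * ((y j : ℝ) : ℂ)) := by
    ext y
    simp [sphereInv, invNorm, mul_assoc]
  rw [h2, h1.2, sphereInvJac]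
  push_cast
  ring

theorem hasPd_kelvin (r : ℝ) {h : R3 → ℂ} (hh : ContDiff ℝ ∞ h) (i : Fin 3) {x : R3}
    (hx : x ≠ 0) : HasPd i (kelvin r h)
      (r * (invNorm x * ∑ j, sphereInvJac r i j x * pd j h (sphereInv r x))
        - r * (((x i : ℝ) : ℂ) * invNorm x ^ 3 * h (sphereInv r x))) x := by
  have := ((hasPd_invNorm i hx).const_mul (r : ℂ)).mul (hasPd_sphereInv_comp r hh i hx)
  exact this.congr (Eventually.of_forall fun _ => rfl) (by ring)

theorem hasPd_sphereInvJac (r : ℝ) (i j : Fin 3) {x : R3} (hx : x ≠ 0) :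
    HasPd i (sphereInvJac r i j) ((r : ℂ) ^ 2 * (-2 * ((x i : ℝ) : ℂ) * invNorm x ^ 4 *
      (if i = j then 1 else 0) - 2 * (-4 * ((x i : ℝ) : ℂ) ^ 2 * invNorm x ^ 6 * ((x j : ℝ) : ℂ)
      + invNorm x ^ 4 * (((x j : ℝ) : ℂ) + ((x i : ℝ) : ℂ) * (if i = j then 1 else 0))))) x := by
  have hν := hasPd_invNorm i hx
  have h1 := (((hν.pow 2).const_mul (if i = j then 1 else 0)).sub (((hν.pow 4).mul
    ((hasPd_coord i i x).mul (hasPd_coord i j x))).const_mul 2)).const_mul ((r : ℂ) ^ 2)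
  refine h1.congr (Eventually.of_forall fun y => ?_) ?_
  · rw [sphereInvJac, mul_comm (invNorm y ^ 2)]
  · push_cast
    simp only [if_true]
    ring

theorem lap_kelvin (r : ℝ) {h : R3 → ℂ} (hh : ContDiff ℝ ∞ h) {x : R3} (hx : x ≠ 0) :
    lap (kelvin r h) x = ((r : ℂ) * invNorm x) ^ 5 * lap h (sphereInv r x) := by
  have hν := invNorm_sq_mul hx
  have key (i : Fin 3) := (((hasPd_invNorm i hx).mul (HasPd.sum fun j =>
      (hasPd_sphereInvJac r i j hx).mul (hasPd_sphereInv_comp r (hh.pd j) i hx))).const_mul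
      (r : ℂ)).sub ((((hasPd_coord i i x).mul ((hasPd_invNorm i hx).pow 3)).mul
        (hasPd_sphereInv_comp r hh i hx)).const_mul (r : ℂ))
  have key2 (i : Fin 3) := (key i).congr (G := pd i (kelvin r h)) (by
    filter_upwards [isOpen_ne.mem_nhds hx] with y hy
    exact (hasPd_kelvin r hh i hy).2) rfl
  simp only [lap, (key2 _).2]
  simp only [Fin.sum_univ_three, sphereInvJac]
  -- What remains is a polynomial identity modulo `ν² |x|² = 1`. Replacing all values and
  -- derivatives by free variables leaves it to `ring`; the coefficient of `hν` is sorted by the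
  -- order of the derivatives of `h`.
  generalize invNorm x = ν at *
  generalize sphereInv r x = y at *
  generalize ((x 0 : ℝ) : ℂ) = a at *
  generalize ((x 1 : ℝ) : ℂ) = b at *
  generalize ((x 2 : ℝ) : ℂ) = c at *
  generalize (r : ℂ) = R at *
  generalize h y = H at *
  generalize pd 0 h y = H0 at *
  generalize pd 1 h y = H1 at *
  generalize pd 2 h y = H2 at *
  simp
  linear_combination (3 * R * ν ^ 3 * H + 12 * R ^ 3 * ν ^ 5 * (a * H0 + b * H1 + c * H2)
    + 4 * R ^ 5 * ν ^ 7 * (a * a * pd 0 (pd 0 h) y + a * b * pd 0 (pd 1 h) y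
    + a * c * pd 0 (pd 2 h) y + b * a * pd 1 (pd 0 h) y + b * b * pd 1 (pd 1 h) y
    + b * c * pd 1 (pd 2 h) y + c * a * pd 2 (pd 0 h) y + c * b * pd 2 (pd 1 h) y
    + c * c * pd 2 (pd 2 h) y)) * hν

theorem invNorm_mul_self {x : R3} {r : ℝ} (hr : 0 < r) (hx : ‖x‖ = r) :
    (r : ℂ) * invNorm x = 1 := by
  rw [invNorm, hx, ← Complex.ofReal_mul, mul_inv_cancel₀ hr.ne', Complex.ofReal_one]

theorem sphereInv_of_norm_eq {x : R3} {r : ℝ} (hr : 0 < r) (hx : ‖x‖ = r) :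
    sphereInv r x = x := by
  rw [sphereInv, hx, ← mul_pow, mul_inv_cancel₀ hr.ne', one_pow, one_smul]

theorem kelvin_of_norm_eq {x : R3} {r : ℝ} (hr : 0 < r) (hx : ‖x‖ = r) (h : R3 → ℂ) :
    kelvin r h x = h x := by
  rw [kelvin, invNorm_mul_self hr hx, one_mul, sphereInv_of_norm_eq hr hx]

/-- The inversion reverses the radial direction, which gives `-x·∇h`; the prefactor `r/|x|` gives
`-h`. -/
theorem radial_kelvin {x : R3} {r : ℝ} (hr : 0 < r) (hx : ‖x‖ = r) {h : R3 → ℂ}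
    (hh : ContDiff ℝ ∞ h) :
    ∑ i, ((x i : ℝ) : ℂ) * pd i (kelvin r h) x = -h x - ∑ i, ((x i : ℝ) : ℂ) * pd i h x := by
  have hx0 : x ≠ 0 := fun h => by rw [h, norm_zero] at hx; exact hr.ne hx
  have hν := invNorm_sq_mul hx0
  have h1 := invNorm_mul_self hr hx
  simp only [(hasPd_kelvin r hh _ hx0).2, sphereInv_of_norm_eq hr hx, Fin.sum_univ_three,
    sphereInvJac]
  have h3 : (r : ℂ) ^ 3 * invNorm x ^ 3 = 1 := by rw [← mul_pow, h1, one_pow]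
  generalize invNorm x = ν at *
  generalize ((x 0 : ℝ) : ℂ) = a at *
  generalize ((x 1 : ℝ) : ℂ) = b at *
  generalize ((x 2 : ℝ) : ℂ) = c at *
  generalize (r : ℂ) = R at *
  simp
  linear_combination (-(a * pd 0 h x + b * pd 1 h x + c * pd 2 h x)) * h3 - h x * h1
    - (R * ν * h x + 2 * R ^ 3 * ν ^ 3 * (a * pd 0 h x + b * pd 1 h x + c * pd 2 h x)) * hν

theorem norm_invNorm (x : R3) : ‖invNorm x‖ = ‖x‖⁻¹ := by
  rw [invNorm, Complex.norm_real, norm_inv, norm_norm]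

theorem norm_sphereInv_le {x : R3} {r : ℝ} (hr : 0 < r) (hx : r ≤ ‖x‖) :
    ‖sphereInv r x‖ ≤ r ^ 2 * ‖x‖⁻¹ ∧ ‖sphereInv r x‖ ≤ r := by
  have h0 : 0 < ‖x‖ := hr.trans_le hx
  have h1 : ‖sphereInv r x‖ = r ^ 2 * ‖x‖⁻¹ := by
    rw [sphereInv, norm_smul, Real.norm_of_nonneg (by positivity)]
    field_simp
  refine ⟨h1.le, ?_⟩
  rw [h1, ← div_eq_mul_inv, div_le_iff₀ h0]
  nlinarith

theorem norm_coord_le (x : R3) (i : Fin 3) : ‖((x i : ℝ) : ℂ)‖ ≤ ‖x‖ := by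
  rw [Complex.norm_real]; exact PiLp.norm_apply_le x i

theorem norm_sphereInvJac_le {x : R3} {r : ℝ} (hx : x ≠ 0) (i j : Fin 3) :
    ‖sphereInvJac r i j x‖ ≤ 3 * r ^ 2 * ‖x‖⁻¹ ^ 2 := by
  have h0 : 0 < ‖x‖ := norm_pos_iff.2 hx
  rw [sphereInvJac, norm_mul, norm_pow, Complex.norm_real, Real.norm_eq_abs, sq_abs,
    mul_comm 3, mul_assoc]
  gcongr
  refine (norm_sub_le _ _).trans ?_
  have h1 : ‖invNorm x ^ 2 * (if i = j then (1 : ℂ) else 0)‖ ≤ ‖x‖⁻¹ ^ 2 := by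
    rw [norm_mul, norm_pow, norm_invNorm]
    refine mul_le_of_le_one_right (by positivity) ?_
    split_ifs <;> simp
  have h2 : ‖2 * (invNorm x ^ 4 * (((x i : ℝ) : ℂ) * ((x j : ℝ) : ℂ)))‖ ≤ 2 * ‖x‖⁻¹ ^ 2 := by
    rw [norm_mul, norm_mul, norm_mul, norm_pow, norm_invNorm, Complex.norm_ofNat]
    calc 2 * (‖x‖⁻¹ ^ 4 * (‖((x i : ℝ) : ℂ)‖ * ‖((x j : ℝ) : ℂ)‖))
        ≤ 2 * (‖x‖⁻¹ ^ 4 * (‖x‖ * ‖x‖)) := by gcongr <;> exact norm_coord_le x _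
      _ = 2 * ‖x‖⁻¹ ^ 2 := by field_simp
  linarith

/-- Infinity is sent to the origin, so `h 0 = 0` gains the second power of `1/|x|`. The gradient
bound is far from sharp but enough for the cutoff at infinity. -/
theorem kelvin_bounds {r : ℝ} (hr : 0 < r) {h : R3 → ℂ} (hh : ContDiff ℝ ∞ h) (h0 : h 0 = 0) :
    ∃ M, 0 ≤ M ∧ ∀ x : R3, r ≤ ‖x‖ → ‖kelvin r h x‖ ≤ M / ‖x‖ ^ 2 ∧
      ∀ i, ‖pd i (kelvin r h) x‖ ≤ M / ‖x‖ := by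
  obtain ⟨L, hL⟩ := (isCompact_closedBall (0 : R3) r).exists_bound_of_continuousOn
    (hh.continuous_fderiv (by simp)).continuousOn
  obtain ⟨B, hB⟩ := (isCompact_closedBall (0 : R3) r).exists_bound_of_continuousOn
    hh.continuous.continuousOn
  have hL0 : 0 ≤ L := (norm_nonneg _).trans (hL 0 (Metric.mem_closedBall_self hr.le))
  have hB0 : 0 ≤ B := (norm_nonneg _).trans (hB 0 (Metric.mem_closedBall_self hr.le))
  refine ⟨max (r ^ 3 * L) (9 * (r * L) + B), le_max_of_le_left (by positivity),
    fun x hx => ⟨?_, fun i => ?_⟩⟩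
  · obtain ⟨h1, h2⟩ := norm_sphereInv_le hr hx
    have hx0 : 0 < ‖x‖ := hr.trans_le hx
    have hm := (convex_closedBall (0 : R3) r).norm_image_sub_le_of_norm_fderiv_le
      (fun z _ => hh.differentiableAt_top z) hL (Metric.mem_closedBall_self hr.le)
      (mem_closedBall_zero_iff.2 h2)
    rw [h0, sub_zero, sub_zero] at hm
    calc ‖kelvin r h x‖ = r * ‖x‖⁻¹ * ‖h (sphereInv r x)‖ := by
          rw [kelvin, norm_mul, norm_mul, norm_invNorm, Complex.norm_real, Real.norm_of_nonneg hr.le]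
      _ ≤ r * ‖x‖⁻¹ * (L * (r ^ 2 * ‖x‖⁻¹)) := by gcongr; exact hm.trans (by gcongr)
      _ = r ^ 3 * L / ‖x‖ ^ 2 := by field_simp
      _ ≤ _ := by gcongr; exact le_max_left _ _
  · obtain ⟨h1, h2⟩ := norm_sphereInv_le hr hx
    have hx0 : 0 < ‖x‖ := hr.trans_le hx
    have hpd (j : Fin 3) : ‖pd j h (sphereInv r x)‖ ≤ L := by
      refine (ContinuousLinearMap.le_opNorm _ _).trans ?_
      simpa using hL _ (mem_closedBall_zero_iff.2 h2)
    have hle : r * ‖x‖⁻¹ ≤ 1 := by rwa [← div_eq_mul_inv, div_le_one hx0]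
    rw [(hasPd_kelvin r hh i (norm_pos_iff.1 hx0)).2]
    have e1 : ‖(r : ℂ) * (invNorm x * ∑ j, sphereInvJac r i j x * pd j h (sphereInv r x))‖
        ≤ 9 * (r * L) / ‖x‖ := by
      have : ‖∑ j, sphereInvJac r i j x * pd j h (sphereInv r x)‖
          ≤ ∑ j : Fin 3, 3 * r ^ 2 * ‖x‖⁻¹ ^ 2 * L := by
        refine norm_sum_le_of_le _ fun j _ => ?_
        rw [norm_mul]
        exact mul_le_mul (norm_sphereInvJac_le (norm_pos_iff.1 hx0) i j) (hpd j) (norm_nonneg _)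
          (by positivity)
      rw [norm_mul, norm_mul, norm_invNorm, Complex.norm_real, Real.norm_of_nonneg hr.le]
      calc _ ≤ r * (‖x‖⁻¹ * ∑ j : Fin 3, 3 * r ^ 2 * ‖x‖⁻¹ ^ 2 * L) := by gcongr
        _ = 9 * (r * L) / ‖x‖ * (r * ‖x‖⁻¹) ^ 2 := by
          simp only [Finset.sum_const, Finset.card_univ, Fintype.card_fin, nsmul_eq_mul]
          push_cast; ring
        _ ≤ 9 * (r * L) / ‖x‖ := mul_le_of_le_one_right (by positivity)
          (pow_le_one₀ (by positivity) hle)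
    have e2 : ‖(r : ℂ) * (((x i : ℝ) : ℂ) * invNorm x ^ 3 * h (sphereInv r x))‖ ≤ B / ‖x‖ := by
      rw [norm_mul, norm_mul, norm_mul, norm_pow, norm_invNorm, Complex.norm_real (r := r),
        Real.norm_of_nonneg hr.le]
      calc r * (‖((x i : ℝ) : ℂ)‖ * ‖x‖⁻¹ ^ 3 * ‖h (sphereInv r x)‖)
          ≤ r * (‖x‖ * ‖x‖⁻¹ ^ 3 * B) := by
            gcongr
            · exact norm_coord_le x i
            · exact hB _ (mem_closedBall_zero_iff.2 h2)
        _ = B / ‖x‖ * (r * ‖x‖⁻¹) := by field_simp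
        _ ≤ B / ‖x‖ := mul_le_of_le_one_right (by positivity) hle
    calc _ ≤ 9 * (r * L) / ‖x‖ + B / ‖x‖ := (norm_sub_le _ _).trans (add_le_add e1 e2)
      _ = (9 * (r * L) + B) / ‖x‖ := by ring
      _ ≤ _ := by gcongr; exact le_max_right _ _

/-! ### The reflected fields and their uniform gradient bound. -/

/-- The interior and exterior reflected fields `h` and `w` of the incident field `u₀` on the ball:
the field `u₀ + h` inside and `u₀ + w` outside solves the transmission problem,
with `s = ε_m / (ε_Ω + ε_m)`. The gradient of `h` is at most `C`. -/
structure IsTransmissionPair (c : R3) (r : ℝ) (u₀ : R3 → ℂ) (s : ℂ) (C : ℝ) (h w : R3 → ℂ) :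
    Prop where
  contDiff_in : ContDiff ℝ ∞ h
  contDiff_out : ContDiff ℝ ∞ w
  lap_in : ∀ x ∈ Metric.ball c r, lap h x = 0
  lap_out : ∀ x, r < ‖x - c‖ → lap w x = 0
  trace : ∀ x ∈ Metric.sphere c r, w x = h x
  flux : ∀ x ∈ Metric.sphere c r, ∑ i, (((x - c) i : ℝ) : ℂ) * pd i w x =
    -h x - ∑ i, (((x - c) i : ℝ) : ℂ) * pd i h x
  ode : ∀ x, (∑ i, (((x - c) i : ℝ) : ℂ) * pd i h x) + s * h x =
    (2 * s - 1) * ∑ i, (((x - c) i : ℝ) : ℂ) * pd i u₀ x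
  decay : ∃ M, 0 ≤ M ∧ ∀ x, r ≤ ‖x - c‖ → ‖w x‖ ≤ M / ‖x - c‖ ^ 2 ∧
    ∀ i, ‖pd i w x‖ ≤ M / ‖x - c‖
  bound : ∀ x ∈ Metric.ball c r, ∀ i, ‖pd i h x‖ ≤ C

theorem exists_bound_on_ball {F : R3 → ℂ} (hF : Continuous F) (r : ℝ) :
    ∃ B, 0 ≤ B ∧ ∀ x ∈ Metric.ball (0 : R3) r, ‖F x‖ ≤ B := by
  obtain ⟨B, hB⟩ := (isCompact_closedBall (0 : R3) r).exists_bound_of_continuousOn hF.continuousOn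
  exact ⟨max B 0, le_max_right _ _, fun x hx =>
    (hB x (Metric.ball_subset_closedBall hx)).trans (le_max_left _ _)⟩

/-- By the Euler equation `s J = F - x·∇J`, and `∇J` is a ray integral of `∇F`. The factor `s` is
thus paid for by one derivative of `F`, uniformly in `s`. -/
theorem norm_mul_rayIntegral_le {s : ℂ} (hs : 1 ≤ s.re) {F : R3 → ℂ} (hF : ContDiff ℝ ∞ F)
    {r B B' : ℝ} (hr : 0 < r) (hB : ∀ x ∈ Metric.ball (0 : R3) r, ‖F x‖ ≤ B)
    (hB' : ∀ i, ∀ x ∈ Metric.ball (0 : R3) r, ‖pd i F x‖ ≤ B') {x : R3}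
    (hx : x ∈ Metric.ball (0 : R3) r) : ‖s * rayIntegral s F x‖ ≤ B + 3 * (r * B') := by
  have h1 := rayIntegral_ode (by linarith) hF x
  rw [eq_sub_of_add_eq' h1]
  refine (norm_sub_le _ _).trans (add_le_add (hB x hx) ?_)
  calc _ ≤ ∑ _i : Fin 3, r * B' := norm_sum_le_of_le _ fun i _ => ?_
    _ = 3 * (r * B') := by simp
  rw [norm_mul, pd_rayIntegral (by linarith) hF]
  exact mul_le_mul ((norm_coord_le x i).trans (mem_ball_zero_iff.1 hx).le)
    (norm_rayIntegral_le (by simp; linarith) (hB' i) hx) (norm_nonneg _) hr.le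

/-- The interior field solves the Euler equation by a ray integral, and the exterior one is its
Kelvin transform. The order of quantifiers is the point: `C` comes before `s`. -/
theorem exists_isTransmissionPair_zero {r : ℝ} (hr : 0 < r) {u₀ : R3 → ℂ} (hu : ContDiff ℝ ∞ u₀)
    (hl : ∀ x ∈ Metric.ball (0 : R3) r, lap u₀ x = 0) :
    ∃ C, ∀ s : ℂ, s.re = 1 / 2 → ∃ h w, IsTransmissionPair 0 r u₀ s C h w := by
  -- The gradient of `h` is expressed by first and second derivatives of `u₀`; removing a remaining
  -- factor `s` costs a third.
  choose B₁ hB₁0 hB₁ using fun i => exists_bound_on_ball (hu.pd i).continuous r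
  choose B₂ hB₂0 hB₂ using fun i j => exists_bound_on_ball ((hu.pd i).pd j).continuous r
  choose B₃ hB₃0 hB₃ using fun i j k => exists_bound_on_ball (((hu.pd i).pd j).pd k).continuous r
  obtain ⟨B, hB⟩ : ∃ B, ∀ i j k, B₁ i ≤ B ∧ B₂ i j ≤ B ∧ B₃ i j k ≤ B := by
    refine ⟨(∑ i, B₁ i) + (∑ i, ∑ j, B₂ i j) + ∑ i, ∑ j, ∑ k, B₃ i j k, fun i j k => ?_⟩
    have n1 : 0 ≤ ∑ i, B₁ i := Finset.sum_nonneg fun i _ => hB₁0 i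
    have n2' : ∀ i, 0 ≤ ∑ j, B₂ i j := fun i => Finset.sum_nonneg fun j _ => hB₂0 i j
    have n2 : 0 ≤ ∑ i, ∑ j, B₂ i j := Finset.sum_nonneg fun i _ => n2' i
    have n3' : ∀ i j, 0 ≤ ∑ k, B₃ i j k := fun i j => Finset.sum_nonneg fun k _ => hB₃0 i j k
    have n3'' : ∀ i, 0 ≤ ∑ j, ∑ k, B₃ i j k := fun i => Finset.sum_nonneg fun j _ => n3' i j
    have n3 : 0 ≤ ∑ i, ∑ j, ∑ k, B₃ i j k := Finset.sum_nonneg fun i _ => n3'' i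
    have m1 := Finset.single_le_sum (fun i _ => hB₁0 i) (Finset.mem_univ i)
    have m2 := (Finset.single_le_sum (fun j _ => hB₂0 i j) (Finset.mem_univ j)).trans
      (Finset.single_le_sum (fun i _ => n2' i) (Finset.mem_univ i))
    have m3 := ((Finset.single_le_sum (fun k _ => hB₃0 i j k) (Finset.mem_univ k)).trans
      (Finset.single_le_sum (fun j _ => n3' i j) (Finset.mem_univ j))).trans
      (Finset.single_le_sum (fun i _ => n3'' i) (Finset.mem_univ i))
    exact ⟨by linarith, by linarith, by linarith⟩
  refine ⟨2 * (B + 3 * (r * (B + 3 * (r * B)))), fun s hs => ?_⟩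
  have hs0 : 0 < s.re := by rw [hs]; norm_num
  set J := rayIntegral s u₀ with hJ
  have hJc : ContDiff ℝ ∞ J := hu.rayIntegral hs0
  set h : R3 → ℂ := fun x => (2 * s - 1) * (u₀ x - s * J x) with hh
  have hc : ContDiff ℝ ∞ h := contDiff_const.mul (hu.sub (contDiff_const.mul hJc))
  have hpd (i : Fin 3) (x : R3) : pd i h x = (2 * s - 1) * (pd i u₀ x - s * pd i J x) := by
    rw [hh, pd_const_mul i _ ((hu.sub (contDiff_const.mul hJc)).differentiableAt_top x),
      pd_sub i (hu.differentiableAt_top x) ((contDiff_const.mul hJc).differentiableAt_top x),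
      pd_const_mul i _ (hJc.differentiableAt_top x)]
  -- At the origin the Euler equation reads `s J(0) = u₀(0)`.
  have h0 : h 0 = 0 := by
    have := rayIntegral_ode hs0 hu 0
    simp only [PiLp.zero_apply, Complex.ofReal_zero, zero_mul, Finset.sum_const_zero, zero_add]
      at this
    simp [hh, hJ, this]
  -- The Kelvin transform is cut off near its singularity at the origin. This makes `w` smooth
  -- everywhere and changes nothing near `‖x‖ ≥ r`; `w` need not be harmonic inside the ball.
  let f : ContDiffBump (0 : R3) := ⟨r / 4, r / 2, by positivity, by linarith⟩
  set w : R3 → ℂ := fun x => (1 - ((f x : ℝ) : ℂ)) * kelvin r h x with hw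
  have hfar {x : R3} (hx : r ≤ ‖x‖) : w =ᶠ[𝓝 x] kelvin r h := by
    have : ∀ᶠ y in 𝓝 x, r / 2 < ‖y‖ :=
      continuous_norm.continuousAt.eventually (lt_mem_nhds (by linarith))
    filter_upwards [this] with y hy
    have : f y = 0 := f.zero_of_le_dist (by simpa [f] using hy.le)
    simp [hw, this]
  have hne {x : R3} (hx : r ≤ ‖x‖) : x ≠ 0 := norm_pos_iff.1 (hr.trans_le hx)
  obtain ⟨M, hM0, hM⟩ := kelvin_bounds hr hc h0
  refine ⟨h, w, hc, ?_, ?_, ?_, ?_, ?_, ?_, ⟨M, hM0, ?_⟩, ?_⟩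
  · refine contDiff_iff_contDiffAt.2 fun x => ?_
    rcases eq_or_ne x 0 with rfl | hx
    · have : w =ᶠ[𝓝 0] fun _ => 0 := by
        filter_upwards [f.eventuallyEq_one] with y hy
        simp [hw, hy]
      exact contDiffAt_const.congr_of_eventuallyEq this
    · exact (contDiffAt_const.sub (contDiff_ofReal_comp f.contDiff).contDiffAt).mul
        (kelvin_contDiffAt r hc hx)
  · intro x hx
    rw [hh, lap_const_mul _ (hu.sub (contDiff_const.mul hJc)),
      lap_sub hu (contDiff_const.mul hJc), lap_const_mul _ hJc, hl x hx, hJ,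
      lap_rayIntegral_eq_zero hs0 hu hl hx]
    simp
  · intro x hx
    rw [sub_zero] at hx
    rw [lap_congr (hfar hx.le), lap_kelvin r hc (hne hx.le)]
    have hx0 : 0 < ‖x‖ := hr.trans hx
    have hin : sphereInv r x ∈ Metric.ball (0 : R3) r := by
      rw [mem_ball_zero_iff]
      refine (norm_sphereInv_le hr hx.le).1.trans_lt ?_
      rw [← div_eq_mul_inv, div_lt_iff₀ hx0]
      nlinarith
    rw [hh, lap_const_mul _ (hu.sub (contDiff_const.mul hJc)),
      lap_sub hu (contDiff_const.mul hJc), lap_const_mul _ hJc, hl _ hin, hJ,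
      lap_rayIntegral_eq_zero hs0 hu hl hin]
    simp
  · intro x hx
    rw [mem_sphere_zero_iff_norm] at hx
    rw [(hfar hx.ge).eq_of_nhds, kelvin_of_norm_eq hr hx]
  · intro x hx
    rw [mem_sphere_zero_iff_norm] at hx
    simp only [pd_congr _ (hfar hx.ge), sub_zero]
    exact radial_kelvin hr hx hc
  · intro x
    have := rayIntegral_ode hs0 hu x
    rw [← hJ] at this
    have e : ∑ i, ((x i : ℝ) : ℂ) * pd i h x = (2 * s - 1) * ((∑ i, ((x i : ℝ) : ℂ) * pd i u₀ x)
        - s * ∑ i, ((x i : ℝ) : ℂ) * pd i J x) := by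
      simp only [hpd, Finset.mul_sum, ← Finset.sum_sub_distrib]
      exact Finset.sum_congr rfl fun i _ => by ring
    simp only [sub_zero]
    rw [e, eq_sub_of_add_eq this, hh]
    ring
  · intro x hx
    rw [sub_zero] at hx ⊢
    rw [(hfar hx).eq_of_nhds]
    simp only [pd_congr _ (hfar hx)]
    exact hM x hx
  · intro x hx i
    have hs1 : s + 1 ≠ 0 := fun h' => by
      have := congrArg Complex.re h'; simp [hs] at this; norm_num at this
    set E := ∑ j, ((x j : ℝ) : ℂ) * rayIntegral (s + 2) (pd j (pd i u₀)) x with hE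
    have o := rayIntegral_ode (s := s + 1) (by simp; linarith) (hu.pd i) x
    simp only [pd_rayIntegral (s := s + 1) (by simp; linarith) (hu.pd i),
      show s + 1 + 1 = s + 2 by ring] at o
    rw [← hE, ← pd_rayIntegral hs0 hu, ← hJ] at o
    -- Eliminates `∂ᵢJ` with the Euler equation at parameter `s + 1`. The factor `(2s - 1)/(s + 1)`
    -- is bounded by `2` on the line, and `s E` by the trade of `s` for a derivative.
    have e : (s + 1) * pd i h x = (2 * s - 1) * (pd i u₀ x + s * E) := by
      rw [hpd]; linear_combination (-(2 * s - 1) * s) * o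
    -- On `Re s = 1/2` the number `2s - 1` is `2i Im s`.
    have n1 : ‖2 * s - 1‖ ≤ 2 * ‖s + 1‖ := by
      rw [← Complex.norm_two, ← norm_mul, Complex.norm_def, Complex.norm_def]
      apply Real.sqrt_le_sqrt
      simp [Complex.normSq_apply, hs]
      nlinarith
    have n2 : ‖s‖ ≤ ‖s + 2‖ := by
      rw [Complex.norm_def, Complex.norm_def]
      apply Real.sqrt_le_sqrt
      simp [Complex.normSq_apply, hs]
      nlinarith
    have n3 : ‖s * E‖ ≤ 3 * (r * (B + 3 * (r * B))) := by
      rw [hE, Finset.mul_sum]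
      calc _ ≤ ∑ _j : Fin 3, r * (B + 3 * (r * B)) := norm_sum_le_of_le _ fun j _ => ?_
        _ = _ := by simp
      have := norm_mul_rayIntegral_le (s := s + 2) (by simp; linarith) ((hu.pd i).pd j) hr
        (fun y hy => (hB₂ i j y hy).trans (hB i j 0).2.1)
        (fun k y hy => (hB₃ i j k y hy).trans (hB i j k).2.2) hx
      rw [mul_left_comm, norm_mul]
      refine mul_le_mul ((norm_coord_le x j).trans (mem_ball_zero_iff.1 hx).le) (le_trans ?_ this)
        (norm_nonneg _) hr.le
      rw [norm_mul, norm_mul]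
      gcongr
    have n4 : ‖s + 1‖ * ‖pd i h x‖ ≤ ‖s + 1‖ * (2 * (B + 3 * (r * (B + 3 * (r * B))))) := by
      rw [← norm_mul, e, norm_mul]
      calc _ ≤ (2 * ‖s + 1‖) * (B + 3 * (r * (B + 3 * (r * B)))) := by
            gcongr
            exact (norm_add_le _ _).trans (add_le_add ((hB₁ i x hx).trans (hB i 0 0).1) n3)
        _ = _ := by ring
    exact le_of_mul_le_mul_left n4 (norm_pos_iff.2 hs1)

theorem exists_isTransmissionPair (c : R3) {r : ℝ} (hr : 0 < r) {u₀ : R3 → ℂ}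
    (hu : ContDiff ℝ ∞ u₀) (hl : ∀ x ∈ Metric.ball c r, lap u₀ x = 0) :
    ∃ C, ∀ s : ℂ, s.re = 1 / 2 → ∃ h w, IsTransmissionPair c r u₀ s C h w := by
  have hu' : ContDiff ℝ ∞ fun y => u₀ (y - -c) := hu.comp (contDiff_id.sub contDiff_const)
  obtain ⟨C, hC⟩ := exists_isTransmissionPair_zero hr hu' fun x hx => by
    rw [lap_comp_sub]
    apply hl
    simpa using hx
  refine ⟨C, fun s hs => ?_⟩
  obtain ⟨h, w, H⟩ := hC s hs
  refine ⟨fun x => h (x - c), fun x => w (x - c), ?_, ?_, ?_, ?_, ?_, ?_, ?_, ?_, ?_⟩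
  · exact H.contDiff_in.comp (contDiff_id.sub contDiff_const)
  · exact H.contDiff_out.comp (contDiff_id.sub contDiff_const)
  · intro x hx
    rw [lap_comp_sub]
    exact H.lap_in _ (by rwa [mem_ball_zero_iff, ← mem_ball_iff_norm])
  · intro x hx
    rw [lap_comp_sub]
    exact H.lap_out _ (by simpa using hx)
  · exact fun x hx => H.trace _ (by simpa [mem_sphere_iff_norm] using hx)
  · intro x hx
    simpa only [pd_comp_sub, sub_zero] using H.flux (x - c) (by simpa [mem_sphere_iff_norm] using hx)
  · intro x
    have := H.ode (x - c)
    have e (i : Fin 3) : pd i (fun y => u₀ (y - -c)) (x - c) = pd i u₀ x := by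
      rw [pd_comp_sub, sub_neg_eq_add, sub_add_cancel]
    simpa only [e, pd_comp_sub, sub_zero] using this
  · obtain ⟨M, hM0, hM⟩ := H.decay
    refine ⟨M, hM0, fun x hx => ?_⟩
    simpa only [pd_comp_sub, sub_zero] using hM (x - c) (by simpa using hx)
  · intro x hx i
    rw [pd_comp_sub]
    exact H.bound _ (by rwa [mem_ball_zero_iff, ← mem_ball_iff_norm]) i

/-! ### Fundamental solution, dipoles and Newtonian potentials. -/

theorem locallyIntegrable_inv_norm_pow {k : ℕ} (hk : k ≤ 2) :
    LocallyIntegrable fun x : R3 => ‖x‖⁻¹ ^ k := by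
  intro x
  refine ⟨Metric.ball 0 (‖x‖ + 1), Metric.isOpen_ball.mem_nhds (by simp), ?_⟩
  rw [integrableOn_fun_norm_addHaar volume (f := fun y : ℝ => y⁻¹ ^ k)]
  have h : IntegrableOn (fun y : ℝ => y ^ (2 - k)) (Set.Ioo 0 (‖x‖ + 1)) :=
    ((continuous_pow _).integrableOn_Icc).mono_set Set.Ioo_subset_Icc_self
  refine h.congr_fun (fun y hy => ?_) measurableSet_Ioo
  have hy0 : y ≠ 0 := hy.1.ne'
  simp only [finrank_euclideanSpace, Fintype.card_fin, smul_eq_mul]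
  rw [pow_sub₀ _ hy0 hk, inv_pow]

theorem ae_ne_zero : ∀ᵐ x : R3, x ≠ 0 := by
  simp [ae_iff]

theorem measurable_invNorm : Measurable invNorm :=
  Complex.measurable_ofReal.comp measurable_norm.inv

theorem locallyIntegrable_invNorm : LocallyIntegrable invNorm := by
  refine (locallyIntegrable_inv_norm_pow (k := 1) (by norm_num)).mono
    measurable_invNorm.aestronglyMeasurable (Eventually.of_forall fun x => ?_)
  rw [norm_invNorm]; simp

/-- The smooth regularization `(|x|² + e²)^(-1/2)` of `1 / |x|`. -/
noncomputable def regInvNorm (e : ℝ) (x : R3) : ℂ := (((√(‖x‖ ^ 2 + e ^ 2))⁻¹ : ℝ) : ℂ)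

theorem regInvNorm_contDiff {e : ℝ} (he : 0 < e) : ContDiff ℝ ∞ (regInvNorm e) := by
  have h (x : R3) : 0 < ‖x‖ ^ 2 + e ^ 2 := by positivity
  exact contDiff_ofReal_comp ((((contDiff_norm_sq ℝ).add contDiff_const).sqrt
    fun x => (h x).ne').inv fun x => (Real.sqrt_pos.2 (h x)).ne')

theorem regInvNorm_sq_mul {e : ℝ} (he : 0 < e) (x : R3) :
    regInvNorm e x ^ 2 * (((x 0 : ℝ) : ℂ) ^ 2 + ((x 1 : ℝ) : ℂ) ^ 2 + ((x 2 : ℝ) : ℂ) ^ 2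
      + (e : ℂ) ^ 2) = 1 := by
  have h : ‖x‖ ^ 2 = x 0 ^ 2 + x 1 ^ 2 + x 2 ^ 2 := by
    rw [EuclideanSpace.real_norm_sq_eq, Fin.sum_univ_three]
  have h0 : 0 < ‖x‖ ^ 2 + e ^ 2 := by positivity
  have : (√(‖x‖ ^ 2 + e ^ 2))⁻¹ ^ 2 * (x 0 ^ 2 + x 1 ^ 2 + x 2 ^ 2 + e ^ 2) = 1 := by
    rw [← h, inv_pow, Real.sq_sqrt h0.le, inv_mul_cancel₀ h0.ne']
  rw [regInvNorm]
  exact_mod_cast this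

theorem norm_regInvNorm_le {x : R3} (hx : x ≠ 0) (e : ℝ) : ‖regInvNorm e x‖ ≤ ‖x‖⁻¹ := by
  rw [regInvNorm, Complex.norm_real, Real.norm_of_nonneg (by positivity)]
  have : 0 < ‖x‖ := norm_pos_iff.2 hx
  gcongr
  exact Real.le_sqrt_of_sq_le (by nlinarith)

theorem hasPd_regInvNorm {e : ℝ} (he : 0 < e) (i : Fin 3) (x : R3) :
    HasPd i (regInvNorm e) (-((x i : ℝ) : ℂ) * regInvNorm e x ^ 3) x :=
  hasPd_of_sq_mul i ((regInvNorm_contDiff he).differentiableAt_top x) ((e : ℂ) ^ 2)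
    (Eventually.of_forall fun y => regInvNorm_sq_mul he y)

theorem hasPd_dipole {ν : R3 → ℂ} {i : Fin 3} {x : R3}
    (h : HasPd i ν (-((x i : ℝ) : ℂ) * ν x ^ 3) x) :
    HasPd i (fun y => -((y i : ℝ) : ℂ) * ν y ^ 3)
      (3 * ((x i : ℝ) : ℂ) ^ 2 * ν x ^ 5 - ν x ^ 3) x := by
  refine (((hasPd_coord i i x).mul (h.pow 3)).const_mul (-1)).congr
    (Eventually.of_forall fun y => by ring) ?_
  simp only [if_true]
  push_cast
  ring

/-- The computation that makes `1/|x|` harmonic leaves a defect of order `e²`, which concentrates at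
the origin with constant mass as `e → 0`. -/
theorem lap_regInvNorm {e : ℝ} (he : 0 < e) (x : R3) :
    lap (regInvNorm e) x = -(3 * (e : ℂ) ^ 2 * regInvNorm e x ^ 5) := by
  have h (i : Fin 3) : pd i (regInvNorm e) = fun x => -((x i : ℝ) : ℂ) * regInvNorm e x ^ 3 :=
    funext fun x => (hasPd_regInvNorm he i x).2
  simp only [lap, h, (hasPd_dipole (hasPd_regInvNorm he _ x)).2, Fin.sum_univ_three]
  linear_combination 3 * regInvNorm e x ^ 3 * regInvNorm_sq_mul he x

/-- The profile of the approximate identity given by the Laplacian of `regInvNorm`. -/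
noncomputable def diracProfile (x : R3) : ℝ := 3 * (√(‖x‖ ^ 2 + 1))⁻¹ ^ 5

/-- The total mass of `diracProfile`; its value is `4π`. -/
noncomputable def diracMass : ℝ := ∫ x, diracProfile x

theorem diracProfile_pos (x : R3) : 0 < diracProfile x := by
  have : 0 < ‖x‖ ^ 2 + 1 := by positivity
  have := Real.sqrt_pos.2 this
  rw [diracProfile]; positivity

theorem integrable_diracProfile : Integrable diracProfile := by
  have h := (integrable_rpow_neg_one_add_norm_sq (E := R3) (μ := volume) (r := 5)
    (by simp; norm_num)).const_mul 3
  refine h.congr (Eventually.of_forall fun x => ?_)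
  have h0 : 0 ≤ ‖x‖ ^ 2 + 1 := by positivity
  simp only [diracProfile]
  rw [Real.sqrt_eq_rpow, ← Real.rpow_neg h0, ← Real.rpow_mul_natCast h0, add_comm]
  norm_num

theorem diracMass_pos : 0 < diracMass := by
  rw [diracMass, integral_pos_iff_support_of_nonneg (fun x => (diracProfile_pos x).le)
    integrable_diracProfile]
  have : Function.support diracProfile = Set.univ :=
    Set.eq_univ_of_forall fun x => (diracProfile_pos x).ne'
  rw [this]
  exact Measure.measure_univ_pos.2 (NeZero.ne _)

theorem tendsto_diracProfile :
    Tendsto (fun x : R3 => ‖x‖ ^ 3 * (diracMass⁻¹ * diracProfile x)) (Bornology.cobounded R3) (𝓝 0) := by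
  have h1 : Tendsto (fun x : R3 => diracMass⁻¹ * 3 * (‖x‖⁻¹) ^ 2) (Bornology.cobounded R3) (𝓝 0) := by
    have := ((tendsto_inv_atTop_zero.comp (tendsto_norm_cobounded_atTop (E := R3))).pow 2).const_mul
      (diracMass⁻¹ * 3)
    simpa using this
  refine squeeze_zero' (Eventually.of_forall fun x => ?_) ?_ h1
  · have := diracMass_pos
    have := diracProfile_pos x
    positivity
  · filter_upwards [(tendsto_norm_cobounded_atTop (E := R3)).eventually_gt_atTop 0] with x hx
    have hm := diracMass_pos
    have hs : ‖x‖ ≤ √(‖x‖ ^ 2 + 1) := Real.le_sqrt_of_sq_le (by linarith)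
    calc ‖x‖ ^ 3 * (diracMass⁻¹ * diracProfile x)
        ≤ ‖x‖ ^ 3 * (diracMass⁻¹ * (3 * ‖x‖⁻¹ ^ 5)) := by rw [diracProfile]; gcongr
      _ = _ := by field_simp

theorem tendsto_integral_lap_regInvNorm {φ : R3 → ℂ} (hφ : Continuous φ) (hc : HasCompactSupport φ) :
    Tendsto (fun n : ℕ => ∫ x, lap (regInvNorm (n : ℝ)⁻¹) x * φ x) atTop
      (𝓝 (-(diracMass : ℂ) * φ 0)) := by
  have hm := diracMass_pos
  have h := (tendsto_integral_comp_smul_smul_of_integrable (μ := (volume : Measure R3))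
    (φ := fun x => diracMass⁻¹ * diracProfile x) (g := φ)
    (fun x => (mul_pos (inv_pos.2 hm) (diracProfile_pos x)).le)
    (by rw [integral_const_mul, ← diracMass, inv_mul_cancel₀ hm.ne'])
    (by simpa using tendsto_diracProfile)
    (hφ.integrable_of_hasCompactSupport hc) hφ.continuousAt).comp tendsto_natCast_atTop_atTop
  refine (h.const_mul (-(diracMass : ℂ))).congr' ?_
  filter_upwards [eventually_gt_atTop 0] with n hn
  have hn' : (0 : ℝ) < n := by exact_mod_cast hn
  rw [Function.comp_apply, ← integral_const_mul]
  refine integral_congr_ae (Eventually.of_forall fun x => ?_)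
  have e : √(‖(n : ℝ) • x‖ ^ 2 + 1) = n * √(‖x‖ ^ 2 + ((n : ℝ)⁻¹) ^ 2) := by
    rw [norm_smul, Real.norm_natCast, show ((n : ℝ) * ‖x‖) ^ 2 + 1 =
      (n : ℝ) ^ 2 * (‖x‖ ^ 2 + ((n : ℝ)⁻¹) ^ 2) by field_simp,
      Real.sqrt_mul (by positivity), Real.sqrt_sq hn'.le]
  -- The dilation by `n = 1/e` with Jacobian `n³`: the fifth power in the profile leaves the factor
  -- `n⁻² = e²` of the Laplacian.
  have e2 : (n : ℝ) ^ 3 * (diracMass⁻¹ * diracProfile ((n : ℝ) • x)) =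
      diracMass⁻¹ * (3 * ((n : ℝ)⁻¹) ^ 2 * (√(‖x‖ ^ 2 + ((n : ℝ)⁻¹) ^ 2))⁻¹ ^ 5) := by
    rw [diracProfile, e, mul_inv, mul_pow]
    field_simp
  have hd : Module.finrank ℝ R3 = 3 := by simp
  simp only
  rw [lap_regInvNorm (by positivity), hd, e2, regInvNorm, Complex.real_smul]
  have : (diracMass : ℂ) ≠ 0 := by exact_mod_cast hm.ne'
  push_cast
  field_simp

theorem tendsto_regInvNorm {x : R3} (hx : x ≠ 0) :
    Tendsto (fun n : ℕ => regInvNorm (n : ℝ)⁻¹ x) atTop (𝓝 (invNorm x)) := by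
  have h1 : Tendsto (fun n : ℕ => √(‖x‖ ^ 2 + ((n : ℝ)⁻¹) ^ 2)) atTop (𝓝 ‖x‖) := by
    have : Tendsto (fun n : ℕ => ((n : ℝ)⁻¹) ^ 2) atTop (𝓝 0) := by
      simpa using (tendsto_inv_atTop_nhds_zero_nat (𝕜 := ℝ)).pow 2
    have := (this.const_add (‖x‖ ^ 2)).sqrt
    simpa [Real.sqrt_sq (norm_nonneg x)] using this
  exact (Complex.continuous_ofReal.tendsto _).comp (h1.inv₀ (norm_ne_zero_iff.2 hx))

/-- The function `-1 / |x|` is, up to a constant, a fundamental solution of the Laplacian. -/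
theorem integral_invNorm_mul_lap {φ : R3 → ℂ} (hφ : ContDiff ℝ ∞ φ) (hc : HasCompactSupport φ) :
    ∫ x, invNorm x * lap φ x = -(diracMass : ℂ) * φ 0 := by
  refine tendsto_nhds_unique ?_ (tendsto_integral_lap_regInvNorm hφ.continuous hc)
  have e : ∀ᶠ n : ℕ in atTop, ∫ x, regInvNorm (n : ℝ)⁻¹ x * lap φ x =
      ∫ x, lap (regInvNorm (n : ℝ)⁻¹) x * φ x := by
    filter_upwards [eventually_gt_atTop 0] with n hn
    exact integral_mul_lap (regInvNorm_contDiff (by positivity)) hφ hc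
  refine Tendsto.congr' e ?_
  refine tendsto_integral_filter_of_dominated_convergence (fun x => ‖invNorm x * lap φ x‖) ?_ ?_ ?_ ?_
  · filter_upwards [eventually_gt_atTop 0] with n hn
    exact ((regInvNorm_contDiff (by positivity)).continuous.mul
      hφ.lap.continuous).aestronglyMeasurable
  · refine Eventually.of_forall fun n => ?_
    filter_upwards [ae_ne_zero] with x hx
    rw [norm_mul, norm_mul, norm_invNorm]
    exact mul_le_mul_of_nonneg_right (norm_regInvNorm_le hx _) (norm_nonneg _)
  · exact (integrable_mul_of_tsupport_subset (locallyIntegrable_invNorm.locallyIntegrableOn Set.univ)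
      hφ.lap.continuous hc.lap (by simp)).norm
  · filter_upwards [ae_ne_zero] with x hx
    exact (tendsto_regInvNorm hx).mul_const _

/-- The partial derivative of `1 / |x|`. -/
noncomputable def dipole (i : Fin 3) (x : R3) : ℂ := -((x i : ℝ) : ℂ) * invNorm x ^ 3

theorem norm_dipole_le (i : Fin 3) (x : R3) : ‖dipole i x‖ ≤ ‖x‖⁻¹ ^ 2 := by
  rcases eq_or_ne x 0 with rfl | hx
  · simp [dipole]
  · have : 0 < ‖x‖ := norm_pos_iff.2 hx
    rw [dipole, norm_mul, norm_neg, norm_pow, norm_invNorm]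
    calc _ ≤ ‖x‖ * ‖x‖⁻¹ ^ 3 := by gcongr; exact norm_coord_le x i
      _ = _ := by field_simp

theorem locallyIntegrable_dipole (i : Fin 3) : LocallyIntegrable (dipole i) := by
  refine (locallyIntegrable_inv_norm_pow (k := 2) le_rfl).mono ?_
    (Eventually.of_forall fun x => ?_)
  · exact ((contDiff_coord i).continuous.neg.measurable.mul
      (measurable_invNorm.pow_const 3)).aestronglyMeasurable
  · rw [Real.norm_of_nonneg (by positivity)]
    exact norm_dipole_le i x

theorem dipole_contDiffAt (i : Fin 3) {x : R3} (hx : x ≠ 0) : ContDiffAt ℝ ∞ (dipole i) x :=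
  (contDiff_coord i).neg.contDiffAt.mul ((invNorm_contDiffAt hx).pow 3)

theorem lap_pd {F : R3 → ℂ} (hF : ContDiff ℝ ∞ F) (i : Fin 3) (x : R3) :
    lap (pd i F) x = pd i (lap F) x := by
  have h : lap F = fun y => ∑ j, pd j (pd j F) y := rfl
  rw [h, pd_sum _ i fun j _ => ((hF.pd j).pd j).differentiableAt_top x, lap]
  refine Finset.sum_congr rfl fun j _ => ?_
  rw [show pd j (pd i F) = pd i (pd j F) from funext (pd_comm hF j i), pd_comm (hF.pd j)]

/-- For the smooth regularization the derivative moves to `φ` and commutes with the Laplacian. The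
limit then gives a Dirac mass on `∂ᵢφ`, dominated by the locally integrable `|x|⁻²`. -/
theorem integral_dipole_mul_lap {φ : R3 → ℂ} (hφ : ContDiff ℝ ∞ φ) (hc : HasCompactSupport φ)
    (i : Fin 3) : ∫ x, dipole i x * lap φ x = (diracMass : ℂ) * pd i φ 0 := by
  have h := (tendsto_integral_lap_regInvNorm (hφ.pd i).continuous (hc.pd i)).neg
  rw [neg_mul, neg_neg] at h
  refine tendsto_nhds_unique ?_ h
  have e : ∀ᶠ n : ℕ in atTop,
      ∫ x, (-((x i : ℝ) : ℂ) * regInvNorm (n : ℝ)⁻¹ x ^ 3) * lap φ x =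
      -∫ x, lap (regInvNorm (n : ℝ)⁻¹) x * pd i φ x := by
    filter_upwards [eventually_gt_atTop 0] with n hn
    have hn' : (0 : ℝ) < (n : ℝ)⁻¹ := by positivity
    have hR := regInvNorm_contDiff hn'
    rw [← integral_mul_lap hR (hφ.pd i) (hc.pd i)]
    simp_rw [lap_pd hφ i]
    rw [integral_mul_pd hR hφ.lap hc.lap, neg_neg]
    simp_rw [(hasPd_regInvNorm hn' i _).2]
  refine Tendsto.congr' e ?_
  refine tendsto_integral_filter_of_dominated_convergence
    (fun x => ‖(‖x‖⁻¹ ^ 2 : ℝ) * lap φ x‖) ?_ ?_ ?_ ?_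
  · filter_upwards [eventually_gt_atTop 0] with n hn
    exact (((contDiff_coord i).neg.mul ((regInvNorm_contDiff (by positivity)).pow 3)).mul
      hφ.lap).continuous.aestronglyMeasurable
  · refine Eventually.of_forall fun n => ?_
    filter_upwards [ae_ne_zero] with x hx
    have hx' : 0 < ‖x‖ := norm_pos_iff.2 hx
    rw [norm_mul, norm_mul, norm_mul, norm_neg, norm_pow, Complex.norm_real (r := ‖x‖⁻¹ ^ 2),
      Real.norm_of_nonneg (by positivity)]
    gcongr
    calc _ ≤ ‖x‖ * ‖x‖⁻¹ ^ 3 := by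
          gcongr
          · exact norm_coord_le x i
          · exact norm_regInvNorm_le hx _
      _ = _ := by field_simp
  · have hl : LocallyIntegrable fun x : R3 => ((‖x‖⁻¹ ^ 2 : ℝ) : ℂ) :=
      fun x => by
        obtain ⟨s, hs, hs'⟩ := locallyIntegrable_inv_norm_pow (k := 2) le_rfl x
        exact ⟨s, hs, hs'.ofReal⟩
    exact (integrable_mul_of_tsupport_subset (hl.locallyIntegrableOn Set.univ)
      hφ.lap.continuous hc.lap (by simp)).norm
  · filter_upwards [ae_ne_zero] with x hx
    exact (((tendsto_regInvNorm hx).pow 3).const_mul _).mul_const _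

/-- The Newtonian potential of a test function. -/
noncomputable def newtonPotential (ψ : R3 → ℂ) : R3 → ℂ :=
  convolution invNorm ψ (ContinuousLinearMap.mul ℝ ℂ) volume

theorem newtonPotential_contDiff {ψ : R3 → ℂ} (hψ : ContDiff ℝ ∞ ψ) (hc : HasCompactSupport ψ) :
    ContDiff ℝ ∞ (newtonPotential ψ) :=
  hc.contDiff_convolution_right (n := ⊤) _ locallyIntegrable_invNorm hψ

theorem pd_newtonPotential {ψ : R3 → ℂ} (hψ : ContDiff ℝ ∞ ψ) (hc : HasCompactSupport ψ)
    (i : Fin 3) : pd i (newtonPotential ψ) = newtonPotential (pd i ψ) := by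
  ext x
  have h1 : ContDiff ℝ 1 ψ := hψ.of_le (by simp)
  rw [pd, newtonPotential, (hc.hasFDerivAt_convolution_right (ContinuousLinearMap.mul ℝ ℂ)
    locallyIntegrable_invNorm h1 x).fderiv, convolution_precompR_apply (ContinuousLinearMap.mul ℝ ℂ)
    locallyIntegrable_invNorm (hc.fderiv (𝕜 := ℝ)) (h1.continuous_fderiv (by simp))]
  rfl

/-- Derivatives of the convolution fall on `ψ`, and the fundamental solution is then tested with `t
↦ ψ (x - t)`. -/
theorem lap_newtonPotential {ψ : R3 → ℂ} (hψ : ContDiff ℝ ∞ ψ) (hc : HasCompactSupport ψ) (x : R3) :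
    lap (newtonPotential ψ) x = -(diracMass : ℂ) * ψ x := by
  have hx : ContDiff ℝ ∞ fun t => ψ (x - t) := hψ.comp (contDiff_const.sub contDiff_id)
  have hcx : HasCompactSupport fun t => ψ (x - t) :=
    hc.comp_homeomorph (Homeomorph.subLeft x)
  have hp (F : R3 → ℂ) (hF : ContDiff ℝ ∞ F) (i : Fin 3) (t : R3) :
      pd i (fun t => F (x - t)) t = -pd i F (x - t) := by
    have h1 : HasFDerivAt (fun t : R3 => x - t) (-ContinuousLinearMap.id ℝ R3) t :=
      (hasFDerivAt_id t).const_sub x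
    have h2 := (hF.differentiableAt_top (x - t)).hasFDerivAt.comp t h1
    rw [Function.comp_def] at h2
    rw [pd, h2.fderiv]
    simp [pd]
  have hl (t : R3) : lap (fun t => ψ (x - t)) t = lap ψ (x - t) := by
    have h1 (i : Fin 3) : pd i (fun t => ψ (x - t)) = fun t => -1 * pd i ψ (x - t) :=
      funext fun t => by rw [hp ψ hψ]; ring
    simp only [lap, h1]
    refine Finset.sum_congr rfl fun i _ => ?_
    have h2 : ContDiff ℝ ∞ fun t => pd i ψ (x - t) :=
      (hψ.pd i).comp (contDiff_const.sub contDiff_id)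
    rw [pd_const_mul i _ (h2.differentiableAt_top t), hp _ (hψ.pd i)]
    ring
  have := integral_invNorm_mul_lap hx hcx
  rw [sub_zero] at this
  rw [← this, lap]
  simp only [pd_newtonPotential hψ hc, pd_newtonPotential (hψ.pd _) (hc.pd _)]
  simp only [newtonPotential, convolution_def, ContinuousLinearMap.mul_apply']
  rw [← integral_finsetSum]
  · refine integral_congr_ae (Eventually.of_forall fun t => ?_)
    simp only [hl]
    simp only [lap, Finset.mul_sum]
  · intro i _
    exact integrable_mul_of_tsupport_subset
      (locallyIntegrable_invNorm.locallyIntegrableOn Set.univ)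
      (((hψ.pd i).pd i).continuous.comp (continuous_const.sub continuous_id))
      (((hc.pd i).pd i).comp_homeomorph (Homeomorph.subLeft x)) (by simp)

/-- For `x` far from the support of `ψ`, `|x - t| ≥ |x|/2` on that support. -/
theorem newtonPotential_bound {ψ : R3 → ℂ} (hψ : Continuous ψ) (hc : HasCompactSupport ψ) :
    ∃ M R, 0 ≤ M ∧ 0 < R ∧ ∀ x : R3, R ≤ ‖x‖ → ‖newtonPotential ψ x‖ ≤ M / ‖x‖ := by
  obtain ⟨L, hL⟩ := hc.isBounded.subset_closedBall (0 : R3)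
  refine ⟨2 * ∫ t, ‖ψ t‖, 2 * |L| + 1, by positivity, by positivity, fun x hx => ?_⟩
  have hx0 : 0 < ‖x‖ := lt_of_lt_of_le (by positivity) hx
  have hi := hψ.integrable_of_hasCompactSupport hc (μ := volume)
  rw [newtonPotential, convolution_eq_swap]
  calc ‖∫ t, (ContinuousLinearMap.mul ℝ ℂ) (invNorm (x - t)) (ψ t)‖
      ≤ ∫ t, 2 / ‖x‖ * ‖ψ t‖ := by
        refine norm_integral_le_of_norm_le (hi.norm.const_mul _) (Eventually.of_forall fun t => ?_)
        by_cases ht : t ∈ tsupport ψ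
        · rw [ContinuousLinearMap.mul_apply', norm_mul, norm_invNorm]
          gcongr
          have h1 := mem_closedBall_zero_iff.1 (hL ht)
          have h2 := norm_sub_norm_le x t
          have h3 := le_abs_self L
          have h4 : ‖x‖ / 2 ≤ ‖x - t‖ := by linarith
          calc ‖x - t‖⁻¹ ≤ (‖x‖ / 2)⁻¹ := by gcongr
            _ = 2 / ‖x‖ := by rw [inv_div]
        · simp [image_eq_zero_of_notMem_tsupport ht]
    _ = _ := by rw [integral_const_mul]; ring

/-! ### Gluing fields across the sphere. -/

theorem locallyIntegrableOn_of_components {g : R3 → C3} {U : Set R3}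
    (h : ∀ i, LocallyIntegrableOn (fun x => g x i) U) : LocallyIntegrableOn g U := by
  have e : g = fun x => ∑ i, g x i • (EuclideanSpace.single i (1 : ℂ) : C3) := by
    ext x j
    simp [Finset.sum_apply, Pi.single_apply]
  rw [e]
  intro x hx
  choose s hs hs' using fun i => h i x hx
  refine ⟨⋂ i, s i, (Filter.iInter_mem).2 hs, ?_⟩
  exact integrable_finsetSum _ fun i _ => ((hs' i).mono_set (Set.iInter_subset s i)).smul_const _

theorem norm_le_sum_components (v : C3) : ‖v‖ ≤ ∑ i, ‖v i‖ := by
  have e : v = ∑ i, v i • (EuclideanSpace.single i (1 : ℂ) : C3) := by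
    ext j
    simp [Finset.sum_apply, Pi.single_apply]
  conv_lhs => rw [e]
  refine norm_sum_le_of_le _ fun i _ => ?_
  simp [norm_smul]

/-- The field equal to `h` in the ball and to `w` outside. -/
noncomputable def gluedField (c : R3) (r : ℝ) (h w : R3 → ℂ) (x : R3) : ℂ :=
  w x + (Metric.ball c r).indicator (fun y => h y - w y) x

theorem gluedField_in {c : R3} {r : ℝ} {h w : R3 → ℂ} {x : R3} (hx : x ∈ Metric.ball c r) :
    gluedField c r h w x = h x := by
  simp [gluedField, Set.indicator_of_mem hx]

theorem gluedField_out {c : R3} {r : ℝ} {h w : R3 → ℂ} {x : R3} (hx : x ∉ Metric.ball c r) :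
    gluedField c r h w x = w x := by
  simp [gluedField, Set.indicator_of_notMem hx]

theorem locallyIntegrable_gluedField (c : R3) (r : ℝ) {h w : R3 → ℂ} (hh : Continuous h)
    (hw : Continuous w) : LocallyIntegrable (gluedField c r h w) :=
  hw.locallyIntegrable.add ((hh.sub hw).locallyIntegrable.indicator measurableSet_ball)

theorem integral_gluedField_mul {c : R3} {r : ℝ} {h w φ : R3 → ℂ} (hh : Continuous h)
    (hw : Continuous w) (hφ : Continuous φ) (hc : HasCompactSupport φ) :
    ∫ x, gluedField c r h w x * φ x =
      (∫ x, w x * φ x) + ∫ x in Metric.ball c r, (h x - w x) * φ x := by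
  rw [← integral_indicator measurableSet_ball, ← integral_add]
  · refine integral_congr_ae (Eventually.of_forall fun x => ?_)
    by_cases hx : x ∈ Metric.ball c r
    · simp [gluedField, hx]; ring
    · simp [gluedField, hx]
  · exact (hw.mul hφ).integrable_of_hasCompactSupport hc.mul_left
  · rw [integrable_indicator_iff measurableSet_ball]
    exact (((hh.sub hw).mul hφ).integrable_of_hasCompactSupport hc.mul_left).integrableOn

/-- The jump `h - w` vanishes on the sphere, so no surface term appears: the glued gradient is the
weak gradient of the glued field. -/
theorem integral_gluedField_mul_pd {c : R3} {r : ℝ} (hr : 0 < r) {h w φ : R3 → ℂ}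
    (hh : ContDiff ℝ ∞ h) (hw : ContDiff ℝ ∞ w) (ht : ∀ x ∈ Metric.sphere c r, w x = h x)
    (hφ : ContDiff ℝ ∞ φ) (hc : HasCompactSupport φ) (i : Fin 3) :
    ∫ x, gluedField c r h w x * pd i φ x = -∫ x, gluedField c r (pd i h) (pd i w) x * φ x := by
  rw [integral_gluedField_mul hh.continuous hw.continuous (hφ.pd i).continuous (hc.pd i),
    integral_gluedField_mul (hh.pd i).continuous (hw.pd i).continuous hφ.continuous hc,
    integral_mul_pd hw hφ hc, neg_add, add_right_inj]
  have hd := hh.sub hw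
  have h1 := integral_div_eq_zero_of_tangential c hr
    (P := fun j x => (if j = i then 1 else 0) * ((h x - w x) * φ x))
    (fun j => contDiff_const.mul (hd.mul hφ)) (fun x hx => by simp [ht x hx])
  have h2 (x : R3) : ∑ j, pd j (fun x => (if j = i then (1 : ℂ) else 0) * ((h x - w x) * φ x)) x =
      (h x - w x) * pd i φ x + (pd i h x - pd i w x) * φ x := by
    have h3 (j : Fin 3) := pd_const_mul (x := x) j (if j = i then (1 : ℂ) else 0)
      ((hd.mul hφ).differentiableAt_top x)
    simp only [h3]
    simp only [ite_mul, one_mul, zero_mul, Finset.sum_ite_eq', Finset.mem_univ, if_true]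
    rw [pd_mul i (hd.differentiableAt_top x) (hφ.differentiableAt_top x),
      pd_sub i (hh.differentiableAt_top x) (hw.differentiableAt_top x)]
  simp only [h2] at h1
  rw [integral_add] at h1
  · exact eq_neg_of_add_eq_zero_left h1
  · exact ((hd.mul (hφ.pd i)).continuous.integrable_of_hasCompactSupport
      (hc.pd i).mul_left).integrableOn
  · exact ((((hh.pd i).sub (hw.pd i)).mul hφ).continuous.integrable_of_hasCompactSupport
      hc.mul_left).integrableOn

/-- The weak form of flux continuity: the Euler equation for `h` and the radial derivative of `w`
cancel the surface term of Green's formula. -/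
theorem transmission_reflected {c : R3} {r : ℝ} (hr : 0 < r) {u₀ h w φ : R3 → ℂ} {s εΩ εm : ℂ}
    {C : ℝ} (hu : ContDiff ℝ ∞ u₀) (hl : ∀ x ∈ Metric.ball c r, lap u₀ x = 0)
    (H : IsTransmissionPair c r u₀ s C h w) (hs : s * (εΩ + εm) = εm)
    (hφ : ContDiff ℝ ∞ φ) (hc : HasCompactSupport φ) :
    εm * (∫ x, gluedField c r h w x * lap φ x)
      - (εΩ - εm) * (∫ x in Metric.ball c r, ∑ i, (pd i u₀ x + pd i h x) * pd i φ x) = 0 := by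
  have hh := H.contDiff_in
  have hw := H.contDiff_out
  have hd := hh.sub hw
  have huh := hu.add hh
  -- This is `εΩ (u₀ + h) - εm (u₀ + w)`, so the radial part of `∇q` is the flux jump and `φ ∇q` is
  -- tangential on the sphere.
  set q : R3 → ℂ := fun x => εm * (h x - w x) + (εΩ - εm) * (u₀ x + h x) with hq
  have hqc : ContDiff ℝ ∞ q := (contDiff_const.mul hd).add (contDiff_const.mul huh)
  have hqp (i : Fin 3) (x : R3) : pd i q x =
      εm * (pd i h x - pd i w x) + (εΩ - εm) * (pd i u₀ x + pd i h x) := by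
    rw [hq, pd_add i ((contDiff_const.mul hd).differentiableAt_top x)
      ((contDiff_const.mul huh).differentiableAt_top x), pd_const_mul i _ (hd.differentiableAt_top x),
      pd_const_mul i _ (huh.differentiableAt_top x),
      pd_sub i (hh.differentiableAt_top x) (hw.differentiableAt_top x),
      pd_add i (hu.differentiableAt_top x) (hh.differentiableAt_top x)]
  have hql (x : R3) (hx : x ∈ Metric.ball c r) : lap q x = -εm * lap w x := by
    rw [hq, lap_add (contDiff_const.mul hd) (contDiff_const.mul huh), lap_const_mul _ hd,
      lap_const_mul _ huh, lap_sub hh hw, lap_add hu hh, hl x hx, H.lap_in x hx]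
    ring
  have hdiv := integral_div_eq_zero_of_tangential c hr (P := fun i x => φ x * pd i q x)
    (fun i => hφ.mul (hqc.pd i)) (fun x hx => by
      have e1 := H.flux x hx
      have e2 := H.ode x
      have e3 : ∑ i, (((x - c) i : ℝ) : ℂ) * (φ x * pd i q x) = φ x *
        (εm * ((∑ i, (((x - c) i : ℝ) : ℂ) * pd i h x) - ∑ i, (((x - c) i : ℝ) : ℂ) * pd i w x)
        + (εΩ - εm) * ((∑ i, (((x - c) i : ℝ) : ℂ) * pd i u₀ x)
          + ∑ i, (((x - c) i : ℝ) : ℂ) * pd i h x)) := by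
        simp only [Finset.mul_sum, ← Finset.sum_add_distrib, ← Finset.sum_sub_distrib, hqp]
        exact Finset.sum_congr rfl fun i _ => by ring
      rw [e3, e1]
      linear_combination φ x * (εΩ + εm) * e2
        - φ x * (h x - 2 * ∑ i, (((x - c) i : ℝ) : ℂ) * pd i u₀ x) * hs)
  have hdiv' (x : R3) : ∑ i, pd i (fun x => φ x * pd i q x) x =
      φ x * lap q x + ∑ i, pd i q x * pd i φ x := by
    rw [lap, Finset.mul_sum, ← Finset.sum_add_distrib]
    refine Finset.sum_congr rfl fun i _ => ?_
    rw [pd_mul i (hφ.differentiableAt_top x) ((hqc.pd i).differentiableAt_top x)]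
    ring
  have int0 {F G : R3 → ℂ} (hF : ContDiff ℝ ∞ F) (hG : ContDiff ℝ ∞ G) (hGc : HasCompactSupport G) :
      Integrable fun x => F x * G x :=
    (hF.mul hG).continuous.integrable_of_hasCompactSupport hGc.mul_left
  have intq : Integrable fun x => ∑ i, pd i q x * pd i φ x :=
    integrable_finsetSum _ fun i _ => int0 (hqc.pd i) (hφ.pd i) (hc.pd i)
  simp only [hdiv'] at hdiv
  rw [integral_add ((int0 hqc.lap hφ hc).integrableOn.congr (Eventually.of_forall fun x => mul_comm _ _))
    intq.integrableOn] at hdiv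
  -- `w` is harmonic outside the closed ball and the sphere is null, so integrating `lap w` over the
  -- ball or the whole space is the same. This spurious inner Laplacian cancels at the end.
  have e4 : ∫ x in Metric.ball c r, φ x * lap q x = -εm * ∫ x, lap w x * φ x := by
    have e5 : ∫ x, lap w x * φ x = ∫ x in Metric.ball c r, lap w x * φ x := by
      rw [← integral_indicator measurableSet_ball]
      refine integral_congr_ae ?_
      have hnull : ∀ᵐ x : R3, x ∉ Metric.sphere c r :=
        measure_eq_zero_iff_ae_notMem.1 (Measure.addHaar_sphere volume c r)
      filter_upwards [hnull] with x hx
      by_cases hxb : x ∈ Metric.ball c r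
      · rw [Set.indicator_of_mem hxb]
      · rw [Set.indicator_of_notMem hxb, H.lap_out x, zero_mul]
        rw [mem_ball_iff_norm, not_lt] at hxb
        exact lt_of_le_of_ne hxb fun h => hx (mem_sphere_iff_norm.2 h.symm)
    rw [e5, ← integral_const_mul]
    refine setIntegral_congr_fun measurableSet_ball fun x hx => ?_
    rw [hql x hx]
    ring
  have e6 : ∫ x, gluedField c r h w x * lap φ x = (∫ x, lap w x * φ x)
      - ∫ x in Metric.ball c r, ∑ i, (pd i h x - pd i w x) * pd i φ x := by
    have e7 (i : Fin 3) : ∫ x, gluedField c r h w x * pd i (pd i φ) x =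
        (∫ x, pd i (pd i w) x * φ x) - ∫ x in Metric.ball c r, (pd i h x - pd i w x) * pd i φ x := by
      rw [integral_gluedField_mul_pd hr hh hw H.trace (hφ.pd i) (hc.pd i),
        integral_gluedField_mul (hh.pd i).continuous (hw.pd i).continuous (hφ.pd i).continuous
          (hc.pd i), integral_mul_pd (hw.pd i) hφ hc]
      ring
    simp only [lap, Finset.mul_sum, Finset.sum_mul]
    rw [integral_finsetSum, integral_finsetSum, integral_finsetSum, ← Finset.sum_sub_distrib]
    · exact Finset.sum_congr rfl fun i _ => e7 i
    · exact fun i _ => (int0 ((hh.pd i).sub (hw.pd i)) (hφ.pd i) (hc.pd i)).integrableOn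
    · exact fun i _ => int0 ((hw.pd i).pd i) hφ hc
    · exact fun i _ => integrable_mul_of_tsupport_subset
        ((locallyIntegrable_gluedField c r hh.continuous hw.continuous).locallyIntegrableOn Set.univ)
        ((hφ.pd i).pd i).continuous ((hc.pd i).pd i) (by simp)
  have e8 : ∫ x in Metric.ball c r, ∑ i, pd i q x * pd i φ x =
      εm * (∫ x in Metric.ball c r, ∑ i, (pd i h x - pd i w x) * pd i φ x)
      + (εΩ - εm) * ∫ x in Metric.ball c r, ∑ i, (pd i u₀ x + pd i h x) * pd i φ x := by
    rw [← integral_const_mul, ← integral_const_mul, ← integral_add]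
    · refine integral_congr_ae (Eventually.of_forall fun x => ?_)
      simp only [Finset.mul_sum, ← Finset.sum_add_distrib, hqp]
      exact Finset.sum_congr rfl fun i _ => by ring
    · exact (integrable_finsetSum _ fun i _ => (int0 ((hh.pd i).sub (hw.pd i)) (hφ.pd i)
        (hc.pd i)).integrableOn).const_mul _
    · exact (integrable_finsetSum _ fun i _ => (int0 ((hu.pd i).add (hh.pd i)) (hφ.pd i)
        (hc.pd i)).integrableOn).const_mul _
  rw [e6]
  rw [e4, e8] at hdiv
  linear_combination -hdiv

/-! ### The dipole field and existence of solutions. -/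

/-- The field of a dipole at `z`, of moment proportional to `a`. -/
noncomputable def dipoleField (K : ℂ) (a z : R3) (x : R3) : ℂ :=
  K * ∑ i, ((a i : ℝ) : ℂ) * dipole i (x - z)

theorem dipoleField_contDiffAt (K : ℂ) (a : R3) {z x : R3} (hx : x ≠ z) :
    ContDiffAt ℝ ∞ (dipoleField K a z) x :=
  contDiffAt_const.mul (ContDiffAt.sum fun i _ => contDiffAt_const.mul
    ((dipole_contDiffAt i (sub_ne_zero.2 hx)).comp x (contDiffAt_id.sub contDiffAt_const)))

theorem locallyIntegrable_comp_sub {F : R3 → ℂ} (hF : LocallyIntegrable F) (z : R3) :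
    LocallyIntegrable fun x => F (x - z) := by
  intro x
  obtain ⟨s, hs, hs'⟩ := hF (x - z)
  have hmp := measurePreserving_sub_right (volume : Measure R3) z
  refine ⟨(fun y => y - z) ⁻¹' s, (continuous_id.sub continuous_const).continuousAt hs, ?_⟩
  exact (hmp.integrableOn_comp_preimage (MeasurableEquiv.subRight z).measurableEmbedding).2 hs'

theorem locallyIntegrable_dipoleField (K : ℂ) (a z : R3) : LocallyIntegrable (dipoleField K a z) := by
  have h (i : Fin 3) : LocallyIntegrable fun x => K * (((a i : ℝ) : ℂ) * dipole i (x - z)) := by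
    have := ((locallyIntegrable_comp_sub (locallyIntegrable_dipole i) z).smul
      ((a i : ℝ) : ℂ)).smul K
    exact this
  have := locallyIntegrable_finsetSum Finset.univ fun i _ => h i
  refine this.congr (Eventually.of_forall fun x => ?_)
  simp [dipoleField, Finset.mul_sum]

theorem lap_dipole (i : Fin 3) {x : R3} (hx : x ≠ 0) : lap (dipole i) x = 0 := by
  have h1 (j : Fin 3) {y : R3} (hy : y ≠ 0) := (((hasPd_coord j i y).mul
    ((hasPd_invNorm j hy).pow 3)).const_mul (-1))
  have h2 (j : Fin 3) : pd j (dipole i) =ᶠ[𝓝 x] fun y =>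
      3 * (((y i : ℝ) : ℂ) * ((y j : ℝ) : ℂ) * invNorm y ^ 5)
        - (if j = i then 1 else 0) * invNorm y ^ 3 := by
    filter_upwards [isOpen_ne.mem_nhds hx] with y hy
    refine ((h1 j hy).congr (G := dipole i) (Eventually.of_forall fun x => ?_) ?_).2
    · rw [dipole]; ring
    · push_cast; ring
  have h3 (j : Fin 3) := ((((((hasPd_coord j i x).mul (hasPd_coord j j x)).mul
    ((hasPd_invNorm j hx).pow 5)).const_mul 3).sub
    (((hasPd_invNorm j hx).pow 3).const_mul (if j = i then 1 else 0)))).congr (h2 j) rfl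
  simp only [lap, (h3 _).2]
  have h5 : ∑ j : Fin 3, ((x j : ℝ) : ℂ) * (if j = i then 1 else 0) = ((x i : ℝ) : ℂ) := by simp
  rw [Fin.sum_univ_three] at h5 ⊢
  simp only [if_true]
  push_cast
  linear_combination (6 * invNorm x ^ 5) * h5
    - 15 * ((x i : ℝ) : ℂ) * invNorm x ^ 5 * invNorm_sq_mul hx

theorem lap_dipoleField (K : ℂ) (a : R3) {z x : R3} (hx : x ≠ z) :
    lap (dipoleField K a z) x = 0 := by
  have hd (i : Fin 3) {y : R3} (hy : y ≠ z) : ContDiffAt ℝ ∞ (fun x => dipole i (x - z)) y :=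
    (dipole_contDiffAt i (sub_ne_zero.2 hy)).comp y (contDiffAt_id.sub contDiffAt_const)
  have hd' (i j : Fin 3) : DifferentiableAt ℝ (pd j fun x => dipole i (x - z)) x := by
    have h1 : ContDiffAt ℝ ∞ (fderiv ℝ fun x => dipole i (x - z)) x :=
      (hd i hx).fderiv_right (by simp)
    exact (h1.clm_apply contDiffAt_const).differentiableAt (by simp)
  have h1 (j : Fin 3) : pd j (dipoleField K a z) =ᶠ[𝓝 x] fun y =>
      K * ∑ i, ((a i : ℝ) : ℂ) * pd j (fun x => dipole i (x - z)) y := by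
    filter_upwards [isOpen_ne.mem_nhds hx] with y hy
    exact ((HasPd.sum fun i => HasPd.const_mul ((a i : ℝ) : ℂ)
      ⟨(hd i hy).differentiableAt (by simp), rfl⟩).const_mul K).2
  have h2 (j : Fin 3) := ((HasPd.sum fun i => HasPd.const_mul ((a i : ℝ) : ℂ)
      (⟨hd' i j, rfl⟩ : HasPd j _ _ x)).const_mul K).congr (h1 j) rfl
  have h3 (i : Fin 3) : ∑ j, pd j (pd j fun x => dipole i (x - z)) x = 0 := by
    have := lap_comp_sub (dipole i) z x
    rwa [lap_dipole i (sub_ne_zero.2 hx)] at this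
  simp only [lap, (h2 _).2]
  rw [← Finset.mul_sum, Finset.sum_comm]
  simp only [← Finset.mul_sum, h3, mul_zero, Finset.sum_const_zero]

theorem integral_dipoleField_mul_lap (K : ℂ) (a z : R3) {φ : R3 → ℂ} (hφ : ContDiff ℝ ∞ φ)
    (hc : HasCompactSupport φ) :
    ∫ x, dipoleField K a z x * lap φ x = K * diracMass * fderiv ℝ φ z a := by
  have hφ' : ContDiff ℝ ∞ fun y => φ (y - -z) := hφ.comp (contDiff_id.sub contDiff_const)
  have hc' : HasCompactSupport fun y => φ (y - -z) :=
    hc.comp_homeomorph (Homeomorph.subRight (-z))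
  have h (i : Fin 3) : ∫ x, dipole i (x - z) * lap φ x = diracMass * pd i φ z := by
    have h1 := integral_dipole_mul_lap hφ' hc' i
    rw [pd_comp_sub, zero_sub, neg_neg] at h1
    rw [← h1, ← integral_sub_right_eq_self (fun x => dipole i x * lap (fun y => φ (y - -z)) x) z]
    refine integral_congr_ae (Eventually.of_forall fun x => ?_)
    simp only [lap_comp_sub]
    rw [sub_neg_eq_add, sub_add_cancel]
  rw [fderiv_apply_eq_sum]
  simp only [dipoleField, Finset.mul_sum, Finset.sum_mul]
  rw [integral_finsetSum]
  · refine Finset.sum_congr rfl fun i _ => ?_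
    simp_rw [mul_assoc]
    rw [integral_const_mul, integral_const_mul, h]
    ring
  · intro i _
    simp_rw [mul_assoc]
    exact ((integrable_mul_of_tsupport_subset ((locallyIntegrable_comp_sub
      (locallyIntegrable_dipole i) z).locallyIntegrableOn Set.univ) hφ.lap.continuous hc.lap
      (by simp)).const_mul _).const_mul _

theorem norm_dipoleField_le (K : ℂ) (a z x : R3) :
    ‖dipoleField K a z x‖ ≤ 3 * (‖K‖ * ‖a‖) * ‖x - z‖⁻¹ ^ 2 := by
  rw [dipoleField, norm_mul]
  calc _ ≤ ‖K‖ * ∑ _i : Fin 3, ‖a‖ * ‖x - z‖⁻¹ ^ 2 := by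
        gcongr
        refine norm_sum_le_of_le _ fun i _ => ?_
        rw [norm_mul]
        exact mul_le_mul (norm_coord_le a i) (norm_dipole_le i _) (norm_nonneg _) (norm_nonneg _)
    _ = _ := by simp; ring

theorem ContDiffAt.continuousAt_pd {F : R3 → ℂ} {x : R3} (hF : ContDiffAt ℝ ∞ F x) (i : Fin 3) :
    ContinuousAt (pd i F) x := by
  have h1 : ContDiffAt ℝ ∞ (fderiv ℝ F) x := hF.fderiv_right (by simp)
  exact (h1.clm_apply contDiffAt_const).continuousAt

/-- Incident field of the dipole, cut off near the source. -/
theorem exists_smooth_incident {c z : R3} {r : ℝ} (hr : 0 < r) (hz : r < ‖z - c‖) (K : ℂ) (a : R3) :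
    ∃ u₀ : R3 → ℂ, ContDiff ℝ ∞ u₀ ∧
      ∀ x ∈ Metric.ball c r, u₀ =ᶠ[𝓝 x] dipoleField K a z := by
  let f : ContDiffBump c := ⟨r, (r + ‖z - c‖) / 2, hr, by linarith⟩
  refine ⟨fun x => (f x : ℂ) * dipoleField K a z x, ?_, fun x hx => ?_⟩
  · refine contDiff_iff_contDiffAt.2 fun x => ?_
    rcases eq_or_ne x z with hx | hx
    · have h1 : ∀ᶠ y in 𝓝 x, (r + ‖z - c‖) / 2 < ‖y - c‖ :=
        (continuous_id.sub continuous_const).norm.continuousAt.eventually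
          (lt_mem_nhds (show (r + ‖z - c‖) / 2 < ‖x - c‖ by rw [hx]; linarith))
      have h2 : (fun y => (f y : ℂ) * dipoleField K a z y) =ᶠ[𝓝 x] fun _ => 0 := by
        filter_upwards [h1] with y hy
        rw [f.zero_of_le_dist (by rw [dist_eq_norm]; exact hy.le)]
        simp
      exact contDiffAt_const.congr_of_eventuallyEq h2
    · exact (contDiff_ofReal_comp f.contDiff).contDiffAt.mul (dipoleField_contDiffAt K a hx)
  · filter_upwards [Metric.isOpen_ball.mem_nhds hx] with y hy
    rw [f.one_of_mem_closedBall (Metric.ball_subset_closedBall hy)]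
    simp

/-- The solution is the dipole field plus the glued reflected fields. The bound on its gradient in
the ball is chosen before `s` and `εΩ`. -/
theorem exists_transmissionSolution {c a z : R3} {r εm : ℝ} (hr : 0 < r) (hz : r < ‖z - c‖)
    (hεm : 0 < εm) : ∃ C, ∀ s εΩ : ℂ, s.re = 1 / 2 → s * (εΩ + εm) = εm →
      ∃ u g, IsTransmissionSolution (Metric.ball c r) εΩ εm a z u g ∧
        ∀ x ∈ Metric.ball c r, ∀ i, ‖g x i‖ ≤ C := by
  -- Normalized so that `εm ΔD = a · ∇δ_z`: testing `D` against `Δφ` gives `K * diracMass` times the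
  -- derivative of `φ` along `a`.
  set K : ℂ := -((εm : ℂ) * diracMass)⁻¹ with hK
  set D := dipoleField K a z with hD
  have hDc {x : R3} (hx : x ≠ z) : ContDiffAt ℝ ∞ D x := dipoleField_contDiffAt K a hx
  have hDi : LocallyIntegrable D := locallyIntegrable_dipoleField K a z
  have hDp (i : Fin 3) : ContinuousOn (pd i D) {z}ᶜ :=
    fun x hx => ((hDc hx).continuousAt_pd i).continuousWithinAt
  have hbz {x : R3} (hx : x ∈ Metric.ball c r) : x ≠ z := fun h => by
    rw [h, mem_ball_iff_norm] at hx; linarith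
  -- The ray integrals want an incident field smooth on the whole space; the solution itself uses
  -- the true field `D`, and only the values in the ball have to agree.
  obtain ⟨u₀, hu, hu₀⟩ := exists_smooth_incident hr hz K a
  have hl : ∀ x ∈ Metric.ball c r, lap u₀ x = 0 := fun x hx => by
    rw [lap_congr (hu₀ x hx), lap_dipoleField K a (hbz hx)]
  obtain ⟨C, hC⟩ := exists_isTransmissionPair c hr hu hl
  choose B hB using fun i => (isCompact_closedBall c r).exists_bound_of_continuousOn
    (hu.pd i).continuous.continuousOn
  refine ⟨(B 0 ⊔ B 1 ⊔ B 2) + C, fun s εΩ hs1 hs2 => ?_⟩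
  obtain ⟨h, w, H⟩ := hC s hs1
  have hh := H.contDiff_in
  have hw := H.contDiff_out
  set J := gluedField c r h w with hJ
  have hJi : LocallyIntegrable J := locallyIntegrable_gluedField c r hh.continuous hw.continuous
  set J' := fun i => gluedField c r (pd i h) (pd i w) with hJ'0
  have hJ' (i : Fin 3) : J' i = gluedField c r (pd i h) (pd i w) := rfl
  have hJ'i (i : Fin 3) : LocallyIntegrable (J' i) :=
    locallyIntegrable_gluedField c r (hh.pd i).continuous (hw.pd i).continuous
  set g : R3 → C3 := fun x => WithLp.toLp 2 fun i => pd i D x + J' i x with hg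
  have hgi (i : Fin 3) (x : R3) : g x i = pd i D x + J' i x := rfl
  have hgl : LocallyIntegrableOn g {z}ᶜ := locallyIntegrableOn_of_components fun i =>
    ((hDp i).locallyIntegrableOn isOpen_compl_singleton.measurableSet).add
      ((hJ'i i).locallyIntegrableOn _)
  have hmul {F φ : R3 → ℂ} (hF : LocallyIntegrable F) (hφ : Continuous φ) (hc : HasCompactSupport φ) :
      Integrable fun x => F x * φ x :=
    integrable_mul_of_tsupport_subset (hF.locallyIntegrableOn Set.univ) hφ hc (by simp)
  refine ⟨fun x => D x + J x, g, ⟨hDi.add hJi, ⟨(hDi.add hJi).locallyIntegrableOn _, hgl, ?_⟩,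
    ?_, ?_, ?_⟩, ?_⟩
  · intro φ hφ i
    have hφc := hφ.complex
    simp_rw [← pd_ofReal i (hφ.1.contDiffAt.differentiableAt (by simp : (∞ : WithTop ℕ∞) ≠ 0)),
      hgi, add_mul]
    have iD : Integrable fun x => pd i D x * (φ x : ℂ) :=
      integrable_mul_of_tsupport_subset
        ((hDp i).locallyIntegrableOn isOpen_compl_singleton.measurableSet) hφc.1.continuous
        hφc.2.1 hφc.2.2
    rw [integral_add (hmul hDi (hφc.1.pd i).continuous (hφc.2.1.pd i))
      (hmul hJi (hφc.1.pd i).continuous (hφc.2.1.pd i)), integral_add iD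
      (hmul (hJ'i i) hφc.1.continuous hφc.2.1), integral_gluedField_mul_pd hr hh hw H.trace
      hφc.1 hφc.2.1, neg_add]
    congr 1
    -- Differentiability of `D` is only asked for on the support of `φ`, which avoids `z`.
    exact integral_mul_fderiv_eq_neg_fderiv_mul_of_integrable iD
      (hmul hDi (hφc.1.pd i).continuous (hφc.2.1.pd i)) (hmul hDi hφc.1.continuous hφc.2.1)
      (fun x hx => (hDc (hφc.2.2 hx)).differentiableAt (by simp))
      (fun x _ => hφc.1.differentiableAt_top x)
  · intro S hS hSz
    have : IsFiniteMeasure (volume.restrict S) := ⟨by simpa using hS.measure_lt_top⟩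
    choose b₁ hb₁ using fun i => hS.exists_bound_of_continuousOn ((hDp i).mono hSz)
    choose b₂ hb₂ using fun i => hS.exists_bound_of_continuousOn (hh.pd i).continuous.continuousOn
    choose b₃ hb₃ using fun i => hS.exists_bound_of_continuousOn (hw.pd i).continuous.continuousOn
    refine MemLp.of_bound (hgl.integrableOn_compact_subset hSz hS).aestronglyMeasurable
      (∑ i, (b₁ i + max (b₂ i) (b₃ i))) ?_
    filter_upwards [ae_restrict_mem hS.measurableSet] with x hx
    refine (norm_le_sum_components _).trans (Finset.sum_le_sum fun i _ => ?_)
    rw [hgi]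
    refine (norm_add_le _ _).trans (add_le_add (hb₁ i x hx) ?_)
    by_cases hxb : x ∈ Metric.ball c r
    · rw [hJ', gluedField_in hxb]; exact (hb₂ i x hx).trans (le_max_left _ _)
    · rw [hJ', gluedField_out hxb]; exact (hb₃ i x hx).trans (le_max_right _ _)
  · intro φ hφ
    have hφc := hφ.complex
    have e1 := integral_dipoleField_mul_lap K a z hφc.1 hφc.2.1
    have e2 := transmission_reflected hr hu hl H hs2 hφc.1 hφc.2.1
    have e3 : ∫ x in Metric.ball c r, ∑ i, g x i * (partialDeriv i φ x : ℂ) =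
        ∫ x in Metric.ball c r, ∑ i, (pd i u₀ x + pd i h x) * pd i (fun x => (φ x : ℂ)) x := by
      refine setIntegral_congr_fun measurableSet_ball fun x hx => ?_
      refine Finset.sum_congr rfl fun i _ => ?_
      rw [hgi, hJ', gluedField_in hx, pd_ofReal i (hφ.1.contDiffAt.differentiableAt (by simp)),
        pd_congr i (hu₀ x hx)]
    have e4 : fderiv ℝ (fun x => (φ x : ℂ)) z a = ((fderiv ℝ φ z a : ℝ) : ℂ) := by
      have d := Complex.ofRealCLM.hasFDerivAt.comp z
        (hφ.1.contDiffAt.differentiableAt (x := z) (by simp)).hasFDerivAt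
      rw [Function.comp_def] at d
      have := d.fderiv
      simp only [Complex.ofRealCLM_apply] at this
      rw [this]
      simp
    simp_rw [laplacian_ofReal hφ.1, add_mul]
    rw [integral_add (hmul hDi hφc.1.lap.continuous hφc.2.1.lap)
      (hmul hJi hφc.1.lap.continuous hφc.2.1.lap), e3, ← e4, mul_add, add_sub_assoc, e2, e1, hK]
    have h1 : (εm : ℂ) ≠ 0 := by exact_mod_cast hεm.ne'
    have h2 : (diracMass : ℂ) ≠ 0 := by exact_mod_cast diracMass_pos.ne'
    field_simp
    simp
  · obtain ⟨M, hM0, hM⟩ := H.decay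
    -- Beyond this radius the distances to `z` and to `c` are at least `‖x‖ / 2`, and squaring gives
    -- the factors `4`.
    refine ⟨4 * (3 * (‖K‖ * ‖a‖)) + 4 * M, 2 * ‖z‖ + 2 * ‖c‖ + 2 * r, Eventually.of_forall
      fun x hx => ?_⟩
    have n1 := norm_nonneg z
    have n2 := norm_nonneg c
    have hx0 : 0 < ‖x‖ := by linarith
    have hxz : ‖x‖ / 2 ≤ ‖x - z‖ := by have := norm_sub_norm_le x z; linarith
    have hxc : ‖x‖ / 2 ≤ ‖x - c‖ := by have := norm_sub_norm_le x c; linarith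
    have hxr : r ≤ ‖x - c‖ := by linarith
    have hxb : x ∉ Metric.ball c r := by rw [mem_ball_iff_norm]; exact not_lt.2 hxr
    have e1 : ‖D x‖ ≤ 4 * (3 * (‖K‖ * ‖a‖)) / ‖x‖ ^ 2 := by
      refine (norm_dipoleField_le K a z x).trans ?_
      calc _ ≤ 3 * (‖K‖ * ‖a‖) * (‖x‖ / 2)⁻¹ ^ 2 := by gcongr
        _ = _ := by field_simp; ring
    have e2 : ‖J x‖ ≤ 4 * M / ‖x‖ ^ 2 := by
      rw [hJ, gluedField_out hxb]
      refine (hM x hxr).1.trans ?_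
      calc _ ≤ M / (‖x‖ / 2) ^ 2 := by gcongr
        _ = _ := by field_simp; ring
    rw [add_div]
    exact (norm_add_le _ _).trans (add_le_add e1 e2)
  · intro x hx i
    rw [hgi, hJ', gluedField_in hx, ← pd_congr i (hu₀ x hx)]
    refine (norm_add_le _ _).trans (add_le_add ?_ (H.bound x hx i))
    refine (hB i x (Metric.ball_subset_closedBall hx)).trans ?_
    fin_cases i <;> simp

/-! ### Homogeneous solutions and duality. -/

theorem lap_const (a : ℂ) (x : R3) : lap (fun _ => a) x = 0 := by
  have h (i : Fin 3) : pd i (fun _ : R3 => a) = fun _ => 0 := funext (pd_const i a)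
  simp [lap, h, pd_const]

theorem HasWeakGradientOn.mono {U V : Set R3} {u : R3 → ℂ} {g : R3 → C3}
    (h : HasWeakGradientOn U u g) (hVU : V ⊆ U) : HasWeakGradientOn V u g :=
  ⟨h.1.mono_set hVU, h.2.1.mono_set hVU, fun φ hφ => h.2.2 φ ⟨hφ.1, hφ.2.1, hφ.2.2.trans hVU⟩⟩

theorem HasWeakGradientOn.integral_mul_lap {U : Set R3} {u : R3 → ℂ} {g : R3 → C3}
    (h : HasWeakGradientOn U u g) {φ : R3 → ℂ} (hφ : IsComplexTest U φ) :
    ∫ x, u x * lap φ x = -∫ x, ∑ i, g x i * pd i φ x := by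
  have hp (i : Fin 3) : IsComplexTest U (pd i φ) :=
    ⟨hφ.1.pd i, hφ.2.1.pd i, (tsupport_pd_subset i φ).trans hφ.2.2⟩
  have hpp (i : Fin 3) : IsComplexTest U (pd i (pd i φ)) :=
    ⟨(hp i).1.pd i, (hp i).2.1.pd i, (tsupport_pd_subset i _).trans (hp i).2.2⟩
  simp only [lap, Finset.mul_sum]
  rw [integral_finsetSum, integral_finsetSum, ← Finset.sum_neg_distrib]
  · exact Finset.sum_congr rfl fun i _ => h.complex (hp i) i
  · exact fun i _ => integrable_mul_of_tsupport_subset (h.integrable_grad_mul i)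
      (hp i).1.continuous (hp i).2.1 (hp i).2.2
  · exact fun i _ => integrable_mul_of_tsupport_subset h.1
      (hpp i).1.continuous (hpp i).2.1 (hpp i).2.2

theorem HasWeakGradientOn.ae_eq_zero {U : Set R3} (hU : IsOpen U) {u : R3 → ℂ} {g : R3 → C3}
    (h : HasWeakGradientOn U u g) (h0 : ∀ᵐ x, x ∈ U → u x = 0) (i : Fin 3) :
    ∀ᵐ x, x ∈ U → g x i = 0 := by
  refine hU.ae_eq_zero_of_integral_contDiff_smul_eq_zero (h.integrable_grad_mul i)
    fun φ h1 h2 h3 => ?_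
  have e := h.2.2 φ ⟨h1, h2, h3⟩ i
  have e0 : ∫ x, u x * (partialDeriv i φ x : ℂ) = 0 := by
    refine integral_eq_zero_of_ae ?_
    have hφc := IsTestFunction.complex (U := U) (φ := φ) ⟨h1, h2, h3⟩
    filter_upwards [h0] with x hx
    by_cases hxU : x ∈ U
    · simp [hx hxU]
    · rw [← pd_ofReal i (h1.contDiffAt.differentiableAt (by simp)),
        image_eq_zero_of_notMem_tsupport fun h' => hxU (hφc.2.2 (tsupport_pd_subset i _ h'))]
      simp
  rw [e0] at e
  simp only [Complex.real_smul, mul_comm ((φ _ : ℝ) : ℂ)]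
  exact (neg_eq_zero.1 e.symm)

/-- A solution of the transmission problem without sources. -/
structure IsHomogeneousSolution (c z : R3) (r : ℝ) (εΩ εm : ℂ) (u : R3 → ℂ) (g : R3 → C3) :
    Prop where
  locallyIntegrable : LocallyIntegrable u
  weakGradient : HasWeakGradientOn {z}ᶜ u g
  equation : ∀ φ, IsComplexTest Set.univ φ → transmissionForm (Metric.ball c r) εΩ εm u g φ = 0
  decay : ∃ M R : ℝ, ∀ᵐ x, R ≤ ‖x - c‖ → ‖u x‖ ≤ M / ‖x - c‖ ^ 2

section

variable {c z : R3} {r : ℝ} {εΩ εm : ℂ} {u : R3 → ℂ} {g : R3 → C3}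

theorem IsHomogeneousSolution.integrableOn_grad (h : IsHomogeneousSolution c z r εΩ εm u g)
    (hz : r < ‖z - c‖) (i : Fin 3) : IntegrableOn (fun x => g x i) (Metric.ball c r) := by
  refine ((h.weakGradient.integrable_grad_mul i).integrableOn_compact_subset ?_
    (isCompact_closedBall c r)).mono_set Metric.ball_subset_closedBall
  intro x hx hxz
  rw [Set.mem_singleton_iff.1 hxz, mem_closedBall_iff_norm] at hx
  linarith

theorem ball_subset_compl_singleton (hz : r < ‖z - c‖) : Metric.ball c r ⊆ {z}ᶜ := by
  intro x hx hxz
  rw [Set.mem_singleton_iff.1 hxz, mem_ball_iff_norm] at hx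
  linarith

/-- Green's second identity for the transmission problem: a homogeneous solution is tested with a
field which is continuous, with continuous flux, across the sphere. -/
theorem IsHomogeneousSolution.duality (H : IsHomogeneousSolution c z r εΩ εm u g) (hr : 0 < r)
    (hz : r < ‖z - c‖) {A B : R3 → ℂ} (hA : IsComplexTest Set.univ A) (hB : ContDiff ℝ ∞ B)
    (ht : ∀ x ∈ Metric.sphere c r, A x = B x)
    (hf : ∀ x ∈ Metric.sphere c r, εΩ * ∑ i, (((x - c) i : ℝ) : ℂ) * pd i B x =
      εm * ∑ i, (((x - c) i : ℝ) : ℂ) * pd i A x) :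
    εm * (∫ x, u x * lap A x)
      + ∫ x in Metric.ball c r, u x * (εΩ * lap B x - εm * lap A x) = 0 := by
  have hg := H.integrableOn_grad hz
  have hwb := H.weakGradient.mono (ball_subset_compl_singleton hz)
  have hub : IntegrableOn u (Metric.ball c r) :=
    (H.locallyIntegrable.integrableOn_isCompact (isCompact_closedBall c r)).mono_set
      Metric.ball_subset_closedBall
  have hw := hB.sub hA.1
  -- Inside the ball the equation is `εΩ Δu = 0`. It may be tested with `B - A`, which vanishes on
  -- the sphere and is a limit of functions with compact support in the ball.
  have e1 : εΩ * ∫ x in Metric.ball c r, ∑ i, g x i * pd i (fun x => B x - A x) x = 0 := by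
    refine tendsto_nhds_unique ((tendsto_integral_grad_ballCutoff_mul hr hg hw
      fun x hx => by rw [ht x hx, sub_self]).const_mul εΩ) (tendsto_const_nhds.congr fun n => ?_)
    have hn := IsComplexTest.ballCutoff_mul c hr n hw
    have h1 := H.equation _ ⟨hn.1, hn.2.1, Set.subset_univ _⟩
    rw [transmissionForm, hwb.integral_mul_lap hn, ← setIntegral_ball_eq_of_tsupport] at h1
    · linear_combination h1
    · refine closure_minimal (fun x hx => ?_) (isClosed_tsupport _) |>.trans hn.2.2
      by_contra hx'
      apply hx
      refine Finset.sum_eq_zero fun i _ => ?_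
      rw [image_eq_zero_of_notMem_tsupport fun h' => hx' (tsupport_pd_subset i _ h'), mul_zero]
  have e2 := H.equation A hA
  have hP (i : Fin 3) : ContDiff ℝ ∞ fun x => εΩ * pd i B x - εm * pd i A x :=
    (contDiff_const.mul (hB.pd i)).sub (contDiff_const.mul (hA.1.pd i))
  -- Continuity of the flux says that `εΩ ∇B - εm ∇A` is tangential, so Green's formula has no
  -- surface term.
  have e3 := hwb.integral_tangential hr hub hg hP fun x hx => by
    have := hf x hx
    rw [← sub_eq_zero] at this
    rw [← this]
    simp only [Finset.mul_sum, ← Finset.sum_sub_distrib]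
    exact Finset.sum_congr rfl fun i _ => by ring
  have hdiv (x : R3) : ∑ i, pd i (fun x => εΩ * pd i B x - εm * pd i A x) x =
      εΩ * lap B x - εm * lap A x := by
    simp only [lap, Finset.mul_sum, ← Finset.sum_sub_distrib]
    refine Finset.sum_congr rfl fun i _ => ?_
    have h1 := (hB.pd i).differentiableAt_top x
    have h2 := (hA.1.pd i).differentiableAt_top x
    rw [pd_sub i (h1.const_mul _) (h2.const_mul _), pd_const_mul i _ h1, pd_const_mul i _ h2]
  simp only [hdiv] at e3
  have iB : IntegrableOn (fun x => ∑ i, g x i * pd i (fun x => B x - A x) x) (Metric.ball c r) :=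
    integrable_finsetSum _ fun i _ => integrableOn_mul_continuous (hg i) (hw.pd i).continuous
  have iA : IntegrableOn (fun x => ∑ i, g x i * pd i A x) (Metric.ball c r) :=
    integrable_finsetSum _ fun i _ => integrableOn_mul_continuous (hg i) (hA.1.pd i).continuous
  have e4 : ∫ x in Metric.ball c r, ∑ i, g x i * (εΩ * pd i B x - εm * pd i A x) =
      εΩ * (∫ x in Metric.ball c r, ∑ i, g x i * pd i (fun x => B x - A x) x)
      + (εΩ - εm) * ∫ x in Metric.ball c r, ∑ i, g x i * pd i A x := by
    rw [← integral_const_mul, ← integral_const_mul,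
      ← integral_add (iB.const_mul _) (iA.const_mul _)]
    refine integral_congr_ae (Eventually.of_forall fun x => ?_)
    simp only [Finset.mul_sum, ← Finset.sum_add_distrib]
    refine Finset.sum_congr rfl fun i _ => ?_
    rw [pd_sub i (hB.differentiableAt_top x) (hA.1.differentiableAt_top x)]
    ring
  rw [transmissionForm] at e2
  linear_combination e2 + e3 - e4 - e1

/-! ### Cutoff at infinity. -/

/-- A smooth cutoff equal to `1` on the ball of radius `R` about `c` and to `0` outside the ball
of radius `2R`. -/
noncomputable def farCutoff (c : R3) (R : ℝ) (x : R3) : ℂ :=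
  (((⟨1, 2, one_pos, one_lt_two⟩ : ContDiffBump (0 : R3)) (R⁻¹ • (x - c)) : ℝ) : ℂ)

theorem farCutoff_contDiff (c : R3) (R : ℝ) : ContDiff ℝ ∞ (farCutoff c R) :=
  contDiff_ofReal_comp ((ContDiffBump.contDiff _).comp
    ((contDiff_id.sub contDiff_const).const_smul R⁻¹))

theorem farCutoff_eq_one {R : ℝ} (hR : 0 < R) {x : R3} (hx : ‖x - c‖ ≤ R) : farCutoff c R x = 1 := by
  rw [farCutoff, ContDiffBump.one_of_mem_closedBall, Complex.ofReal_one]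
  rw [mem_closedBall_zero_iff, norm_smul, norm_inv, Real.norm_of_nonneg hR.le,
    inv_mul_le_iff₀ hR]
  simpa using hx

theorem farCutoff_eq_zero {R : ℝ} (hR : 0 < R) {x : R3} (hx : 2 * R ≤ ‖x - c‖) :
    farCutoff c R x = 0 := by
  rw [farCutoff, ContDiffBump.zero_of_le_dist, Complex.ofReal_zero]
  rw [dist_zero_right, norm_smul, norm_inv, Real.norm_of_nonneg hR.le, le_inv_mul_iff₀ hR]
  linarith

theorem farCutoff_eventuallyEq_one {R : ℝ} (hR : 0 < R) {x : R3} (hx : ‖x - c‖ < R) :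
    farCutoff c R =ᶠ[𝓝 x] fun _ => 1 := by
  filter_upwards [(continuous_id.sub continuous_const).norm.continuousAt.eventually
    (gt_mem_nhds (show ‖id x - c‖ < R from hx))] with y hy using farCutoff_eq_one hR (le_of_lt hy)

theorem farCutoff_eventuallyEq_zero {R : ℝ} (hR : 0 < R) {x : R3} (hx : 2 * R < ‖x - c‖) :
    farCutoff c R =ᶠ[𝓝 x] fun _ => 0 := by
  filter_upwards [(continuous_id.sub continuous_const).norm.continuousAt.eventually
    (lt_mem_nhds (show 2 * R < ‖id x - c‖ from hx))] with y hy
  exact farCutoff_eq_zero hR (le_of_lt hy)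

theorem farCutoff_hasCompactSupport {R : ℝ} (hR : 0 < R) : HasCompactSupport (farCutoff c R) := by
  refine HasCompactSupport.intro (isCompact_closedBall c (2 * R)) fun x hx => ?_
  rw [mem_closedBall_iff_norm, not_le] at hx
  exact farCutoff_eq_zero hR hx.le

theorem pd_comp_smul_sub {F : R3 → ℂ} (hF : ContDiff ℝ ∞ F) (c : R3) (R : ℝ) (i : Fin 3) (x : R3) :
    pd i (fun y => F (R • (y - c))) x = R * pd i F (R • (x - c)) := by
  have h1 : HasFDerivAt (fun y : R3 => R • (y - c)) (R • ContinuousLinearMap.id ℝ R3) x :=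
    ((hasFDerivAt_id x).sub_const c).const_smul R
  have h2 := (hF.differentiableAt_top (R • (x - c))).hasFDerivAt.comp x h1
  rw [Function.comp_def] at h2
  rw [pd, h2.fderiv]
  simp [pd]

theorem exists_farCutoff_bound : ∃ B, 0 ≤ B ∧ ∀ (c : R3) (R : ℝ), 0 < R → ∀ x,
    (∀ i, ‖pd i (farCutoff c R) x‖ ≤ B / R) ∧ ‖lap (farCutoff c R) x‖ ≤ B / R ^ 2 := by
  set f : R3 → ℂ := fun x => (((⟨1, 2, one_pos, one_lt_two⟩ : ContDiffBump (0 : R3)) x : ℝ) : ℂ)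
    with hf
  have hfc : ContDiff ℝ ∞ f := contDiff_ofReal_comp (ContDiffBump.contDiff _)
  have hfs : HasCompactSupport f := (ContDiffBump.hasCompactSupport _).comp_left Complex.ofReal_zero
  choose B₁ hB₁ using fun i => (hfs.pd i).exists_bound_of_continuous (hfc.pd i).continuous
  obtain ⟨B₂, hB₂⟩ := hfs.lap.exists_bound_of_continuous hfc.lap.continuous
  have hp (c : R3) (R : ℝ) (i : Fin 3) : pd i (farCutoff c R) =
      fun x => ((R⁻¹ : ℝ) : ℂ) * pd i f (R⁻¹ • (x - c)) :=
    funext fun x => pd_comp_smul_sub hfc c R⁻¹ i x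
  have hl (c : R3) (R : ℝ) (x : R3) : lap (farCutoff c R) x =
      ((R⁻¹ : ℝ) : ℂ) ^ 2 * lap f (R⁻¹ • (x - c)) := by
    simp only [lap, hp, Finset.mul_sum]
    refine Finset.sum_congr rfl fun i _ => ?_
    have h1 : ContDiff ℝ ∞ fun x => pd i f (R⁻¹ • (x - c)) :=
      (hfc.pd i).comp ((contDiff_id.sub contDiff_const).const_smul R⁻¹)
    rw [pd_const_mul i _ (h1.differentiableAt_top x), pd_comp_smul_sub (hfc.pd i)]
    ring
  refine ⟨max 0 (max B₂ (B₁ 0 ⊔ B₁ 1 ⊔ B₁ 2)), le_max_left _ _, fun c R hR x => ⟨fun i => ?_, ?_⟩⟩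
  · rw [hp, norm_mul, Complex.norm_real, norm_inv, Real.norm_of_nonneg hR.le, inv_mul_eq_div]
    gcongr
    refine (hB₁ i _).trans ?_
    fin_cases i <;> simp
  · rw [hl, norm_mul, norm_pow, Complex.norm_real, norm_inv, Real.norm_of_nonneg hR.le, inv_pow,
      inv_mul_eq_div]
    gcongr
    exact (hB₂ _).trans (by simp)

/-- The contribution of the cutoff at infinity vanishes in the limit. -/
theorem tendsto_integral_farCutoff (hu : ∃ M R : ℝ, ∀ᵐ x, R ≤ ‖x - c‖ → ‖u x‖ ≤ M / ‖x - c‖ ^ 2)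
    {F : R3 → ℂ} (hF : ∃ M R : ℝ, ∀ x, R ≤ ‖x - c‖ → ‖F x‖ ≤ M / ‖x - c‖ ∧
      ∀ i, ‖pd i F x‖ ≤ M / ‖x - c‖) :
    Tendsto (fun R : ℝ => ∫ x, u x * (2 * (∑ i, pd i (farCutoff c R) x * pd i F x)
      + F x * lap (farCutoff c R) x)) atTop (𝓝 0) := by
  obtain ⟨M₁, R₁, h₁⟩ := hu
  obtain ⟨M₂, R₂, h₂⟩ := hF
  obtain ⟨B, hB0, hB⟩ := exists_farCutoff_bound
  set V := (volume : Measure R3).real (Metric.ball 0 1)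
  have hlim : Tendsto (fun R : ℝ => |M₁| * (9 * (B * |M₂|)) * 8 * V * R⁻¹) atTop (𝓝 0) := by
    simpa using tendsto_inv_atTop_zero.const_mul (|M₁| * (9 * (B * |M₂|)) * 8 * V)
  refine squeeze_zero_norm' ?_ hlim
  filter_upwards [eventually_ge_atTop 1, eventually_ge_atTop R₁, eventually_ge_atTop R₂]
    with R hR hR₁ hR₂
  have hR0 : 0 < R := by linarith
  have hz : ∀ x, x ∉ Metric.closedBall c (2 * R) → u x * (2 * (∑ i, pd i (farCutoff c R) x *
      pd i F x) + F x * lap (farCutoff c R) x) = 0 := by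
    intro x hx
    rw [mem_closedBall_iff_norm, not_le] at hx
    have := farCutoff_eventuallyEq_zero hR0 hx
    simp [pd_congr _ this, lap_congr this, pd_const, lap_const]
  rw [← setIntegral_eq_integral_of_forall_compl_eq_zero hz]
  -- Where the cutoff varies, `u` is `O(R⁻²)` and the bracket is `O(R⁻²)`. The bound `R⁻⁴` beats the
  -- volume, of order `R³`. The constant `9` is `2·3 + 3`, and `8` above comes from the radius `2R`.
  have hb : ∀ᵐ x, x ∈ Metric.closedBall c (2 * R) → ‖u x * (2 * (∑ i, pd i (farCutoff c R) x *
      pd i F x) + F x * lap (farCutoff c R) x)‖ ≤ |M₁| * (9 * (B * |M₂|)) / R ^ 4 := by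
    filter_upwards [h₁] with x hx _
    rcases lt_or_ge ‖x - c‖ R with hxR | hxR
    · have := farCutoff_eventuallyEq_one hR0 hxR
      simp only [pd_congr _ this, lap_congr this, pd_const, lap_const]
      simp
      positivity
    · have hx0 : 0 < ‖x - c‖ := by linarith
      have k1 : ‖u x‖ ≤ |M₁| / R ^ 2 := (hx (hR₁.trans hxR)).trans (by
        gcongr
        exact le_abs_self M₁)
      have k2 : M₂ / ‖x - c‖ ≤ |M₂| / R := by
        gcongr
        exact le_abs_self M₂
      obtain ⟨k3, k4⟩ := h₂ x (hR₂.trans hxR)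
      obtain ⟨k5, k6⟩ := hB c R hR0 x
      have k7 : ‖∑ i, pd i (farCutoff c R) x * pd i F x‖ ≤ 3 * (B / R * (|M₂| / R)) := by
        calc _ ≤ ∑ _i : Fin 3, B / R * (|M₂| / R) := norm_sum_le_of_le _ fun i _ => ?_
          _ = _ := by simp
        rw [norm_mul]
        exact mul_le_mul (k5 i) ((k4 i).trans k2) (norm_nonneg _) (by positivity)
      have k8 : ‖F x * lap (farCutoff c R) x‖ ≤ 3 * (B / R * (|M₂| / R)) := by
        rw [norm_mul]
        calc _ ≤ |M₂| / R * (B / R ^ 2) :=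
              mul_le_mul (k3.trans k2) k6 (norm_nonneg _) (by positivity)
          _ ≤ |M₂| / R * (3 * (B / R)) := by
              gcongr
              calc B / R ^ 2 ≤ B / R := by
                    gcongr
                    nlinarith
                _ ≤ 3 * (B / R) := by
                    have : 0 ≤ B / R := by positivity
                    linarith
          _ = _ := by ring
      rw [norm_mul]
      calc _ ≤ |M₁| / R ^ 2 * (2 * (3 * (B / R * (|M₂| / R))) + 3 * (B / R * (|M₂| / R))) := by
            refine mul_le_mul k1 ((norm_add_le _ _).trans (add_le_add ?_ k8)) (norm_nonneg _)
              (by positivity)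
            rw [norm_mul, Complex.norm_ofNat]
            gcongr
        _ = _ := by field_simp; ring
  refine (norm_setIntegral_le_of_norm_le_const_ae' measure_closedBall_lt_top hb).trans ?_
  rw [Measure.addHaar_real_closedBall _ _ (by positivity)]
  simp only [finrank_euclideanSpace, Fintype.card_fin]
  apply le_of_eq
  field_simp
  ring

theorem newtonPotential_decay (c : R3) {ψ : R3 → ℂ} (hψ : ContDiff ℝ ∞ ψ) (hc : HasCompactSupport ψ) :
    ∃ M R : ℝ, 0 ≤ M ∧ ∀ x, R ≤ ‖x - c‖ → ‖newtonPotential ψ x‖ ≤ M / ‖x - c‖ ∧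
      ∀ i, ‖pd i (newtonPotential ψ) x‖ ≤ M / ‖x - c‖ := by
  obtain ⟨M₀, R₀, hM₀, hR₀, h₀⟩ := newtonPotential_bound hψ.continuous hc
  choose M₁ R₁ hM₁ hR₁ h₁ using fun i => newtonPotential_bound (hψ.pd i).continuous (hc.pd i)
  have hs : ∀ i, M₁ i ≤ ∑ j, M₁ j := fun i =>
    Finset.single_le_sum (fun j _ => hM₁ j) (Finset.mem_univ i)
  have hs' : ∀ i, R₁ i ≤ ∑ j, R₁ j := fun i =>
    Finset.single_le_sum (fun j _ => (hR₁ j).le) (Finset.mem_univ i)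
  have hn : 0 ≤ ∑ j, M₁ j := Finset.sum_nonneg fun j _ => hM₁ j
  have hn' : 0 ≤ ∑ j, R₁ j := Finset.sum_nonneg fun j _ => (hR₁ j).le
  refine ⟨2 * (M₀ + ∑ j, M₁ j), 2 * ‖c‖ + 2 * (R₀ + ∑ j, R₁ j), by positivity, fun x hx => ?_⟩
  have hxc : ‖x - c‖ / 2 ≤ ‖x‖ := by
    have := norm_sub_le x c
    have := norm_nonneg c
    linarith
  have hx0 : 0 < ‖x - c‖ := by have := norm_nonneg c; linarith
  have hR : R₀ + ∑ j, R₁ j ≤ ‖x‖ := by have := norm_nonneg c; linarith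
  have key {m : ℝ} (hm : 0 ≤ m) (hm' : m ≤ M₀ + ∑ j, M₁ j) :
      m / ‖x‖ ≤ 2 * (M₀ + ∑ j, M₁ j) / ‖x - c‖ := by
    calc m / ‖x‖ ≤ (M₀ + ∑ j, M₁ j) / (‖x - c‖ / 2) := by gcongr
      _ = _ := by field_simp
  refine ⟨(h₀ x (by linarith)).trans (key hM₀ (by linarith)), fun i => ?_⟩
  rw [pd_newtonPotential hψ hc]
  exact (h₁ i x (by linarith [hs' i])).trans (key (hM₁ i) (by linarith [hs i]))

theorem ae_notMem_sphere (c : R3) (r : ℝ) : ∀ᵐ x : R3, x ∉ Metric.sphere c r :=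
  measure_eq_zero_iff_ae_notMem.1 (Measure.addHaar_sphere volume c r)

/-! ### Vanishing of homogeneous solutions. -/

/-- Uniqueness from existence for the dual problem, which is the same problem because the form is
bilinear. The field radiated by `ψ` in the presence of the ball, cut off at infinity, is the test
function in `duality`. -/
theorem IsHomogeneousSolution.integral_exterior_eq_zero
    (H : IsHomogeneousSolution c z r εΩ εm u g) (hr : 0 < r) (hz : r < ‖z - c‖) {s : ℂ}
    (hs : s.re = 1 / 2) (hs' : s * (εΩ + εm) = εm) (hm : εm ≠ 0) {ψ : R3 → ℂ}
    (hψ : IsComplexTest (Metric.closedBall c r)ᶜ ψ) : ∫ x, u x * ψ x = 0 := by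
  set u₀ := newtonPotential ψ with hu₀
  have hu : ContDiff ℝ ∞ u₀ := newtonPotential_contDiff hψ.1 hψ.2.1
  have hlu (x : R3) : lap u₀ x = -(diracMass : ℂ) * ψ x := lap_newtonPotential hψ.1 hψ.2.1 x
  have hψ0 {x : R3} (hx : x ∈ Metric.ball c r) : ψ x = 0 :=
    image_eq_zero_of_notMem_tsupport fun h => hψ.2.2 h (Metric.ball_subset_closedBall hx)
  have hl : ∀ x ∈ Metric.ball c r, lap u₀ x = 0 := fun x hx => by rw [hlu, hψ0 hx, mul_zero]
  obtain ⟨C, hC⟩ := exists_isTransmissionPair c hr hu hl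
  obtain ⟨h, w, T⟩ := hC s hs
  have hh := T.contDiff_in
  have hw := T.contDiff_out
  set F : R3 → ℂ := fun x => u₀ x + w x with hF
  have hFc : ContDiff ℝ ∞ F := hu.add hw
  have hFp (i : Fin 3) (x : R3) : pd i F x = pd i u₀ x + pd i w x :=
    pd_add i (hu.differentiableAt_top x) (hw.differentiableAt_top x)
  have hFl (x : R3) : lap F x = -(diracMass : ℂ) * ψ x + lap w x := by
    rw [hF, lap_add hu hw, hlu]
  have hFd : ∃ M R : ℝ, ∀ x, R ≤ ‖x - c‖ → ‖F x‖ ≤ M / ‖x - c‖ ∧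
      ∀ i, ‖pd i F x‖ ≤ M / ‖x - c‖ := by
    obtain ⟨M₁, R₁, hM₁, h₁⟩ := newtonPotential_decay c hψ.1 hψ.2.1
    obtain ⟨M₂, hM₂, h₂⟩ := T.decay
    refine ⟨M₁ + M₂, max R₁ (max r 1), fun x hx => ?_⟩
    have hx1 : R₁ ≤ ‖x - c‖ := (le_max_left _ _).trans hx
    have hx2 : r ≤ ‖x - c‖ := ((le_max_left _ _).trans (le_max_right _ _)).trans hx
    have hx3 : 1 ≤ ‖x - c‖ := ((le_max_right _ _).trans (le_max_right _ _)).trans hx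
    rw [add_div]
    refine ⟨(norm_add_le _ _).trans (add_le_add (h₁ x hx1).1 ((h₂ x hx2).1.trans ?_)), fun i => ?_⟩
    · gcongr
      nlinarith
    · rw [hFp]
      exact (norm_add_le _ _).trans (add_le_add ((h₁ x hx1).2 i) ((h₂ x hx2).2 i))
  have hB : ContDiff ℝ ∞ fun x => u₀ x + h x := hu.add hh
  have hBl : ∀ x ∈ Metric.ball c r, lap (fun x => u₀ x + h x) x = 0 := fun x hx => by
    rw [lap_add hu hh, hl x hx, T.lap_in x hx, add_zero]
  have hint {G : R3 → ℂ} (hG : Continuous G) (hGc : HasCompactSupport G) :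
      Integrable fun x => u x * G x :=
    integrable_mul_of_tsupport_subset (H.locallyIntegrable.locallyIntegrableOn Set.univ) hG hGc
      (by simp)
  obtain ⟨L, hL⟩ := hψ.2.1.isBounded.subset_closedBall c
  have hlim := tendsto_integral_farCutoff H.decay hFd
  -- Once `R` exceeds `r` and the support of `ψ`, duality leaves only the source term and the
  -- commutator with the cutoff. The left side does not depend on `R`, and the right side tends to
  -- zero.
  have hev : ∀ᶠ R : ℝ in atTop, (diracMass : ℂ) * ∫ x, u x * ψ x =
      ∫ x, u x * (2 * (∑ i, pd i (farCutoff c R) x * pd i F x) + F x * lap (farCutoff c R) x) := by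
    filter_upwards [eventually_gt_atTop r, eventually_ge_atTop L] with R hR hRL
    have hR0 : 0 < R := hr.trans hR
    have hχ := farCutoff_contDiff c R
    have hχc := farCutoff_hasCompactSupport (c := c) hR0
    have hnear {x : R3} (hx : ‖x - c‖ ≤ r) : (fun x => farCutoff c R x * F x) =ᶠ[𝓝 x] F := by
      filter_upwards [farCutoff_eventuallyEq_one hR0 (hx.trans_lt hR)] with y hy
      rw [hy, one_mul]
    have hd := H.duality hr hz (A := fun x => farCutoff c R x * F x) (B := fun x => u₀ x + h x)
      ⟨hχ.mul hFc, hχc.mul_right, Set.subset_univ _⟩ hB ?_ ?_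
    · have e1 : ∫ x in Metric.ball c r, u x * (εΩ * lap (fun x => u₀ x + h x) x
          - εm * lap (fun x => farCutoff c R x * F x) x) =
          -εm * ∫ x, u x * lap w x := by
        have e2 : ∫ x, u x * lap w x = ∫ x in Metric.ball c r, u x * lap w x := by
          rw [← integral_indicator measurableSet_ball]
          refine integral_congr_ae ?_
          filter_upwards [ae_notMem_sphere c r] with x hx
          by_cases hxb : x ∈ Metric.ball c r
          · rw [Set.indicator_of_mem hxb]
          · rw [Set.indicator_of_notMem hxb, T.lap_out x, mul_zero]
            rw [mem_ball_iff_norm, not_lt] at hxb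
            exact lt_of_le_of_ne hxb fun h => hx (mem_sphere_iff_norm.2 h.symm)
        rw [e2, ← integral_const_mul]
        refine setIntegral_congr_fun measurableSet_ball fun x hx => ?_
        rw [hBl x hx, lap_congr (hnear (mem_ball_iff_norm.1 hx).le), hFl, hψ0 hx]
        ring
      have e3 (x : R3) : u x * lap (fun x => farCutoff c R x * F x) x =
          -(diracMass : ℂ) * (u x * ψ x) + u x * lap w x
          + u x * (2 * (∑ i, pd i (farCutoff c R) x * pd i F x) + F x * lap (farCutoff c R) x) := by
        rw [lap_mul hχ hFc]
        -- Beyond radius `R` both `ψ` and `lap w` vanish, so the cutoff acts only where it equals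
        -- `1`.
        have e4 : farCutoff c R x * lap F x = lap F x := by
          rcases le_or_gt ‖x - c‖ R with hx | hx
          · rw [farCutoff_eq_one hR0 hx, one_mul]
          · have : ψ x = 0 := image_eq_zero_of_notMem_tsupport fun h' => by
              have := mem_closedBall_iff_norm.1 (hL h')
              linarith
            rw [hFl, this, T.lap_out x (hR.trans hx)]
            simp
        rw [e4, hFl]
        ring
      have i1 := hint hψ.1.continuous hψ.2.1
      have hwc : HasCompactSupport (lap w) :=
        HasCompactSupport.intro (isCompact_closedBall c r) fun x hx => by
          rw [mem_closedBall_iff_norm, not_le] at hx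
          exact T.lap_out x hx
      have i2 := hint hw.lap.continuous hwc
      have i3 : Integrable fun x => u x * (2 * (∑ i, pd i (farCutoff c R) x * pd i F x)
          + F x * lap (farCutoff c R) x) := by
        have hs1 : ContDiff ℝ ∞ fun x => ∑ i, pd i (farCutoff c R) x * pd i F x :=
          ContDiff.sum fun i _ => (hχ.pd i).mul (hFc.pd i)
        refine hint ((contDiff_const.mul hs1).add (hFc.mul hχ.lap)).continuous ?_
        refine HasCompactSupport.intro (isCompact_closedBall c (2 * R)) fun x hx => ?_
        rw [mem_closedBall_iff_norm, not_le] at hx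
        have := farCutoff_eventuallyEq_zero hR0 hx
        simp [pd_congr _ this, lap_congr this, pd_const, lap_const]
      rw [e1] at hd
      simp_rw [e3] at hd
      have i12 : Integrable fun x => -(diracMass : ℂ) * (u x * ψ x) + u x * lap w x :=
        (i1.const_mul _).add i2
      rw [integral_add i12 i3, integral_add (i1.const_mul _) i2,
        integral_const_mul] at hd
      refine mul_left_cancel₀ hm ?_
      linear_combination -hd
    · intro x hx
      have hx' := (mem_sphere_iff_norm.1 hx).le
      rw [(hnear hx').eq_of_nhds, hF]
      simp only [T.trace x hx]
    · intro x hx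
      have hx' := (mem_sphere_iff_norm.1 hx).le
      have e1 := T.flux x hx
      have e2 := T.ode x
      simp only [pd_congr _ (hnear hx'), hFp, mul_add, Finset.sum_add_distrib,
        pd_add _ (hu.differentiableAt_top x) (hh.differentiableAt_top x)]
      rw [e1]
      linear_combination (εΩ + εm) * e2
        - (h x - 2 * ∑ i, (((x - c) i : ℝ) : ℂ) * pd i u₀ x) * hs'
  have h0 := tendsto_nhds_unique (tendsto_const_nhds.congr' hev) hlim
  exact (mul_eq_zero.1 h0).resolve_left (by exact_mod_cast diracMass_pos.ne')

theorem ae_eq_zero_of_integral_complexTest {U : Set R3} (hU : IsOpen U)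
    (hu : LocallyIntegrable u) (h : ∀ ψ, IsComplexTest U ψ → ∫ x, u x * ψ x = 0) :
    ∀ᵐ x, x ∈ U → u x = 0 := by
  refine hU.ae_eq_zero_of_integral_contDiff_smul_eq_zero (hu.locallyIntegrableOn _)
    fun φ h1 h2 h3 => ?_
  rw [← h _ (IsTestFunction.complex ⟨h1, h2, h3⟩)]
  simp only [Complex.real_smul, mul_comm]

/-- Homogeneous solutions have vanishing gradient in the ball. -/
theorem IsHomogeneousSolution.grad_eq_zero
    (H : IsHomogeneousSolution c z r εΩ εm u g) (hr : 0 < r) (hz : r < ‖z - c‖) {s : ℂ}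
    (hs : s.re = 1 / 2) (hs' : s * (εΩ + εm) = εm) (hm : εm ≠ 0) (i : Fin 3) :
    ∀ᵐ x, x ∈ Metric.ball c r → g x i = 0 := by
  -- `εΩ = 0` would force `s = 1`, off the line.
  have hΩ : εΩ ≠ 0 := by
    rintro rfl
    rw [zero_add] at hs'
    have : s = 1 := mul_right_cancel₀ hm (by rw [hs', one_mul])
    rw [this] at hs
    norm_num at hs
  have hout : ∀ᵐ x, x ∈ (Metric.closedBall c r)ᶜ → u x = 0 :=
    ae_eq_zero_of_integral_complexTest Metric.isClosed_closedBall.isOpen_compl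
      H.locallyIntegrable fun ψ hψ => H.integral_exterior_eq_zero hr hz hs hs' hm hψ
  have hgout (i : Fin 3) : ∀ᵐ x, x ∉ Metric.ball c r → g x i = 0 := by
    have h1 := (H.weakGradient.mono (V := (Metric.closedBall c r)ᶜ ∩ {z}ᶜ)
      Set.inter_subset_right).ae_eq_zero
      (Metric.isClosed_closedBall.isOpen_compl.inter isOpen_compl_singleton)
      (by filter_upwards [hout] with x hx h using hx h.1) i
    have hz0 : ∀ᵐ x : R3, x ≠ z := by simp [ae_iff]
    filter_upwards [h1, ae_notMem_sphere c r, hz0] with x hx hxs hxz hxb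
    refine hx ⟨fun hc => ?_, hxz⟩
    rw [mem_ball_iff_norm, not_lt] at hxb
    exact hxs (mem_sphere_iff_norm.2 (le_antisymm (mem_closedBall_iff_norm.1 hc) hxb))
  have hin : ∀ᵐ x, x ∈ Metric.ball c r → u x = 0 := by
    refine ae_eq_zero_of_integral_complexTest Metric.isOpen_ball H.locallyIntegrable fun ψ hψ => ?_
    -- The potential of `ψ` is cut off between the sphere and `z`, to keep its support away from the
    -- point where the weak gradient is not available.
    let f : ContDiffBump c := ⟨r, (r + ‖z - c‖) / 2, hr, by linarith⟩
    set N := newtonPotential ψ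
    have hN : ContDiff ℝ ∞ N := newtonPotential_contDiff hψ.1 hψ.2.1
    have hf : ContDiff ℝ ∞ fun x => (f x : ℂ) := contDiff_ofReal_comp f.contDiff
    set φ : R3 → ℂ := fun x => (f x : ℂ) * N x with hφ
    have hφs : tsupport φ ⊆ Metric.closedBall c ((r + ‖z - c‖) / 2) := by
      refine closure_minimal (fun x hx => ?_) Metric.isClosed_closedBall
      by_contra hx'
      rw [Metric.mem_closedBall, not_le] at hx'
      apply hx
      rw [hφ]
      simp only
      rw [f.zero_of_le_dist hx'.le]
      simp
    have hφt : IsComplexTest {z}ᶜ φ := by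
      refine ⟨hf.mul hN, (isCompact_closedBall c _).of_isClosed_subset (isClosed_tsupport _) hφs,
        fun x hx hxz => ?_⟩
      have := hφs hx
      rw [Set.mem_singleton_iff.1 hxz, mem_closedBall_iff_norm] at this
      linarith
    have e1 := H.equation φ ⟨hφt.1, hφt.2.1, Set.subset_univ _⟩
    have e2 := H.weakGradient.integral_mul_lap hφt
    have e3 : ∫ x, ∑ i, g x i * pd i φ x = ∫ x in Metric.ball c r, ∑ i, g x i * pd i φ x := by
      rw [← integral_indicator measurableSet_ball]
      refine integral_congr_ae ?_
      filter_upwards [ae_all_iff.2 hgout] with x hx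
      by_cases hxb : x ∈ Metric.ball c r
      · rw [Set.indicator_of_mem hxb]
      · rw [Set.indicator_of_notMem hxb]
        exact Finset.sum_eq_zero fun i _ => by rw [hx i hxb, zero_mul]
    rw [transmissionForm, ← e3, ← neg_eq_iff_eq_neg.2 e2] at e1
    have e4 : ∫ x, u x * lap φ x = -(diracMass : ℂ) * ∫ x, u x * ψ x := by
      rw [← integral_const_mul]
      refine integral_congr_ae ?_
      filter_upwards [hout, ae_notMem_sphere c r] with x hx hxs
      rcases lt_trichotomy ‖x - c‖ r with h | h | h
      · have hxb : x ∈ Metric.ball c r := mem_ball_iff_norm.2 h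
        have : φ =ᶠ[𝓝 x] N := by
          filter_upwards [Metric.isOpen_ball.mem_nhds hxb] with y hy
          rw [hφ]
          simp only
          rw [f.one_of_mem_closedBall (Metric.ball_subset_closedBall hy)]
          simp
        rw [lap_congr this, lap_newtonPotential hψ.1 hψ.2.1]
        ring
      · exact absurd (mem_sphere_iff_norm.2 h) hxs
      · rw [hx fun hc => absurd (mem_closedBall_iff_norm.1 hc) (not_le.2 h)]
        ring
    -- The gradient vanishes outside the ball, so the integral over the ball is the full one, equal
    -- to `-∫ u Δφ`, and the two coefficients add up to `εΩ`.
    have e5 : εΩ * ∫ x, u x * lap φ x = 0 := by linear_combination e1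
    have e6 := (mul_eq_zero.1 e5).resolve_left hΩ
    rw [e4] at e6
    exact (mul_eq_zero.1 e6).resolve_left
      (neg_ne_zero.2 (by exact_mod_cast diracMass_pos.ne'))
  exact (H.weakGradient.mono (ball_subset_compl_singleton hz)).ae_eq_zero Metric.isOpen_ball hin i

end

/-! ### The line `Re s = 1/2`, uniqueness and the conclusion. -/

/-- If `λ = i δ`, then `ε_m / (ε_Ω + ε_m)` lies on the line `Re s = 1/2`. -/
theorem exists_re_eq_half_of_contrastParameter {εΩ : ℂ} {εm δ : ℝ} (hm : 0 < εm) (hδ : 0 < δ)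
    (h : contrastParameter εΩ εm = Complex.I * δ) :
    ∃ s : ℂ, s.re = 1 / 2 ∧ s * (εΩ + εm) = εm := by
  rw [contrastParameter_eq_iff εΩ εm δ hm hδ] at h
  have h1 : (2 * Complex.I * δ - 1 : ℂ) ≠ 0 := by
    intro h
    have := congrArg Complex.re h
    simp at this
  have h3 : (δ : ℂ) ≠ 0 := by exact_mod_cast hδ.ne'
  have hI := Complex.I_sq
  -- `εΩ + εm = 4iδ εm / (2iδ - 1)`, whence `s = (2iδ - 1)/(4iδ) = 1/2 + i/(4δ)`.
  refine ⟨⟨1 / 2, 1 / (4 * δ)⟩, rfl, ?_⟩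
  have hs : (⟨1 / 2, 1 / (4 * δ)⟩ : ℂ) = (2 * δ + Complex.I) / (4 * δ) := by
    have : (⟨1 / 2, 1 / (4 * δ)⟩ : ℂ) = 1 / 2 + 1 / (4 * δ) * Complex.I := by
      rw [Complex.mk_eq_add_mul_I]
      push_cast
      rfl
    rw [this]
    field_simp
    ring
  rw [hs, h, div_add' _ _ _ h1, div_mul_div_comm, div_eq_iff (mul_ne_zero (mul_ne_zero (by norm_num) h3) h1)]
  linear_combination 4 * (εm : ℂ) * δ * hI

theorem HasWeakGradientOn.sub {U : Set R3} {u₁ u₂ : R3 → ℂ} {g₁ g₂ : R3 → C3}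
    (h₁ : HasWeakGradientOn U u₁ g₁) (h₂ : HasWeakGradientOn U u₂ g₂) :
    HasWeakGradientOn U (fun x => u₁ x - u₂ x) fun x => g₁ x - g₂ x := by
  refine ⟨h₁.1.sub h₂.1, h₁.2.1.sub h₂.2.1, fun φ hφ i => ?_⟩
  have hc := hφ.complex
  have ip {u : R3 → ℂ} (hu : LocallyIntegrableOn u U) :
      Integrable fun x => u x * (partialDeriv i φ x : ℂ) := by
    simp_rw [← pd_ofReal i (hφ.1.contDiffAt.differentiableAt (by simp : (∞ : WithTop ℕ∞) ≠ 0))]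
    exact integrable_mul_of_tsupport_subset hu (hc.1.pd i).continuous (hc.2.1.pd i)
      ((tsupport_pd_subset i _).trans hc.2.2)
  have iq {u : R3 → ℂ} {g : R3 → C3} (h : HasWeakGradientOn U u g) :
      Integrable fun x => g x i * (φ x : ℂ) :=
    integrable_mul_of_tsupport_subset (h.integrable_grad_mul i) hc.1.continuous hc.2.1 hc.2.2
  simp only [PiLp.sub_apply, sub_mul]
  rw [integral_sub (ip h₁.1) (ip h₂.1), integral_sub (iq h₁) (iq h₂), h₁.2.2 φ hφ i,
    h₂.2.2 φ hφ i]
  ring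

theorem IsTransmissionSolution.integrableOn_grad {εΩ εm : ℂ} {a c z : R3} {r : ℝ} {u : R3 → ℂ}
    {g : R3 → C3} (h : IsTransmissionSolution (Metric.ball c r) εΩ εm a z u g)
    (hz : r < ‖z - c‖) (i : Fin 3) : IntegrableOn (fun x => g x i) (Metric.ball c r) := by
  refine ((h.weakGradient.integrable_grad_mul i).integrableOn_compact_subset ?_
    (isCompact_closedBall c r)).mono_set Metric.ball_subset_closedBall
  intro x hx hxz
  rw [Set.mem_singleton_iff.1 hxz, mem_closedBall_iff_norm] at hx
  linarith

/-- Decay at infinity does not depend on the choice of the origin. -/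
theorem exists_decay_recenter {u : R3 → ℂ}
    (h : ∃ M R : ℝ, ∀ᵐ x : R3, R ≤ ‖x‖ → ‖u x‖ ≤ M / ‖x‖ ^ 2) (c : R3) :
    ∃ M R : ℝ, 0 < R ∧ ∀ᵐ x : R3, R ≤ ‖x - c‖ → ‖u x‖ ≤ M / ‖x - c‖ ^ 2 := by
  obtain ⟨M, R, h⟩ := h
  refine ⟨4 * |M|, 2 * ‖c‖ + 2 * |R| + 1, by positivity, ?_⟩
  filter_upwards [h] with x hx hxR
  have h1 : ‖x - c‖ ≤ ‖x‖ + ‖c‖ := norm_sub_le _ _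
  have h2 := le_abs_self R
  have h3 := norm_nonneg c
  have h4 := abs_nonneg R
  have h5 : 0 < ‖x - c‖ := by linarith
  have h6 : ‖x - c‖ / 2 ≤ ‖x‖ := by linarith
  calc ‖u x‖ ≤ M / ‖x‖ ^ 2 := hx (by linarith)
    _ ≤ |M| / (‖x - c‖ / 2) ^ 2 := by
        gcongr
        exact le_abs_self M
    _ = 4 * |M| / ‖x - c‖ ^ 2 := by ring

theorem IsTransmissionSolution.sub {εΩ εm : ℂ} {a c z : R3} {r : ℝ} {u₁ u₂ : R3 → ℂ}
    {g₁ g₂ : R3 → C3} (h₁ : IsTransmissionSolution (Metric.ball c r) εΩ εm a z u₁ g₁)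
    (h₂ : IsTransmissionSolution (Metric.ball c r) εΩ εm a z u₂ g₂) (hz : r < ‖z - c‖) :
    IsHomogeneousSolution c z r εΩ εm (fun x => u₁ x - u₂ x) fun x => g₁ x - g₂ x := by
  refine ⟨h₁.locallyIntegrable.sub h₂.locallyIntegrable, h₁.weakGradient.sub h₂.weakGradient,
    fun φ hφ => ?_, ?_⟩
  · have e₁ := h₁.complex (h₁.integrableOn_grad hz) hφ
    have e₂ := h₂.complex (h₂.integrableOn_grad hz) hφ
    have iu {u : R3 → ℂ} (hu : LocallyIntegrable u) : Integrable fun x => u x * lap φ x :=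
      integrable_mul_of_tsupport_subset (U := Set.univ) (hu.locallyIntegrableOn _)
        hφ.1.lap.continuous hφ.2.1.lap (Set.subset_univ _)
    have ig {g : R3 → C3} (hg : ∀ i, IntegrableOn (fun x => g x i) (Metric.ball c r)) :
        IntegrableOn (fun x => ∑ i, g x i * pd i φ x) (Metric.ball c r) :=
      integrable_finsetSum _ fun i _ => integrableOn_mul_continuous (hg i) (hφ.1.pd i).continuous
    rw [transmissionForm] at e₁ e₂ ⊢
    simp only [PiLp.sub_apply, sub_mul, Finset.sum_sub_distrib]
    rw [integral_sub (iu h₁.locallyIntegrable) (iu h₂.locallyIntegrable),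
      integral_sub (ig (h₁.integrableOn_grad hz)) (ig (h₂.integrableOn_grad hz))]
    linear_combination e₁ - e₂
  · obtain ⟨M₁, R₁, -, k₁⟩ := exists_decay_recenter h₁.decay c
    obtain ⟨M₂, R₂, -, k₂⟩ := exists_decay_recenter h₂.decay c
    refine ⟨M₁ + M₂, max R₁ R₂, ?_⟩
    filter_upwards [k₁, k₂] with x hx₁ hx₂ hx
    rw [add_div]
    exact (norm_sub_le _ _).trans
      (add_le_add (hx₁ ((le_max_left _ _).trans hx)) (hx₂ ((le_max_right _ _).trans hx)))

/-- The inclusion does not see the choice of the solution: the gradient is unique there. -/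
theorem IsTransmissionSolution.grad_unique {εΩ εm : ℂ} {a c z : R3} {r : ℝ} {u₁ u₂ : R3 → ℂ}
    {g₁ g₂ : R3 → C3} (h₁ : IsTransmissionSolution (Metric.ball c r) εΩ εm a z u₁ g₁)
    (h₂ : IsTransmissionSolution (Metric.ball c r) εΩ εm a z u₂ g₂) (hr : 0 < r)
    (hz : r < ‖z - c‖) {s : ℂ} (hs : s.re = 1 / 2) (hs' : s * (εΩ + εm) = εm) (hm : εm ≠ 0) :
    ∀ᵐ x ∂volume.restrict (Metric.ball c r), g₁ x = g₂ x := by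
  rw [ae_restrict_iff' Metric.isOpen_ball.measurableSet]
  have h := ae_all_iff.2 ((h₁.sub h₂ hz).grad_eq_zero hr hz hs hs' hm)
  filter_upwards [h] with x hx hxb
  ext i
  exact sub_eq_zero.1 (hx i hxb)

theorem mainTheorem6
    (c : R3) (r : ℝ) (hr : 0 < r)
    (εm : ℝ) (hεm : 0 < εm)
    (a z : R3) (hz : z ∉ closure (Metric.ball c r)) :
    (∀ δ : ℝ, 0 < δ → ∀ εΩ : ℂ, contrastParameter εΩ εm = Complex.I * δ →
      ∃ (u : R3 → ℂ) (g : R3 → C3),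
        IsTransmissionSolution (Metric.ball c r) εΩ εm a z u g) ∧
    ∃ C : ℝ≥0, ∀ δ : ℝ, 0 < δ → ∀ εΩ : ℂ, contrastParameter εΩ εm = Complex.I * δ →
      ∀ (u : R3 → ℂ) (g : R3 → C3),
        IsTransmissionSolution (Metric.ball c r) εΩ εm a z u g →
          eLpNorm g 2 (volume.restrict (Metric.ball c r)) ≤ (C : ℝ≥0∞) := by
  rw [closure_ball c hr.ne', mem_closedBall_iff_norm, not_le] at hz
  obtain ⟨C, hC⟩ := exists_transmissionSolution (a := a) hr hz hεm
  refine ⟨fun δ hδ εΩ h => ?_, ?_⟩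
  · obtain ⟨s, hs, hs'⟩ := exists_re_eq_half_of_contrastParameter hεm hδ h
    obtain ⟨u, g, hug, -⟩ := hC s εΩ hs hs'
    exact ⟨u, g, hug⟩
  · have hfin : volume.restrict (Metric.ball c r) Set.univ ≠ ⊤ := by
      rw [Measure.restrict_apply_univ]
      exact measure_ball_lt_top.ne
    -- Square root of the volume times a pointwise bound: each of the three components of the
    -- constructed gradient is at most `C`.
    set B : ℝ≥0∞ := volume.restrict (Metric.ball c r) Set.univ ^ (2 : ℝ≥0∞).toReal⁻¹ *
      ENNReal.ofReal (3 * C) with hB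
    have hBt : B ≠ ⊤ := ENNReal.mul_ne_top (ENNReal.rpow_ne_top_of_nonneg (by positivity) hfin)
      ENNReal.ofReal_ne_top
    refine ⟨B.toNNReal, fun δ hδ εΩ h u g hug => ?_⟩
    rw [ENNReal.coe_toNNReal hBt]
    obtain ⟨s, hs, hs'⟩ := exists_re_eq_half_of_contrastParameter hεm hδ h
    obtain ⟨u₁, g₁, hug₁, hg₁⟩ := hC s εΩ hs hs'
    refine eLpNorm_le_of_ae_bound ?_
    filter_upwards [hug.grad_unique hug₁ hr hz hs hs' (Complex.ofReal_ne_zero.2 hεm.ne'),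
      ae_restrict_mem measurableSet_ball] with x hx hxb
    rw [hx]
    calc ‖g₁ x‖ ≤ ∑ i, ‖g₁ x i‖ := norm_le_sum_components _
      _ ≤ ∑ _i : Fin 3, C := Finset.sum_le_sum fun i _ => hg₁ x hxb i
      _ = 3 * C := by simp
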